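/- **Theorem (projected stochastic gradient descent).** There is a numerical constant $c>0$ such that the following holds for all $n,p$. Let $f:\mathbb{R}\to\mathbb{R}$ be measurable, and for a standard normal variable $g$ put $$\mu=\mathbb{E}[f(g)g],\qquad \sigma^2=\mathbb{E}[(f(g)-\mu g)^2],\qquad \gamma^2=\mathbb{E}[g^2(f(g)-\mu g)^2],\qquad \sigma,\gamma\ge 0,$$ where $\mathbb{E}[f(g)^2]$ and $\mathbb{E}[g^2f(g)^2]$ are assumed finite. For $\mathbf{g}\sim\mathcal{N}(0,I_n)$ let $b_n=\mathbb{E}\|\mathbf{g}\|$ and, for $\eta\in\mathbb{R}$, $$p(\eta)=\mathbb{P}\big(\|f(\mathbf{g})-\mu\mathbf{g}\|>\eta b_n\sigma\big)+\mathbb{P}\Big(|\mathbf{g}^T(f(\mathbf{g})-\mu\mathbf{g})|>\eta\tfrac{b_n^2}{\sqrt n}\gamma\Big),$$ with $f$ applied entrywise. Let $\theta^*\in\mathbb{R}^p$ with $\|\theta^*\|=1$, and let $X\in\mathbb{R}^{n\times p}$ have i.i.d. $\mathcal{N}(0,1)$ entries and rows $x_1,\dots,x_n$. Let $y_i=f(\langle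 x_i,\theta^*\rangle)$ for $1\le i\le n$. Let $\mathcal{R}:\mathbb{R}^p\to\mathbb{R}$ be convex, let $\mathcal{K}=\{\theta:\mathcal{R}(\theta)\le\mathcal{R}(\mu\theta^*)\}$, and let $\mathcal{P}_{\mathcal{K}}$ be the Euclidean projection onto $\mathcal{K}$. Let $\mathcal{C}$ be a cone of descent of $\mathcal{R}$ at $\mu\theta^*$, that is, any closed cone containing $\{h:\mathcal{R}(\mu\theta^*+h)\le\mathcal{R}(\mu\theta^*)\}$. For $t\ge0$ define $$n_0=\phi^{-1}(\omega+t),\qquad \omega=\mathbb{E}_{g\sim\mathcal{N}(0,I_p)}\Big[\sup_{z\in\mathcal{C},\,\|z\|\le1}\langle g,z\rangle\Big],\qquad \phi(s)=\sqrt2\,\frac{\Gamma(\frac{s+1}{2})}{\Gamma(\frac s2)}\ \ (s>0),\quad \phi(0)=0,$$ where $\phi^{-1}$ is the inverse of $\phi:[0,\infty)\to[0,\infty)$. Assume $n>n_0$. Fix any initial estimate $\theta_0\in\mathbb{R}^p$. Given $X$, let $\psi_1,\psi_2,\dots$ be independent random indices with $\mathbb{P}(\psi_s=i)=\|x_i\|^2/\|X\|_F^2$,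 and let $$\theta_s=\mathcal{P}_{\mathcal{K}}\Big(\theta_{s-1}+\frac{y_{\psi_s}-\langle x_{\psi_s},\theta_{s-1}\rangle}{\|x_{\psi_s}\|^2}\,x_{\psi_s}\Big),\qquad s\ge1.$$ Then, with probability over $X$ at least $1-(n+1)e^{-cp}-p(\eta)-\kappa e^{-t^2/2}$, where $\kappa=1$ if $\theta_0\in\mathcal{K}$ and $\kappa=2$ otherwise, for all $\tau\ge0$ simultaneously, $$\mathbb{E}\big[\|\theta_\tau-\mu\theta^*\|^2\big]\le\left(1-\frac{\big(1-\sqrt{n_0/n}\big)^2}{2p}\right)^{\tau}\|\theta_0-\mu\theta^*\|^2+\frac{1.01}{\big(1-\sqrt{n_0/n}\big)^2}\,\eta^2\sigma^2,$$ where the expectation is over $\psi_1,\dots,\psi_\tau$ with $X$ fixed. -/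

import Mathlib

open MeasureTheory ProbabilityTheory
open scoped RealInnerProductSpace

noncomputable section

/-- `ℝ^d` with the Euclidean norm. -/
abbrev Vec (d : ℕ) : Type := EuclideanSpace ℝ (Fin d)

/-- The set of descent of `R` at `θ`. -/
def descentSet {p : ℕ} (R : Vec p → ℝ) (θ : Vec p) : Set (Vec p) :=
  {h | R (θ + h) ≤ R θ}

/-- `C` is a cone of descent of `R` at `θ`: a closed cone containing the set of descent. -/
structure IsDescentCone {p : ℕ} (R : Vec p → ℝ) (θ : Vec p) (C : Set (Vec p)) : Prop where
  isClosed : IsClosed C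
  smul_mem : ∀ x ∈ C, ∀ a : ℝ, 0 ≤ a → a • x ∈ C
  descentSet_subset : descentSet R θ ⊆ C

/-- The Gaussian width `E sup_{z ∈ S} ⟨g, z⟩` with `g ∼ N(0, I_p)`. -/
def gaussianWidth {p : ℕ} (S : Set (Vec p)) : ℝ :=
  ∫ g, sSup ((fun z => ⟪g, z⟫) '' S) ∂(stdGaussian (Vec p))

/-- `φ(s) = √2 Γ((s+1)/2) / Γ(s/2)`. Note that `phi 0 = 0`, as `Real.Gamma 0 = 0`. -/
def phi (s : ℝ) : ℝ :=
  √2 * Real.Gamma ((s + 1) / 2) / Real.Gamma (s / 2)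

/-- The minimal number of samples `φ⁻¹(ω(C ∩ B) + t)`, where `φ⁻¹` is the inverse of
`φ : [0, ∞) → [0, ∞)` and `B` is the closed unit ball. -/
def minimalSamples {p : ℕ} (C : Set (Vec p)) (t : ℝ) : ℝ :=
  Function.invFunOn phi (Set.Ici 0) (gaussianWidth (C ∩ Metric.closedBall 0 1) + t)

/-- The mean term `μ = E[f(g) g]`. -/
def meanTerm (f : ℝ → ℝ) : ℝ :=
  ∫ g, f g * g ∂(gaussianReal 0 1)

/-- The variance term: `σ ≥ 0` with `σ² = E[(f(g) - μ g)²]`. -/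
def sigmaTerm (f : ℝ → ℝ) : ℝ :=
  √(∫ g, (f g - meanTerm f * g) ^ 2 ∂(gaussianReal 0 1))

/-- The deviation term: `γ ≥ 0` with `γ² = E[g² (f(g) - μ g)²]`. -/
def gammaTerm (f : ℝ → ℝ) : ℝ :=
  √(∫ g, g ^ 2 * (f g - meanTerm f * g) ^ 2 ∂(gaussianReal 0 1))

/-- `b_n = E ‖g‖` with `g ∼ N(0, I_n)`. -/
def meanNorm (n : ℕ) : ℝ :=
  ∫ g, ‖g‖ ∂(stdGaussian (Vec n))

/-- The vector `f(g) - μ g`, with `f` applied entrywise. -/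
def effectiveNoise (f : ℝ → ℝ) {n : ℕ} (g : Vec n) : Vec n :=
  WithLp.toLp 2 fun i => f (g i) - meanTerm f * g i

/-- The concentration probability function `p(η)`. -/
def concProb (f : ℝ → ℝ) (n : ℕ) (η : ℝ) : ℝ :=
  (stdGaussian (Vec n)).real {g | η * meanNorm n * sigmaTerm f < ‖effectiveNoise f g‖} +
  (stdGaussian (Vec n)).real
    {g | η * (meanNorm n ^ 2 / √(n : ℝ)) * gammaTerm f < |⟪g, effectiveNoise f g⟫|}

/-- The Euclidean projection of `z` onto `K`: a point of `K` closest to `z`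
(it exists and is unique when `K` is nonempty, closed and convex). -/
def projOnto {p : ℕ} (K : Set (Vec p)) (z : Vec p) : Vec p :=
  Classical.epsilon fun v => v ∈ K ∧ ∀ w ∈ K, ‖z - v‖ ≤ ‖z - w‖

/-- The `i`-th row `x_i` of the feature matrix, as a Euclidean vector. -/
def rowVec {n p : ℕ} (X : Matrix (Fin n) (Fin p) ℝ) (i : Fin n) : Vec p :=
  WithLp.toLp 2 (X i)

/-- The observations `y = f(X θ)`, that is, `y_i = f(⟨x_i, θ⟩)`. -/
def observations (f : ℝ → ℝ) {n p : ℕ} (X : Matrix (Fin n) (Fin p) ℝ) (θ : Vec p) :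
    Fin n → ℝ :=
  fun i => f ⟪rowVec X i, θ⟫

/-- One projected stochastic gradient step that uses the row `i`. -/
def psgdStep {n p : ℕ} (K : Set (Vec p)) (X : Matrix (Fin n) (Fin p) ℝ) (y : Fin n → ℝ)
    (i : Fin n) (θ : Vec p) : Vec p :=
  projOnto K (θ + ((y i - ⟪rowVec X i, θ⟫) / ‖rowVec X i‖ ^ 2) • rowVec X i)

/-- The iterate `θ_τ` started at `θ₀`, as a function of the first `τ` row indices. -/
def psgdIter {n p : ℕ} (K : Set (Vec p)) (X : Matrix (Fin n) (Fin p) ℝ) (y : Fin n → ℝ)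
    (θ₀ : Vec p) : (τ : ℕ) → (Fin τ → Fin n) → Vec p
  | 0, _ => θ₀
  | τ + 1, ψ => psgdStep K X y (ψ (Fin.last τ)) (psgdIter K X y θ₀ τ (Fin.init ψ))

/-- The law of a random row index: `i` has probability `‖x_i‖² / ‖X‖_F²`. -/
def rowLaw {n p : ℕ} (X : Matrix (Fin n) (Fin p) ℝ) : Measure (Fin n) :=
  ∑ i, ENNReal.ofReal (‖rowVec X i‖ ^ 2 / ∑ k, ‖rowVec X k‖ ^ 2) • Measure.dirac i

/-- `E ‖θ_τ - v‖²` for a fixed feature matrix, the expectation being over `τ` independent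
row indices with law `rowLaw X`. -/
def expectedSqError {n p : ℕ} (K : Set (Vec p)) (X : Matrix (Fin n) (Fin p) ℝ) (y : Fin n → ℝ)
    (θ₀ v : Vec p) (τ : ℕ) : ℝ :=
  ∫ ψ, ‖psgdIter K X y θ₀ τ ψ - v‖ ^ 2 ∂(Measure.pi fun _ : Fin τ => rowLaw X)

end

/-! ### Integrability, second moments and symmetries of the standard Gaussian measure. -/

section GaussianBasics

variable {E F : Type*} [NormedAddCommGroup E] [InnerProductSpace ℝ E] [FiniteDimensional ℝ E]
  [MeasurableSpace E] [BorelSpace E] [NormedAddCommGroup F] [InnerProductSpace ℝ F]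
  [FiniteDimensional ℝ F] [MeasurableSpace F] [BorelSpace F]

/-! Fix `X` and write v = μθ*, e = θ - v, w = y - Xv. Projecting onto K does not increase the
distance to v ∈ K, and expanding a step along the row x_i gives ‖x_i‖²‖e_new‖² ≤ ‖x_i‖²‖e‖² - ⟨x_i,
e⟩² + w_i²: the cross terms between noise and error cancel. Averaging with weights ‖x_i‖²/‖X‖_F²
gives E‖e_new‖² ≤ ‖e‖² - ‖Xe‖²/‖X‖_F² + ‖w‖²/‖X‖_F². If ‖Xe‖ ≥ m‖e‖ for every error that can occur,
iteration yields the rate 1 - m²/‖X‖_F² and the noise floor ‖w‖²/m² (`expectedSqError_le`). This is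
deterministic in `X` and covers all τ at once, so probability only has to supply three bounds.

Lower bound m. After the first step the errors lie in C, and Gordon's escape theorem
`stdGaussian_real_exists_norm_matVec_lt` gives ‖Xz‖ ≥ b_n - ω - t for unit z ∈ C. Since b_n = φ(n),
ω + t = φ(n₀) and φ(s)/√s is nondecreasing (`logGammaGap_mono`), m ≥ b_n(1 - √(n₀/n)). An initial
error outside the descent set is one more fixed direction, of width zero, and costs one more
e^{-t²/2}.

Frobenius norm. Concentration in dimension np gives ‖X‖_F ≤ 1.125√(np), and 1.125²/2 < 2/π ≤ b_n²/n
turns the rate into the stated one.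

Noise. Xθ* is a standard Gaussian vector, so ‖w‖ ≤ η b_n σ outside an event counted by p(η).

Gordon's theorem combines `integral_stdGaussian_comparison`, applied to a smoothed minimum of ‖Xz‖ +
γ against ‖h‖ - ⟨g, z⟩, with the sharp concentration bound `mgf_stdGaussian_le_of_lipschitz`. Both
rest on interpolating two independent Gaussian vectors along a quarter circle. -/

/-- Fernique's theorem handles `exp (C * ‖x‖ ^ 2)` for some positive `C`, and completing the square
dominates `exp (a * ‖x‖)` by a multiple of it. Exponential growth is the integrability test behind
the interpolation arguments. -/
lemma integrable_exp_mul_norm_stdGaussian (a : ℝ) :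
    Integrable (fun x : E => Real.exp (a * ‖x‖)) (stdGaussian E) := by
  obtain ⟨C, hC, h⟩ := IsGaussian.exists_integrable_exp_sq (stdGaussian E)
  refine (h.const_mul (Real.exp (a ^ 2 / (4 * C)))).mono' (by fun_prop) (ae_of_all _ fun x => ?_)
  rw [Real.norm_eq_abs, abs_of_pos (Real.exp_pos _), ← Real.exp_add]
  refine Real.exp_le_exp.2 ?_
  have : a ^ 2 / (4 * C) + C * ‖x‖ ^ 2 - a * ‖x‖ = (a - 2 * C * ‖x‖) ^ 2 / (4 * C) := by
    field_simp; ring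
  have := this ▸ (by positivity : 0 ≤ (a - 2 * C * ‖x‖) ^ 2 / (4 * C))
  linarith

lemma integrable_stdGaussian_of_le_exp {f : E → ℝ} (hf : AEStronglyMeasurable f (stdGaussian E))
    (C a : ℝ) (h : ∀ x, |f x| ≤ C * Real.exp (a * ‖x‖)) : Integrable f (stdGaussian E) :=
  ((integrable_exp_mul_norm_stdGaussian a).const_mul C).mono' hf (ae_of_all _ h)

lemma integrable_exp_mul_norm_add_norm (a : ℝ) :
    Integrable (fun z : E × F => Real.exp (a * (‖z.1‖ + ‖z.2‖)))
      ((stdGaussian E).prod (stdGaussian F)) := by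
  have := (integrable_exp_mul_norm_stdGaussian (E := E) a).mul_prod
    (integrable_exp_mul_norm_stdGaussian (E := F) a)
  simpa only [mul_add, Real.exp_add] using this

lemma integrable_prod_stdGaussian_of_le_exp {f : E × F → ℝ}
    (hf : AEStronglyMeasurable f ((stdGaussian E).prod (stdGaussian F)))
    (C a : ℝ) (h : ∀ x y, |f (x, y)| ≤ C * Real.exp (a * (‖x‖ + ‖y‖))) :
    Integrable f ((stdGaussian E).prod (stdGaussian F)) :=
  ((integrable_exp_mul_norm_add_norm a).const_mul C).mono' hf (ae_of_all _ fun z => h z.1 z.2)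

lemma integrable_norm_stdGaussian : Integrable (fun x : E => ‖x‖) (stdGaussian E) :=
  integrable_stdGaussian_of_le_exp (by fun_prop) 1 1 fun x => by
    rw [abs_norm, one_mul, one_mul]; linarith [Real.add_one_le_exp ‖x‖]

lemma integrable_stdGaussian_of_lipschitz {f : E → ℝ} {K : NNReal} (hf : LipschitzWith K f) :
    Integrable f (stdGaussian E) := by
  refine ((integrable_norm_stdGaussian.const_mul (K : ℝ)).add (integrable_const |f 0|)).mono'
    hf.continuous.aestronglyMeasurable (ae_of_all _ fun x => ?_)
  have := hf.dist_le_mul x 0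
  rw [Real.dist_eq, dist_zero_right] at this
  have h2 := abs_sub_abs_le_abs_sub (f x) (f 0)
  simp only [Pi.add_apply, Real.norm_eq_abs]
  linarith

lemma integral_inner_sq_stdGaussian (a : E) :
    ∫ x, ⟪a, x⟫ ^ 2 ∂(stdGaussian E) = ‖a‖ ^ 2 := by
  have h := variance_dual_stdGaussian (innerSL ℝ a)
  rw [variance_of_integral_eq_zero (by fun_prop) (integral_strongDual_stdGaussian _)] at h
  simpa using h

lemma integrable_inner_sq_stdGaussian (a : E) :
    Integrable (fun x => ⟪a, x⟫ ^ 2) (stdGaussian E) := by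
  have h : MemLp (innerSL ℝ a) 2 (stdGaussian E) := by
    have := (innerSL ℝ a).comp_memLp' (IsGaussian.memLp_two_id (μ := stdGaussian E))
    exact this
  simpa using h.integrable_sq

/-- A linear map with isometric adjoint `S` maps the standard Gaussian measure to the standard
Gaussian measure. -/
lemma map_stdGaussian_of_norm_adjoint (L : E →L[ℝ] F) (S : F → E)
    (hLS : ∀ x t, ⟪L x, t⟫ = ⟪x, S t⟫) (hS : ∀ t, ‖S t‖ = ‖t‖) :
    (stdGaussian E).map L = stdGaussian F := by
  have : IsProbabilityMeasure ((stdGaussian E).map L) :=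
    Measure.isProbabilityMeasure_map L.continuous.aemeasurable
  refine Measure.ext_of_charFun (funext fun t => ?_)
  rw [charFun_stdGaussian, charFun_apply, integral_map (by fun_prop) (by fun_prop)]
  simp_rw [hLS]
  rw [← charFun_apply, charFun_stdGaussian, hS]

/-- Pairing a Lipschitz function with a linear form under the standard Gaussian measure. -/
lemma integral_mul_inner_le_of_lipschitz {ψ : E → ℝ} {K : NNReal} (hψ : LipschitzWith K ψ)
    (a : E) : |∫ v, ψ v * ⟪a, v⟫ ∂(stdGaussian E)| ≤ K * ‖a‖ := by
  rcases eq_or_ne a 0 with rfl | ha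
  · simp
  have ha' : 0 < ‖a‖ := norm_pos_iff.2 ha
  -- This reflection preserves the measure and flips the sign of `⟪a, v⟫`, so `ψ` may be replaced by
  -- half of `ψ - ψ ∘ R`. Since `v - R v` is a multiple of `a`, the Lipschitz bound yields a
  -- multiple of `⟪a, v⟫ ^ 2` without differentiating `ψ`.
  set R := (Submodule.span ℝ {a})ᗮ.reflection with hR
  have hRv : ∀ v, R v = v - (2 * ⟪a, v⟫ / ‖a‖ ^ 2) • a := by
    intro v
    rw [hR, Submodule.reflection_orthogonal_apply, Submodule.reflection_singleton_apply]
    simp only [neg_sub, RCLike.ofReal_real_eq_id, id_eq]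
    rw [two_smul, ← add_smul]; congr 2; ring
  have hmap : (stdGaussian E).map R = stdGaussian E := stdGaussian_map R
  have hint : Integrable (fun v => ψ v * ⟪a, v⟫) (stdGaussian E) := by
    have h1 : MemLp ψ 2 (stdGaussian E) := by
      refine ((IsGaussian.memLp_two_id (μ := stdGaussian E)).norm.const_mul (K : ℝ) |>.add
        (memLp_const |ψ 0|)).mono' hψ.continuous.aestronglyMeasurable (ae_of_all _ fun x => ?_)
      have := hψ.dist_le_mul x 0
      rw [Real.dist_eq, dist_zero_right] at this
      have h2 := abs_sub_abs_le_abs_sub (ψ x) (ψ 0)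
      simp only [Pi.add_apply, Real.norm_eq_abs, id]
      linarith
    have h2 : MemLp (fun v => ⟪a, v⟫) 2 (stdGaussian E) :=
      (innerSL ℝ a).comp_memLp' (IsGaussian.memLp_two_id (μ := stdGaussian E))
    exact h1.integrable_mul h2
  have hRa : ∀ v, ⟪a, R v⟫ = -⟪a, v⟫ := by
    intro v
    rw [hRv, inner_sub_right, inner_smul_right, real_inner_self_eq_norm_sq]
    field_simp; ring
  have hint2 : Integrable (fun v => ψ (R v) * ⟪a, v⟫) (stdGaussian E) := by
    have h := hint
    rw [← hmap] at h
    have h := (h.comp_measurable R.continuous.measurable).neg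
    refine h.congr (ae_of_all _ fun v => ?_)
    simp [hRa]
  have e1 : ∫ v, ψ v * ⟪a, v⟫ ∂(stdGaussian E) = -∫ v, ψ (R v) * ⟪a, v⟫ ∂(stdGaussian E) := by
    rw [← hmap, integral_map R.continuous.aemeasurable
      (by rw [hmap]; exact hint.aestronglyMeasurable), hmap, ← integral_neg]
    refine integral_congr_ae (ae_of_all _ fun v => ?_)
    simp [hRa]
  have e2 : ∫ v, ψ v * ⟪a, v⟫ ∂(stdGaussian E)
      = ∫ v, (ψ v - ψ (R v)) * ⟪a, v⟫ / 2 ∂(stdGaussian E) := by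
    have : ∀ v, (ψ v - ψ (R v)) * ⟪a, v⟫ / 2
        = (ψ v * ⟪a, v⟫ - ψ (R v) * ⟪a, v⟫) * (1 / 2) := fun v => by ring
    simp_rw [this]
    rw [integral_mul_const, integral_sub hint hint2]
    linarith
  rw [e2]
  have hb : ∀ v, |(ψ v - ψ (R v)) * ⟪a, v⟫ / 2| ≤ K / ‖a‖ * ⟪a, v⟫ ^ 2 := by
    intro v
    have h1 := hψ.dist_le_mul v (R v)
    rw [Real.dist_eq, dist_eq_norm, hRv, sub_sub_cancel, norm_smul, Real.norm_eq_abs, abs_div,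
      abs_mul, abs_two, abs_of_pos (by positivity : 0 < ‖a‖ ^ 2)] at h1
    rw [hRv, abs_div, abs_mul, abs_two, ← sq_abs ⟪a, v⟫]
    calc _ ≤ (K * (2 * |⟪a, v⟫| / ‖a‖ ^ 2 * ‖a‖)) * |⟪a, v⟫| / 2 := by gcongr
      _ = _ := by field_simp
  calc |∫ v, (ψ v - ψ (R v)) * ⟪a, v⟫ / 2 ∂(stdGaussian E)|
      ≤ ∫ v, |(ψ v - ψ (R v)) * ⟪a, v⟫ / 2| ∂(stdGaussian E) := abs_integral_le_integral_abs
    _ ≤ ∫ v, K / ‖a‖ * ⟪a, v⟫ ^ 2 ∂(stdGaussian E) := by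
        refine integral_mono_of_nonneg (ae_of_all _ fun v => abs_nonneg _)
          ((integrable_inner_sq_stdGaussian a).const_mul _) (ae_of_all _ hb)
    _ = K * ‖a‖ := by
        rw [integral_const_mul, integral_inner_sq_stdGaussian]; field_simp

lemma integral_rotation_stdGaussian {f : E × E → ℝ} (hf : Continuous f) (θ : ℝ) :
    ∫ z, f (ContinuousLinearMap.rotation θ z) ∂((stdGaussian E).prod (stdGaussian E))
      = ∫ z, f z ∂((stdGaussian E).prod (stdGaussian E)) := by
  have h := IsGaussian.map_rotation_eq_self (μ := stdGaussian E)
    (by simp [integral_id_stdGaussian]) θ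
  conv_rhs => rw [← h]
  rw [integral_map (by fun_prop) hf.aestronglyMeasurable]

end GaussianBasics

/-! ### Gaussian concentration for Lipschitz functions. -/

section GaussianConcentration

set_option linter.unusedSectionVars false

variable {E : Type*} [NormedAddCommGroup E] [InnerProductSpace ℝ E] [FiniteDimensional ℝ E]
  [MeasurableSpace E] [BorelSpace E]

lemma LipschitzWith.abs_le_mul_exp_norm {F : E → ℝ} {K : NNReal} (hF : LipschitzWith K F) (x : E) :
    |F x| ≤ (|F 0| + K) * Real.exp ‖x‖ := by
  have := hF.dist_le_mul x 0
  rw [Real.dist_eq, dist_zero_right] at this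
  have h2 := abs_sub_abs_le_abs_sub (F x) (F 0)
  have h3 := Real.add_one_le_exp ‖x‖
  have h4 : (1 : ℝ) ≤ Real.exp ‖x‖ := Real.one_le_exp (norm_nonneg _)
  have h5 : (K : ℝ) * ‖x‖ ≤ K * Real.exp ‖x‖ := by gcongr; linarith
  have h6 : |F 0| * 1 ≤ |F 0| * Real.exp ‖x‖ := by gcongr
  linarith

lemma norm_cos_smul_add_sin_smul_le (t : ℝ) (x y : E) :
    ‖Real.cos t • x + Real.sin t • y‖ ≤ ‖x‖ + ‖y‖ := by
  refine (norm_add_le _ _).trans ?_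
  rw [norm_smul, norm_smul]
  have h1 := Real.abs_cos_le_one t
  have h2 := Real.abs_sin_le_one t
  exact add_le_add (mul_le_of_le_one_left (norm_nonneg _) h1)
    (mul_le_of_le_one_left (norm_nonneg _) h2)

lemma norm_neg_sin_smul_add_cos_smul_le (t : ℝ) (x y : E) :
    ‖-Real.sin t • x + Real.cos t • y‖ ≤ ‖x‖ + ‖y‖ := by
  refine (norm_add_le _ _).trans ?_
  rw [norm_smul, norm_smul, norm_neg]
  have h1 := Real.abs_cos_le_one t
  have h2 := Real.abs_sin_le_one t
  exact add_le_add (mul_le_of_le_one_left (norm_nonneg _) h2)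
    (mul_le_of_le_one_left (norm_nonneg _) h1)

lemma hasDerivAt_cos_smul_add_sin_smul (t : ℝ) (x y : E) :
    HasDerivAt (fun t : ℝ => Real.cos t • x + Real.sin t • y)
      (-Real.sin t • x + Real.cos t • y) t :=
  ((Real.hasDerivAt_cos t).smul_const x).add ((Real.hasDerivAt_sin t).smul_const y)

/-- A covariance bound for a Lipschitz function and a smooth function of a Gaussian vector. -/
theorem integral_mul_le_add_integral_norm_fderiv {F k : E → ℝ} {K : NNReal}
    (hF : LipschitzWith K F) {D : E → E →L[ℝ] ℝ} (hk : ∀ x, HasFDerivAt k (D x) x)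
    (hD : Continuous D) {C a : ℝ} (ha : 0 ≤ a) (hkC : ∀ x, |k x| ≤ C * Real.exp (a * ‖x‖))
    (hDC : ∀ x, ‖D x‖ ≤ C * Real.exp (a * ‖x‖)) :
    ∫ x, F x * k x ∂(stdGaussian E) ≤
      (∫ x, F x ∂(stdGaussian E)) * (∫ x, k x ∂(stdGaussian E))
        + K * ∫ x, ‖D x‖ ∂(stdGaussian E) := by
  set G := stdGaussian E with hG
  have hC : 0 ≤ C := by
    have := (norm_nonneg _).trans (hDC 0)
    simpa using this
  have hkc : Continuous k := continuous_iff_continuousAt.2 fun x => (hk x).continuousAt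
  have hFc := hF.continuous
  set c := |F 0| + K with hc
  have hc0 : 0 ≤ c := by positivity
  have hDint : Integrable (fun x => ‖D x‖) G :=
    integrable_stdGaussian_of_le_exp (by fun_prop) C a fun x => by rw [abs_norm]; exact hDC x
  have hFb : ∀ x y : E, |F x| ≤ c * Real.exp (‖x‖ + ‖y‖) := fun x y =>
    (hF.abs_le_mul_exp_norm x).trans (by gcongr; linarith [norm_nonneg y])
  -- Interpolate from `k` at the same vector (t = 0) to `k` at an independent copy (t = π/2). Only
  -- the argument of `k` moves, so `F` need not be differentiable.
  let g : ℝ → E × E → ℝ := fun t z => F z.1 * k (Real.cos t • z.1 + Real.sin t • z.2)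
  let g' : ℝ → E × E → ℝ := fun t z =>
    F z.1 * D (Real.cos t • z.1 + Real.sin t • z.2) (-Real.sin t • z.1 + Real.cos t • z.2)
  have hgc : ∀ t, Continuous (g t) := fun t => by fun_prop
  have hg'c : ∀ t, Continuous (g' t) := fun t => by
    refine (by fun_prop : Continuous fun z : E × E => F z.1).mul ?_
    exact Continuous.clm_apply (by fun_prop) (by fun_prop)
  have hgint : ∀ t, Integrable (g t) (G.prod G) := fun t => by
    refine integrable_prod_stdGaussian_of_le_exp (hgc t).aestronglyMeasurable (c * C) (a + 1)
      fun x y => ?_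
    have h1 := hkC (Real.cos t • x + Real.sin t • y)
    have h2 := norm_cos_smul_add_sin_smul_le t x y
    calc |g t (x, y)| = |F x| * |k (Real.cos t • x + Real.sin t • y)| := abs_mul _ _
      _ ≤ (c * Real.exp (‖x‖ + ‖y‖)) * (C * Real.exp (a * (‖x‖ + ‖y‖))) := by
          refine mul_le_mul (hFb x y) (h1.trans ?_) (abs_nonneg _) (by positivity)
          gcongr
      _ = c * C * Real.exp ((a + 1) * (‖x‖ + ‖y‖)) := by
          generalize ‖x‖ + ‖y‖ = r
          rw [show (a + 1) * r = a * r + r by ring, Real.exp_add]; ring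
  have hg'b : ∀ t x y, |g' t (x, y)| ≤ c * C * Real.exp ((a + 2) * (‖x‖ + ‖y‖)) := by
    intro t x y
    have h1 := hDC (Real.cos t • x + Real.sin t • y)
    have h2 := norm_cos_smul_add_sin_smul_le t x y
    have h3 := norm_neg_sin_smul_add_cos_smul_le t x y
    have h4 := Real.add_one_le_exp (‖x‖ + ‖y‖)
    calc |g' t (x, y)| = |F x| * ‖D (Real.cos t • x + Real.sin t • y)
            (-Real.sin t • x + Real.cos t • y)‖ := abs_mul _ _
      _ ≤ (c * Real.exp (‖x‖ + ‖y‖)) * ((C * Real.exp (a * (‖x‖ + ‖y‖))) *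
            Real.exp (‖x‖ + ‖y‖)) := by
          refine mul_le_mul (hFb x y) ((ContinuousLinearMap.le_opNorm _ _).trans ?_)
            (norm_nonneg _) (by positivity)
          refine mul_le_mul (h1.trans ?_) (by linarith) (norm_nonneg _) (by positivity)
          gcongr
      _ = c * C * Real.exp ((a + 2) * (‖x‖ + ‖y‖)) := by
          generalize ‖x‖ + ‖y‖ = r
          rw [show (a + 2) * r = a * r + (r + r) by ring, Real.exp_add, Real.exp_add]; ring
  let h : ℝ → ℝ := fun t => ∫ z, g t z ∂(G.prod G)
  have hderiv : ∀ t, HasDerivAt h (∫ z, g' t z ∂(G.prod G)) t := by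
    intro t
    refine (hasDerivAt_integral_of_dominated_loc_of_deriv_le (F := g) (F' := g')
      (bound := fun z : E × E => c * C * Real.exp ((a + 2) * (‖z.1‖ + ‖z.2‖)))
      Filter.univ_mem (Filter.Eventually.of_forall fun s => (hgc s).aestronglyMeasurable)
      (hgint t) (hg'c t).aestronglyMeasurable (ae_of_all _ fun z s _ => hg'b s z.1 z.2)
      ((integrable_exp_mul_norm_add_norm _).const_mul _)
      (ae_of_all _ fun z s _ => ?_)).2
    exact ((hk _).comp_hasDerivAt s (hasDerivAt_cos_smul_add_sin_smul s z.1 z.2)).const_mul (F z.1)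
  have hlow : ∀ t, 0 ≤ Real.sin t →
      -(Real.sin t * (K * ∫ x, ‖D x‖ ∂G)) ≤ ∫ z, g' t z ∂(G.prod G) := by
    intro t ht
    -- In the rotated coordinates (u, v), again independent standard Gaussians, the derivative is
    -- F(cos t u - sin t v) D(u)v. For fixed u this pairs a linear form in v with a function of
    -- Lipschitz constant K sin t, as in `integral_mul_inner_le_of_lipschitz`.
    let Q : E × E → ℝ := fun z => F (Real.cos t • z.1 - Real.sin t • z.2) * D z.1 z.2
    have hQc : Continuous Q := by
      refine (by fun_prop : Continuous fun z : E × E =>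
        F (Real.cos t • z.1 - Real.sin t • z.2)).mul ?_
      exact Continuous.clm_apply (by fun_prop) (by fun_prop)
    have hQ : ∀ z, g' t z = Q (ContinuousLinearMap.rotation t z) := by
      intro z
      have : Real.cos t • (Real.cos t • z.1 + Real.sin t • z.2)
          - Real.sin t • (-Real.sin t • z.1 + Real.cos t • z.2) = z.1 := by
        calc _ = (Real.sin t ^ 2 + Real.cos t ^ 2) • z.1 := by module
          _ = z.1 := by rw [Real.sin_sq_add_cos_sq, one_smul]
      simp only [g', Q, ContinuousLinearMap.rotation_apply, this]
    have hQint : Integrable Q (G.prod G) := by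
      have h0 : Integrable (g' t) (G.prod G) :=
        integrable_prod_stdGaussian_of_le_exp (hg'c t).aestronglyMeasurable _ _ (hg'b t)
      have h1 := IsGaussian.map_rotation_eq_self (μ := G)
        (by simp [hG, integral_id_stdGaussian]) t
      rw [← h1]
      refine (integrable_map_measure hQc.aestronglyMeasurable (by fun_prop)).2 ?_
      exact h0.congr (ae_of_all _ hQ)
    have e : ∫ z, g' t z ∂(G.prod G) = ∫ u, ∫ v, Q (u, v) ∂G ∂G := by
      rw [← integral_prod _ hQint, ← integral_rotation_stdGaussian hQc t]
      exact integral_congr_ae (ae_of_all _ hQ)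
    rw [e, ← integral_const_mul, ← integral_const_mul, ← integral_neg]
    refine integral_mono ((hDint.const_mul _).const_mul _).neg hQint.integral_prod_left
      fun u => ?_
    set d := (InnerProductSpace.toDual ℝ E).symm (D u) with hd
    have hdn : ‖d‖ = ‖D u‖ := by rw [hd, LinearIsometryEquiv.norm_map]
    have hdv : ∀ v, D u v = ⟪d, v⟫ := fun v => by
      rw [hd, InnerProductSpace.toDual_symm_apply]
    have hlip : LipschitzWith (K * (Real.sin t).toNNReal)
        (fun v => F (Real.cos t • u - Real.sin t • v)) := by
      refine hF.comp (LipschitzWith.of_dist_le_mul fun v w => ?_)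
      rw [dist_sub_left, dist_smul₀, Real.norm_eq_abs, abs_of_nonneg ht, Real.coe_toNNReal _ ht]
    have := integral_mul_inner_le_of_lipschitz hlip d
    rw [hdn] at this
    have h2 := (abs_le.1 this).1
    simp only [Q, hdv]
    refine le_trans (le_of_eq ?_) h2
    rw [NNReal.coe_mul, Real.coe_toNNReal _ ht]
    ring
  have hmono : MonotoneOn (fun t => h t - Real.cos t * (K * ∫ x, ‖D x‖ ∂G))
      (Set.Icc 0 (Real.pi / 2)) := by
    have hd2 : ∀ t, HasDerivAt (fun t => h t - Real.cos t * (K * ∫ x, ‖D x‖ ∂G))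
      ((∫ z, g' t z ∂(G.prod G)) - -Real.sin t * (K * ∫ x, ‖D x‖ ∂G)) t := fun t =>
      (hderiv t).sub ((Real.hasDerivAt_cos t).mul_const _)
    refine monotoneOn_of_deriv_nonneg (convex_Icc _ _)
      (fun t _ => (hd2 t).continuousAt.continuousWithinAt)
      (fun t _ => (hd2 t).differentiableAt.differentiableWithinAt) fun t ht => ?_
    rw [interior_Icc] at ht
    rw [(hd2 t).deriv]
    have := hlow t (Real.sin_nonneg_of_nonneg_of_le_pi ht.1.le
      (by linarith [ht.2, Real.pi_pos]))
    linarith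
  have hfin := hmono (Set.left_mem_Icc.2 (by positivity)) (Set.right_mem_Icc.2 (by positivity))
    (by positivity)
  have h0 : h 0 = ∫ x, F x * k x ∂G := by
    simp only [h, g, Real.cos_zero, Real.sin_zero, one_smul, zero_smul, add_zero]
    have := integral_fun_fst (μ := G) (ν := G) (fun x => F x * k x)
    simpa using this
  have h1 : h (Real.pi / 2) = (∫ x, F x ∂G) * ∫ x, k x ∂G := by
    simp only [h, g, Real.cos_pi_div_two, Real.sin_pi_div_two, one_smul, zero_smul, zero_add]
    exact integral_prod_mul F k
  simp only [h0, h1, Real.cos_zero, Real.cos_pi_div_two] at hfin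
  linarith

/-- The moment generating function of a smooth Lipschitz function of a Gaussian vector. -/
theorem mgf_stdGaussian_le_of_lipschitz {F : E → ℝ} (hF : LipschitzWith 1 F)
    (hF1 : ContDiff ℝ 1 F) {l : ℝ} (hl : 0 ≤ l) :
    mgf F (stdGaussian E) l ≤ Real.exp (l * (∫ x, F x ∂(stdGaussian E)) + l ^ 2 / 2) := by
  set G := stdGaussian E with hG
  have hFb : ∀ x, |F x| ≤ |F 0| + ‖x‖ := fun x => by
    have := hF.dist_le_mul x 0
    rw [Real.dist_eq, dist_zero_right] at this
    have h2 := abs_sub_abs_le_abs_sub (F x) (F 0)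
    simp at this
    linarith
  have hexp : ∀ (s : ℝ) x, Real.exp (s * F x) ≤ Real.exp (|s| * |F 0|) * Real.exp (|s| * ‖x‖) := by
    intro s x
    rw [← Real.exp_add, ← mul_add]
    refine Real.exp_le_exp.2 ((le_abs_self _).trans ?_)
    rw [abs_mul]
    exact mul_le_mul_of_nonneg_left (hFb x) (abs_nonneg _)
  have hint : ∀ s, Integrable (fun x => Real.exp (s * F x)) G := fun s =>
    integrable_stdGaussian_of_le_exp
      (by have := hF.continuous; exact Continuous.aestronglyMeasurable (by fun_prop)) _ _
      fun x => by rw [abs_of_pos (Real.exp_pos _)]; exact hexp s x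
  have hset : integrableExpSet F G = Set.univ := Set.eq_univ_of_forall hint
  have hdm : ∀ s, HasDerivAt (mgf F G) (∫ x, F x * Real.exp (s * F x) ∂G) s := fun s =>
    hasDerivAt_mgf (by rw [hset]; simp)
  set m := ∫ x, F x ∂G with hm
  -- The covariance bound with k = exp(sF), whose gradient has norm at most s exp(sF), gives M' ≤ (m
  -- + s)M. Equality holds for exp(sm + s²/2), so dividing by that function gives a nonincreasing
  -- quotient.
  have hbound : ∀ s, 0 ≤ s → ∫ x, F x * Real.exp (s * F x) ∂G ≤ (m + s) * mgf F G s := by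
    intro s hs
    have hfd : ∀ x, HasFDerivAt F (fderiv ℝ F x) x := fun x =>
      (hF1.differentiable one_ne_zero).differentiableAt.hasFDerivAt
    have hk : ∀ x, HasFDerivAt (fun x => Real.exp (s * F x))
        (Real.exp (s * F x) • s • fderiv ℝ F x) x := fun x => ((hfd x).const_mul s).exp
    have hfn : ∀ x, ‖fderiv ℝ F x‖ ≤ 1 := fun x => by
      simpa using norm_fderiv_le_of_lipschitz ℝ hF (x₀ := x)
    have hDn : ∀ x, ‖Real.exp (s * F x) • s • fderiv ℝ F x‖ ≤ s * Real.exp (s * F x) := by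
      intro x
      rw [norm_smul, norm_smul, Real.norm_of_nonneg hs, Real.norm_of_nonneg (Real.exp_pos _).le]
      nlinarith [hfn x, mul_nonneg hs (Real.exp_pos (s * F x)).le]
    have hc1 := hF1.continuous_fderiv one_ne_zero
    have hFc := hF.continuous
    have := integral_mul_le_add_integral_norm_fderiv hF hk (by fun_prop)
      (C := (1 + s) * Real.exp (|s| * |F 0|)) (a := |s|) (abs_nonneg s)
      (fun x => by
        rw [abs_of_pos (Real.exp_pos _), mul_assoc]
        refine (hexp s x).trans ?_
        have : 0 ≤ Real.exp (|s| * |F 0|) * Real.exp (|s| * ‖x‖) := by positivity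
        nlinarith)
      (fun x => by
        refine (hDn x).trans ?_
        rw [mul_assoc]
        have h1 := hexp s x
        exact mul_le_mul (by linarith) h1 (Real.exp_pos _).le (by linarith))
    refine this.trans ?_
    have h3 : ∫ x, ‖Real.exp (s * F x) • s • fderiv ℝ F x‖ ∂G ≤ s * mgf F G s := by
      rw [mgf, ← integral_const_mul]
      exact integral_mono_of_nonneg (ae_of_all _ fun x => norm_nonneg _)
        ((hint s).const_mul s) (ae_of_all _ hDn)
    simp only [NNReal.coe_one, one_mul]
    rw [add_mul]
    exact add_le_add le_rfl h3
  have hanti : AntitoneOn (fun s => mgf F G s * Real.exp (-(s * m + s ^ 2 / 2))) (Set.Ici 0) := by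
    have hd : ∀ s, HasDerivAt (fun s => mgf F G s * Real.exp (-(s * m + s ^ 2 / 2)))
        ((∫ x, F x * Real.exp (s * F x) ∂G) * Real.exp (-(s * m + s ^ 2 / 2)) +
          mgf F G s * (Real.exp (-(s * m + s ^ 2 / 2)) * -(m + s))) s := by
      intro s
      have h2 : HasDerivAt (fun s : ℝ => -(s * m + s ^ 2 / 2)) (-(m + s)) s := by
        exact (((hasDerivAt_id s).mul_const m).add
          ((hasDerivAt_pow 2 s).div_const 2)).neg.congr_deriv (by simp)
      exact (hdm s).mul h2.exp
    refine antitoneOn_of_deriv_nonpos (convex_Ici 0)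
      (fun t _ => (hd t).continuousAt.continuousWithinAt)
      (fun t _ => (hd t).differentiableAt.differentiableWithinAt) fun s hs => ?_
    rw [interior_Ici] at hs
    rw [(hd s).deriv]
    have h1 := hbound s (le_of_lt hs)
    have h2 := Real.exp_pos (-(s * m + s ^ 2 / 2))
    nlinarith
  have := hanti (Set.mem_Ici.2 le_rfl) (Set.mem_Ici.2 hl) hl
  simp only [mgf_zero, zero_mul, ne_eq, OfNat.ofNat_ne_zero, not_false_eq_true, zero_pow, zero_div,
    add_zero, neg_zero, Real.exp_zero, mul_one] at this
  rw [Real.exp_neg, ← div_eq_mul_inv, div_le_one (Real.exp_pos _)] at this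
  exact this

/-- Gaussian concentration for smooth Lipschitz functions, upper tail. -/
theorem stdGaussian_real_ge_le_of_lipschitz {F : E → ℝ} (hF : LipschitzWith 1 F)
    (hF1 : ContDiff ℝ 1 F) {t : ℝ} (ht : 0 ≤ t) :
    (stdGaussian E).real {x | (∫ x, F x ∂(stdGaussian E)) + t ≤ F x} ≤ Real.exp (-t ^ 2 / 2) := by
  have hint : Integrable (fun x => Real.exp (t * F x)) (stdGaussian E) :=
    integrable_stdGaussian_of_le_exp
      (by have := hF.continuous; exact Continuous.aestronglyMeasurable (by fun_prop))
      (Real.exp (t * |F 0|)) t fun x => by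
        rw [abs_of_pos (Real.exp_pos _), ← Real.exp_add, ← mul_add]
        refine Real.exp_le_exp.2 (mul_le_mul_of_nonneg_left ?_ ht)
        have := hF.dist_le_mul x 0
        rw [Real.dist_eq, dist_zero_right] at this
        have h2 := abs_sub_abs_le_abs_sub (F x) (F 0)
        simp at this
        linarith [le_abs_self (F x)]
  -- Chernoff's bound with parameter l = t, the minimiser of -l(m + t) + lm + l²/2.
  refine (measure_ge_le_exp_mul_mgf _ ht hint).trans ?_
  refine (mul_le_mul_of_nonneg_left (mgf_stdGaussian_le_of_lipschitz hF hF1 ht)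
    (Real.exp_pos _).le).trans ?_
  rw [← Real.exp_add]
  refine Real.exp_le_exp.2 (le_of_eq ?_)
  ring

/-- Gaussian concentration for smooth Lipschitz functions, lower tail. -/
theorem stdGaussian_real_le_le_of_lipschitz {F : E → ℝ} (hF : LipschitzWith 1 F)
    (hF1 : ContDiff ℝ 1 F) {t : ℝ} (ht : 0 ≤ t) :
    (stdGaussian E).real {x | F x ≤ (∫ x, F x ∂(stdGaussian E)) - t} ≤ Real.exp (-t ^ 2 / 2) := by
  have h := stdGaussian_real_ge_le_of_lipschitz (F := fun x => -F x)
    (LipschitzWith.of_dist_le_mul fun x y => by rw [dist_neg_neg]; exact hF.dist_le_mul x y)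
    hF1.neg ht
  refine le_trans (le_of_eq ?_) h
  congr 1
  ext x
  simp only [Set.mem_ofPred_eq, integral_neg]
  constructor <;> intro h <;> linarith

end GaussianConcentration

/-! ### Gaussian integration by parts and comparison of Gaussian processes. -/

section GaussianComparison

/-- Gaussian integration by parts on the line. -/
lemma integral_id_mul_gaussianReal {ψ ψ' : ℝ → ℝ} (hψ : ∀ s, HasDerivAt ψ (ψ' s) s)
    (hψ' : Continuous ψ') {C : ℝ} (hC : ∀ s, |ψ s| ≤ C) (hC' : ∀ s, |ψ' s| ≤ C) :
    ∫ s, s * ψ s ∂(gaussianReal 0 1) = ∫ s, ψ' s ∂(gaussianReal 0 1) := by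
  have hψc : Continuous ψ := continuous_iff_continuousAt.2 fun x => (hψ x).continuousAt
  rw [integral_gaussianReal_eq_integral_smul one_ne_zero,
    integral_gaussianReal_eq_integral_smul one_ne_zero]
  simp only [smul_eq_mul]
  have hpc : Continuous (gaussianPDFReal 0 1) := by
    rw [gaussianPDFReal_def]; fun_prop
  have hpd : ∀ s, HasDerivAt (gaussianPDFReal 0 1) (-(s * gaussianPDFReal 0 1 s)) s := by
    intro s
    rw [gaussianPDFReal_def]
    have h1 : HasDerivAt (fun x : ℝ => -(x - 0) ^ 2 / (2 * ((1 : NNReal) : ℝ))) (-s) s := by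
      have := (((hasDerivAt_id s).sub_const 0).pow 2).neg.div_const (2 * ((1 : NNReal) : ℝ))
      refine this.congr_deriv ?_
      simp only [id_eq, NNReal.coe_one]
      norm_num
      ring
    exact (h1.exp.const_mul _).congr_deriv (by ring)
  have hpi : Integrable (gaussianPDFReal 0 1) := integrable_gaussianPDFReal 0 1
  have hspi : Integrable fun s => s * gaussianPDFReal 0 1 s := by
    have := integrable_mul_exp_neg_mul_sq (b := 1 / 2) (by norm_num)
    refine (this.const_mul (√(2 * Real.pi * (1 : NNReal)))⁻¹).congr (ae_of_all _ fun s => ?_)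
    simp only [gaussianPDFReal_def]
    rw [show -(s - 0) ^ 2 / (2 * ((1 : NNReal) : ℝ)) = -(1 / 2) * s ^ 2 by
      rw [NNReal.coe_one]; ring]
    ring
  have key := integral_mul_deriv_eq_deriv_mul_of_integrable (u := ψ) (u' := ψ')
    (v := gaussianPDFReal 0 1) (v' := fun s => -(s * gaussianPDFReal 0 1 s))
    (fun x _ => hψ x) (fun x _ => hpd x)
    (hspi.neg.bdd_mul hψc.aestronglyMeasurable (ae_of_all _ hC))
    (hpi.bdd_mul hψ'.aestronglyMeasurable (ae_of_all _ hC'))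
    (hpi.bdd_mul hψc.aestronglyMeasurable (ae_of_all _ hC))
  calc _ = -∫ s, ψ s * -(s * gaussianPDFReal 0 1 s) := by
        rw [← integral_neg]; congr 1; ext s; ring
    _ = ∫ s, ψ' s * gaussianPDFReal 0 1 s := by rw [key, neg_neg]
    _ = _ := by congr 1; ext s; ring

variable {E F : Type*} [NormedAddCommGroup E] [InnerProductSpace ℝ E] [FiniteDimensional ℝ E]
  [MeasurableSpace E] [BorelSpace E] [NormedAddCommGroup F] [InnerProductSpace ℝ F]
  [FiniteDimensional ℝ F] [MeasurableSpace F] [BorelSpace F]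

/-- Resampling one coordinate of a standard Gaussian vector. -/
lemma map_resample_stdGaussian {e : E} (he : ‖e‖ = 1) :
    ((stdGaussian E).prod (gaussianReal 0 1)).map (fun z => z.1 - ⟪e, z.1⟫ • e + z.2 • e)
      = stdGaussian E := by
  have hm : Continuous (fun z : E × ℝ => z.1 - ⟪e, z.1⟫ • e + z.2 • e) := by fun_prop
  have : IsProbabilityMeasure (((stdGaussian E).prod (gaussianReal 0 1)).map
      (fun z => z.1 - ⟪e, z.1⟫ • e + z.2 • e)) :=
    Measure.isProbabilityMeasure_map hm.aemeasurable
  refine Measure.ext_of_charFun (funext fun t => ?_)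
  rw [charFun_stdGaussian, charFun_apply, integral_map hm.aemeasurable (by fun_prop)]
  have h1 : ∀ z : E × ℝ, Complex.exp (⟪z.1 - ⟪e, z.1⟫ • e + z.2 • e, t⟫ * Complex.I)
      = Complex.exp (⟪z.1, t - ⟪e, t⟫ • e⟫ * Complex.I) *
        Complex.exp (⟪e, t⟫ * z.2 * Complex.I) := by
    intro z
    rw [← Complex.exp_add, ← add_mul]
    congr 2
    norm_cast
    rw [inner_add_left, inner_sub_left, inner_sub_right, inner_smul_left, inner_smul_left,
      inner_smul_right, real_inner_comm z.1 e]
    simp only [conj_trivial]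
    ring
  simp_rw [h1]
  rw [integral_prod_mul (fun x : E => Complex.exp (⟪x, t - ⟪e, t⟫ • e⟫ * Complex.I))
    (fun s : ℝ => Complex.exp (⟪e, t⟫ * s * Complex.I)), ← charFun_apply, ← charFun_apply_real,
    charFun_stdGaussian, charFun_gaussianReal, ← Complex.exp_add]
  congr 1
  have h2 : ‖t - ⟪e, t⟫ • e‖ ^ 2 = ‖t‖ ^ 2 - ⟪e, t⟫ ^ 2 := by
    rw [norm_sub_sq_real, norm_smul, inner_smul_right, he, real_inner_comm e t]
    simp; ring
  have h3 : ((‖t - ⟪e, t⟫ • e‖ : ℝ) : ℂ) ^ 2 = (‖t‖ : ℂ) ^ 2 - (⟪e, t⟫ : ℂ) ^ 2 := by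
    exact_mod_cast h2
  rw [h3]
  simp
  ring

/-- Gaussian integration by parts in the direction of a unit vector. -/
lemma integral_inner_mul_stdGaussian {e : E} (he : ‖e‖ = 1) {ψ ψ' : E → ℝ}
    (hψ : ∀ x, HasDerivAt (fun s : ℝ => ψ (x + s • e)) (ψ' x) 0) (hψc : Continuous ψ)
    (hψ' : Continuous ψ') {C : ℝ} (hC : ∀ x, |ψ x| ≤ C) (hC' : ∀ x, |ψ' x| ≤ C) :
    ∫ x, ⟪e, x⟫ * ψ x ∂(stdGaussian E) = ∫ x, ψ' x ∂(stdGaussian E) := by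
  set G := stdGaussian E with hG
  set γ := gaussianReal 0 1 with hγ
  -- The component of `T z` along `e` is the fresh variable `z.2`, so Fubini reduces the claim to
  -- integration by parts on the line with `z.1` fixed.
  let T : E × ℝ → E := fun z => z.1 - ⟪e, z.1⟫ • e + z.2 • e
  have hT : Continuous T := by fun_prop
  have hmap : (G.prod γ).map T = G := map_resample_stdGaussian he
  have hint1 : Integrable (fun x => ⟪e, x⟫ * ψ x) G := by
    have h1 : Integrable (fun x => ⟪e, x⟫) G :=
      ((innerSL ℝ e).integrable_comp (IsGaussian.integrable_id (μ := G)) :)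
    exact h1.mul_bdd hψc.aestronglyMeasurable (ae_of_all _ hC)
  have hint2 : Integrable ψ' G :=
    (integrable_const C).mono' hψ'.aestronglyMeasurable (ae_of_all _ hC')
  have heT : ∀ z, ⟪e, T z⟫ = z.2 := by
    intro z
    simp only [T]
    rw [inner_add_right, inner_sub_right, inner_smul_right, inner_smul_right,
      real_inner_self_eq_norm_sq, he]
    ring
  have hi1 : Integrable (fun z : E × ℝ => z.2 * ψ (T z)) (G.prod γ) := by
    rw [← hmap] at hint1
    refine (hint1.comp_measurable hT.measurable).congr (ae_of_all _ fun z => ?_)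
    simp [heT]
  have hi2 : Integrable (fun z : E × ℝ => ψ' (T z)) (G.prod γ) := by
    rw [← hmap] at hint2
    exact hint2.comp_measurable hT.measurable
  have e1 : ∫ x, ⟪e, x⟫ * ψ x ∂G = ∫ x, ∫ s, s * ψ (T (x, s)) ∂γ ∂G := by
    conv_lhs => rw [← hmap]
    rw [integral_map hT.aemeasurable (by fun_prop), ← integral_prod _ hi1]
    simp_rw [heT]
  have e2 : ∫ x, ψ' x ∂G = ∫ x, ∫ s, ψ' (T (x, s)) ∂γ ∂G := by
    conv_lhs => rw [← hmap]
    rw [integral_map hT.aemeasurable (by fun_prop), ← integral_prod _ hi2]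
  rw [e1, e2]
  congr 1
  ext x
  refine integral_id_mul_gaussianReal (fun s => ?_) (by fun_prop) (fun s => hC _) (fun s => hC' _)
  have h := hψ (T (x, s))
  have h2 : HasDerivAt (fun r : ℝ => ψ (T (x, s) + (r - s) • e)) (ψ' (T (x, s))) s := by
    have h3 : HasDerivAt (fun r : ℝ => r - s) 1 s := (hasDerivAt_id s).sub_const s
    have h4 := HasDerivAt.comp (h := fun r : ℝ => r - s) s
      (h₂ := fun s : ℝ => ψ (T (x, _) + s • e)) (by simpa using h) h3
    exact h4.congr_deriv (mul_one _)
  refine h2.congr_of_eventuallyEq (Filter.Eventually.of_forall fun r => ?_)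
  simp only [T]
  congr 1
  module

variable {V : Type*} [NormedAddCommGroup V] [NormedSpace ℝ V]

/-- Integration by parts for a gradient paired with a linear image of a Gaussian vector. -/
lemma integral_clm_apply_stdGaussian {I : Type*} [Fintype I]
    {D : V → V →L[ℝ] ℝ} {D2 : V → V → ℝ} (hD : Continuous D)
    (hD2 : ∀ x u, HasDerivAt (fun s : ℝ => D (x + s • u) u) (D2 x u) 0)
    (hD2c : ∀ u, Continuous fun x => D2 x u) {M : ℝ} (hM : ∀ x, ‖D x‖ ≤ M)
    (hM2 : ∀ u, ∃ C, ∀ x, |D2 x u| ≤ C) (A : EuclideanSpace ℝ I →L[ℝ] V) (c : ℝ) (b : V)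
    (u : I → V) (hu : ∀ x, A x = ∑ i, x i • u i) :
    ∫ x, D (c • A x + b) (A x) ∂(stdGaussian (EuclideanSpace ℝ I))
      = c * ∫ x, ∑ i, D2 (c • A x + b) (u i) ∂(stdGaussian (EuclideanSpace ℝ I)) := by
  classical
  set G := stdGaussian (EuclideanSpace ℝ I) with hG
  let e : I → EuclideanSpace ℝ I := fun i => EuclideanSpace.single i 1
  have he : ∀ i, ‖e i‖ = 1 := fun i => by simp [e]
  have hAe : ∀ i, A (e i) = u i := fun i => by
    rw [hu, Finset.sum_eq_single i]
    · simp [e]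
    · intro j _ hj; simp [e, hj]
    · simp
  have hx : ∀ (x : EuclideanSpace ℝ I) i, x i = ⟪e i, x⟫ := fun x i => by
    simp [e, EuclideanSpace.inner_single_left]
  have hDu : ∀ i, Continuous fun x : EuclideanSpace ℝ I => D (c • A x + b) (u i) := fun i =>
    Continuous.clm_apply (by fun_prop) (by fun_prop)
  have hDb : ∀ i (x : EuclideanSpace ℝ I), |D (c • A x + b) (u i)| ≤ M * ‖u i‖ := fun i x =>
    ((D _).le_opNorm _).trans (mul_le_mul_of_nonneg_right (hM _) (norm_nonneg _))
  have key : ∀ i, ∫ x, x i * D (c • A x + b) (u i) ∂G = c * ∫ x, D2 (c • A x + b) (u i) ∂G := by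
    intro i
    obtain ⟨C, hC⟩ := hM2 (u i)
    rw [← integral_const_mul]
    simp_rw [hx _ i]
    refine integral_inner_mul_stdGaussian (he i) (fun x => ?_) (hDu i)
      (by have := hD2c (u i); fun_prop) (C := max (M * ‖u i‖) (|c| * C))
      (fun x => (hDb i x).trans (le_max_left _ _)) (fun x => ?_)
    · have h1 := hD2 (c • A x + b) (u i)
      have h2 : HasDerivAt (fun s : ℝ => c * s) c 0 := by
        simpa using (hasDerivAt_id (0 : ℝ)).const_mul c
      have h3 := HasDerivAt.comp (h := fun s : ℝ => c * s) (0 : ℝ)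
        (h₂ := fun s : ℝ => D (c • A x + b + s • u i) (u i)) (by simpa using h1) h2
      refine (h3.congr_deriv (mul_comm _ _)).congr_of_eventuallyEq
        (Filter.Eventually.of_forall fun s => ?_)
      simp only [Function.comp_apply, map_add, map_smul, hAe]
      congr 2
      module
    · rw [abs_mul]
      exact (mul_le_mul_of_nonneg_left (hC _) (abs_nonneg c)).trans (le_max_right _ _)
  have hint : ∀ i, Integrable (fun x : EuclideanSpace ℝ I => x i * D (c • A x + b) (u i)) G := by
    intro i
    have h1 : Integrable (fun x : EuclideanSpace ℝ I => x i) G := by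
      simp_rw [hx _ i]
      exact ((innerSL ℝ (e i)).integrable_comp (IsGaussian.integrable_id (μ := G)) :)
    exact h1.mul_bdd (hDu i).aestronglyMeasurable (ae_of_all _ (hDb i))
  have hint2 : ∀ i, Integrable (fun x : EuclideanSpace ℝ I => D2 (c • A x + b) (u i)) G := by
    intro i
    obtain ⟨C, hC⟩ := hM2 (u i)
    exact (integrable_const C).mono'
      (Continuous.aestronglyMeasurable (by have := hD2c (u i); fun_prop))
      (ae_of_all _ fun x => hC _)
  rw [integral_finsetSum _ fun i _ => hint2 i, Finset.mul_sum]
  simp_rw [← key]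
  rw [← integral_finsetSum _ fun i _ => hint i]
  congr 1
  ext x
  conv_lhs => rw [hu x]
  rw [← hu x, hu x, map_sum]
  simp [← hu x]

/-- **Gaussian comparison.** If the second derivatives of `Φ` traced along the covariance of the
first Gaussian vector dominate those traced along the covariance of the second one, then
`E Φ` is larger for the first vector. -/
theorem integral_stdGaussian_comparison {I J : Type*} [Fintype I] [Fintype J]
    {Φ : V → ℝ} {D : V → V →L[ℝ] ℝ} {D2 : V → V → ℝ} (hΦ : ∀ x, HasFDerivAt Φ (D x) x)
    (hD : Continuous D)
    (hD2 : ∀ x u, HasDerivAt (fun s : ℝ => D (x + s • u) u) (D2 x u) 0)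
    (hD2c : ∀ u, Continuous fun x => D2 x u) {M : ℝ} (hM : ∀ x, ‖D x‖ ≤ M)
    (hM2 : ∀ u, ∃ C, ∀ x, |D2 x u| ≤ C)
    (A : EuclideanSpace ℝ I →L[ℝ] V) (B : EuclideanSpace ℝ J →L[ℝ] V)
    (u : I → V) (hu : ∀ x, A x = ∑ i, x i • u i) (v : J → V) (hv : ∀ x, B x = ∑ i, x i • v i)
    (htr : ∀ x, ∑ j, D2 x (v j) ≤ ∑ i, D2 x (u i)) :
    ∫ y, Φ (B y) ∂(stdGaussian (EuclideanSpace ℝ J))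
      ≤ ∫ x, Φ (A x) ∂(stdGaussian (EuclideanSpace ℝ I)) := by
  set G := stdGaussian (EuclideanSpace ℝ I) with hG
  set H := stdGaussian (EuclideanSpace ℝ J) with hH
  have hM0 : 0 ≤ M := (norm_nonneg _).trans (hM 0)
  have hΦlip : LipschitzWith M.toNNReal Φ :=
    lipschitzWith_of_nnnorm_fderiv_le (𝕜 := ℝ) (fun x => (hΦ x).differentiableAt) fun x => by
      rw [(hΦ x).fderiv, ← NNReal.coe_le_coe, coe_nnnorm, Real.coe_toNNReal _ hM0]; exact hM x
  have hΦc := hΦlip.continuous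
  -- Move from A x at t = 0 to B y at t = π/2 with x, y independent. After integration by parts, the
  -- derivative of E Φ(w) is sin t cos t times the expected trace along `v` minus the trace along
  -- `u`, hence nonpositive.
  let w : ℝ → EuclideanSpace ℝ I × EuclideanSpace ℝ J → V := fun t z =>
    Real.cos t • A z.1 + Real.sin t • B z.2
  let w' : ℝ → EuclideanSpace ℝ I × EuclideanSpace ℝ J → V := fun t z =>
    -Real.sin t • A z.1 + Real.cos t • B z.2
  have hw : ∀ t, Continuous (w t) := fun t => by fun_prop
  have hw' : ∀ t, Continuous (w' t) := fun t => by fun_prop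
  set K := ‖A‖ + ‖B‖ with hK
  have hAB : ∀ (a b : ℝ) x y, |a| ≤ 1 → |b| ≤ 1 →
      ‖a • A x + b • B y‖ ≤ K * Real.exp (1 * (‖x‖ + ‖y‖)) := by
    intro a b x y ha hb
    have h1 := A.le_opNorm x
    have h2 := B.le_opNorm y
    have h3 := Real.add_one_le_exp (‖x‖ + ‖y‖)
    have h4 : ‖a • A x‖ ≤ ‖A x‖ := by
      rw [norm_smul]; exact mul_le_of_le_one_left (norm_nonneg _) ha
    have h5 : ‖b • B y‖ ≤ ‖B y‖ := by
      rw [norm_smul]; exact mul_le_of_le_one_left (norm_nonneg _) hb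
    have h6 : ‖A‖ * ‖x‖ ≤ ‖A‖ * Real.exp (‖x‖ + ‖y‖) := by
      gcongr; linarith [norm_nonneg y]
    have h7 : ‖B‖ * ‖y‖ ≤ ‖B‖ * Real.exp (‖x‖ + ‖y‖) := by
      gcongr; linarith [norm_nonneg x]
    rw [one_mul, hK, add_mul]
    linarith [norm_add_le (a • A x) (b • B y)]
  have hgint : ∀ t, Integrable (fun z => Φ (w t z)) (G.prod H) := by
    intro t
    refine integrable_prod_stdGaussian_of_le_exp (Continuous.aestronglyMeasurable (by fun_prop))
      (|Φ 0| + M * K) 1 fun x y => ?_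
    have h1 := hΦlip.dist_le_mul (w t (x, y)) 0
    rw [Real.dist_eq, dist_zero_right, Real.coe_toNNReal _ hM0] at h1
    have h2 := abs_sub_abs_le_abs_sub (Φ (w t (x, y))) (Φ 0)
    have h3 := mul_le_mul_of_nonneg_left
      (hAB _ _ x y (Real.abs_cos_le_one t) (Real.abs_sin_le_one t)) hM0
    have h4 : |Φ 0| * 1 ≤ |Φ 0| * Real.exp (1 * (‖x‖ + ‖y‖)) := by
      gcongr; exact Real.one_le_exp (by positivity)
    simp only [w] at *
    rw [add_mul]
    linarith
  have hg'c : ∀ t, Continuous (fun z => D (w t z) (w' t z)) := fun t =>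
    Continuous.clm_apply (by fun_prop) (by fun_prop)
  have hDb : ∀ z (a b : ℝ) x y, |a| ≤ 1 → |b| ≤ 1 →
      |D z (a • A x + b • B y)| ≤ M * K * Real.exp (1 * (‖x‖ + ‖y‖)) := by
    intro z a b x y ha hb
    refine ((D z).le_opNorm _).trans ?_
    rw [mul_assoc]
    exact mul_le_mul (hM _) (hAB _ _ x y ha hb) (norm_nonneg _) hM0
  let h : ℝ → ℝ := fun t => ∫ z, Φ (w t z) ∂(G.prod H)
  have hderiv : ∀ t, HasDerivAt h (∫ z, D (w t z) (w' t z) ∂(G.prod H)) t := by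
    intro t
    refine (hasDerivAt_integral_of_dominated_loc_of_deriv_le (F := fun t z => Φ (w t z))
      (F' := fun t z => D (w t z) (w' t z))
      (bound := fun z => M * K * Real.exp (1 * (‖z.1‖ + ‖z.2‖)))
      Filter.univ_mem (Filter.Eventually.of_forall fun s =>
        Continuous.aestronglyMeasurable (by fun_prop))
      (hgint t) (hg'c t).aestronglyMeasurable (ae_of_all _ fun z s _ => hDb _ _ _ z.1 z.2
        (by rw [abs_neg]; exact Real.abs_sin_le_one s) (Real.abs_cos_le_one s))
      ((integrable_exp_mul_norm_add_norm _).const_mul _)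
      (ae_of_all _ fun z s _ => ?_)).2
    exact (hΦ _).comp_hasDerivAt s
      (((Real.hasDerivAt_cos s).smul_const _).add ((Real.hasDerivAt_sin s).smul_const _))
  have hi1 : ∀ t, Integrable (fun z => D (w t z) (A z.1)) (G.prod H) := fun t =>
    integrable_prod_stdGaussian_of_le_exp
      (Continuous.aestronglyMeasurable (Continuous.clm_apply (by fun_prop) (by fun_prop))) _ 1
      fun x y => by simpa using hDb (w t (x, y)) 1 0 x y (by simp) (by simp)
  have hi2 : ∀ t, Integrable (fun z => D (w t z) (B z.2)) (G.prod H) := fun t =>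
    integrable_prod_stdGaussian_of_le_exp
      (Continuous.aestronglyMeasurable (Continuous.clm_apply (by fun_prop) (by fun_prop))) _ 1
      fun x y => by simpa using hDb (w t (x, y)) 0 1 x y (by simp) (by simp)
  have hi3 : ∀ t u, Integrable (fun z => D2 (w t z) u) (G.prod H) := by
    intro t u
    obtain ⟨C, hC⟩ := hM2 u
    exact (integrable_const C).mono'
      (Continuous.aestronglyMeasurable (by have := hD2c u; fun_prop)) (ae_of_all _ fun x => hC _)
  have ea : ∀ t, ∫ z, D (w t z) (A z.1) ∂(G.prod H)
      = Real.cos t * ∫ z, ∑ i, D2 (w t z) (u i) ∂(G.prod H) := by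
    intro t
    rw [integral_prod_symm _ (hi1 t), integral_prod_symm _ (integrable_finsetSum _ fun i _ =>
      hi3 t (u i)), ← integral_const_mul]
    congr 1
    ext y
    exact integral_clm_apply_stdGaussian hD hD2 hD2c hM hM2 A (Real.cos t) (Real.sin t • B y) u hu
  have eb : ∀ t, ∫ z, D (w t z) (B z.2) ∂(G.prod H)
      = Real.sin t * ∫ z, ∑ i, D2 (w t z) (v i) ∂(G.prod H) := by
    intro t
    rw [integral_prod _ (hi2 t), integral_prod _ (integrable_finsetSum _ fun i _ =>
      hi3 t (v i)), ← integral_const_mul]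
    congr 1
    ext x
    have := integral_clm_apply_stdGaussian hD hD2 hD2c hM hM2 B (Real.sin t) (Real.cos t • A x) v hv
    simpa only [w, add_comm] using this
  have hle : ∀ t, 0 ≤ Real.sin t → 0 ≤ Real.cos t →
      ∫ z, D (w t z) (w' t z) ∂(G.prod H) ≤ 0 := by
    intro t hs hc
    have e : ∫ z, D (w t z) (w' t z) ∂(G.prod H)
        = -Real.sin t * ∫ z, D (w t z) (A z.1) ∂(G.prod H)
          + Real.cos t * ∫ z, D (w t z) (B z.2) ∂(G.prod H) := by
      rw [← integral_const_mul, ← integral_const_mul,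
        ← integral_add ((hi1 t).const_mul _) ((hi2 t).const_mul _)]
      simp [w']
    rw [e, ea, eb]
    have := integral_mono (integrable_finsetSum _ fun i _ => hi3 t (v i))
      (integrable_finsetSum _ fun i _ => hi3 t (u i)) (fun z => htr (w t z))
    nlinarith [mul_nonneg hs hc]
  have hanti : AntitoneOn h (Set.Icc 0 (Real.pi / 2)) := by
    refine antitoneOn_of_deriv_nonpos (convex_Icc _ _)
      (fun t _ => (hderiv t).continuousAt.continuousWithinAt)
      (fun t _ => (hderiv t).differentiableAt.differentiableWithinAt) fun t ht => ?_
    rw [interior_Icc] at ht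
    rw [(hderiv t).deriv]
    exact hle t (Real.sin_nonneg_of_nonneg_of_le_pi ht.1.le (by linarith [ht.2, Real.pi_pos]))
      (Real.cos_nonneg_of_neg_pi_div_two_le_of_le (by linarith [ht.1, Real.pi_pos]) ht.2.le)
  have hfin := hanti (Set.left_mem_Icc.2 (by positivity)) (Set.right_mem_Icc.2 (by positivity))
    (by positivity)
  have h0 : h 0 = ∫ x, Φ (A x) ∂G := by
    simp only [h, w, Real.cos_zero, Real.sin_zero, one_smul, zero_smul, add_zero]
    have := integral_fun_fst (μ := G) (ν := H) (fun x => Φ (A x))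
    simpa using this
  have h1 : h (Real.pi / 2) = ∫ x, Φ (B x) ∂H := by
    simp only [h, w, Real.cos_pi_div_two, Real.sin_pi_div_two, one_smul, zero_smul, zero_add]
    have := integral_fun_snd (μ := G) (ν := H) (fun x => Φ (B x))
    simpa using this
  rwa [h0, h1] at hfin

end GaussianComparison

/-! ### Smoothed norms and minima, with their first two derivatives. -/

section SmoothMin

set_option linter.unusedSectionVars false

/-- A smooth approximation of the norm. -/
noncomputable def smoothNorm {H : Type*} [NormedAddCommGroup H] (ε : ℝ) (a : H) : ℝ :=
  √(‖a‖ ^ 2 + ε ^ 2)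

/-- A smooth approximation of the minimum of finitely many numbers. -/
noncomputable def softMin {ι : Type*} [Fintype ι] (β : ℝ) (r : ι → ℝ) : ℝ :=
  -(1 / β) * Real.log (∑ z, Real.exp (-β * r z))

section SmoothNorm

variable {H : Type*} [NormedAddCommGroup H] [InnerProductSpace ℝ H] {ε : ℝ}

omit [InnerProductSpace ℝ H] in
lemma smoothNorm_pos (hε : 0 < ε) (a : H) : 0 < smoothNorm ε a :=
  Real.sqrt_pos.2 (by positivity)

omit [InnerProductSpace ℝ H] in
lemma smoothNorm_sq (a : H) : smoothNorm ε a ^ 2 = ‖a‖ ^ 2 + ε ^ 2 :=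
  Real.sq_sqrt (by positivity)

omit [InnerProductSpace ℝ H] in
lemma norm_le_smoothNorm (a : H) : ‖a‖ ≤ smoothNorm ε a :=
  Real.le_sqrt_of_sq_le (by nlinarith [sq_nonneg ε])

omit [InnerProductSpace ℝ H] in
lemma le_smoothNorm (a : H) : ε ≤ smoothNorm ε a :=
  Real.le_sqrt_of_sq_le (by nlinarith [sq_nonneg ‖a‖])

omit [InnerProductSpace ℝ H] in
lemma smoothNorm_le (hε : 0 < ε) (a : H) : smoothNorm ε a ≤ ‖a‖ + ε :=
  Real.sqrt_le_iff.2 ⟨by positivity, by nlinarith [mul_nonneg (norm_nonneg a) hε.le]⟩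

lemma contDiff_smoothNorm (hε : 0 < ε) {m : WithTop ℕ∞} :
    ContDiff ℝ m (smoothNorm ε : H → ℝ) := by
  unfold smoothNorm
  exact ((contDiff_norm_sq ℝ).add contDiff_const).sqrt fun x => by positivity

omit [InnerProductSpace ℝ H] in
lemma abs_smoothNorm_sub_le (hε : 0 < ε) (a b : H) :
    |smoothNorm ε a - smoothNorm ε b| ≤ ‖a - b‖ := by
  have ha := smoothNorm_pos hε a
  have hb := smoothNorm_pos hε b
  have h1 := smoothNorm_sq (ε := ε) a
  have h2 := smoothNorm_sq (ε := ε) b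
  refine le_trans ?_ (abs_norm_sub_norm_le a b)
  have h3 : (smoothNorm ε a - smoothNorm ε b) * (smoothNorm ε a + smoothNorm ε b)
      = (‖a‖ - ‖b‖) * (‖a‖ + ‖b‖) := by nlinarith
  have h4 := congrArg abs h3
  rw [abs_mul, abs_mul, abs_of_pos (add_pos ha hb),
    abs_of_nonneg (add_nonneg (norm_nonneg a) (norm_nonneg b))] at h4
  have h5 := norm_le_smoothNorm (ε := ε) a
  have h6 := norm_le_smoothNorm (ε := ε) b
  have h7 : |smoothNorm ε a - smoothNorm ε b| * (smoothNorm ε a + smoothNorm ε b)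
      ≤ |‖a‖ - ‖b‖| * (smoothNorm ε a + smoothNorm ε b) := by
    rw [h4]; exact mul_le_mul_of_nonneg_left (by linarith) (abs_nonneg _)
  exact le_of_mul_le_mul_right h7 (add_pos ha hb)

lemma hasDerivAt_smoothNorm_line (hε : 0 < ε) (a u : H) (s : ℝ) :
    HasDerivAt (fun s : ℝ => smoothNorm ε (a + s • u))
      (⟪a + s • u, u⟫ / smoothNorm ε (a + s • u)) s := by
  have h1 : ∀ s : ℝ,
      ‖a + s • u‖ ^ 2 + ε ^ 2 = ‖a‖ ^ 2 + ε ^ 2 + 2 * ⟪a, u⟫ * s + ‖u‖ ^ 2 * s ^ 2 := by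
    intro s
    rw [norm_add_sq_real, inner_smul_right, norm_smul, mul_pow, Real.norm_eq_abs, sq_abs]; ring
  have h2 : HasDerivAt (fun s : ℝ => ‖a + s • u‖ ^ 2 + ε ^ 2)
      (2 * ⟪a, u⟫ + ‖u‖ ^ 2 * (2 * s)) s := by
    simp_rw [h1]
    have := (((hasDerivAt_id s).const_mul (2 * ⟪a, u⟫)).const_add (‖a‖ ^ 2 + ε ^ 2)).add
      ((hasDerivAt_pow 2 s).const_mul (‖u‖ ^ 2))
    exact this.congr_deriv (by simp)
  have h3 := h2.sqrt (by positivity)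
  refine h3.congr_deriv ?_
  have h4 : (2 * ⟪a, u⟫ + ‖u‖ ^ 2 * (2 * s)) = 2 * ⟪a + s • u, u⟫ := by
    rw [inner_add_left, real_inner_smul_left, real_inner_self_eq_norm_sq]; ring
  rw [h4, mul_div_mul_left _ _ two_ne_zero]
  rfl

end SmoothNorm

section SoftMin

variable {ι : Type*} [Fintype ι] [Nonempty ι] {β : ℝ}

lemma sum_exp_pos (r : ι → ℝ) : 0 < ∑ z, Real.exp (r z) :=
  Finset.sum_pos (fun _ _ => Real.exp_pos _) Finset.univ_nonempty

lemma softMin_le (hβ : 0 < β) (r : ι → ℝ) (z : ι) : softMin β r ≤ r z := by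
  have h1 : Real.exp (-β * r z) ≤ ∑ z, Real.exp (-β * r z) :=
    Finset.single_le_sum (f := fun z => Real.exp (-β * r z)) (fun _ _ => (Real.exp_pos _).le)
      (Finset.mem_univ z)
  have h2 := Real.log_le_log (Real.exp_pos _) h1
  rw [Real.log_exp] at h2
  rw [softMin]
  have h3 : β * (-(1 / β) * Real.log (∑ z, Real.exp (-β * r z))) ≤ β * r z := by
    have : β * (-(1 / β) * Real.log (∑ z, Real.exp (-β * r z)))
      = -Real.log (∑ z, Real.exp (-β * r z)) := by field_simp
    linarith
  exact le_of_mul_le_mul_left h3 hβ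

/-- Each of the `card ι` summands is at most `exp (-β * m)`. The loss `log (card ι) / β` vanishes as
`β` grows. -/
lemma le_softMin (hβ : 0 < β) {r : ι → ℝ} {m : ℝ} (h : ∀ z, m ≤ r z) :
    m - Real.log (Fintype.card ι) / β ≤ softMin β r := by
  have h1 : ∑ z, Real.exp (-β * r z) ≤ Fintype.card ι * Real.exp (-β * m) := by
    rw [← nsmul_eq_mul, ← Finset.card_univ]
    refine Finset.sum_le_card_nsmul _ _ _ fun z _ => Real.exp_le_exp.2 ?_
    nlinarith [h z]
  have h2 := Real.log_le_log (sum_exp_pos _) h1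
  have hc : (0 : ℝ) < Fintype.card ι := by exact_mod_cast Fintype.card_pos
  rw [Real.log_mul hc.ne' (Real.exp_pos _).ne', Real.log_exp] at h2
  rw [softMin]
  have h3 : β * (m - Real.log (Fintype.card ι) / β)
      ≤ β * (-(1 / β) * Real.log (∑ z, Real.exp (-β * r z))) := by
    have e1 : β * (-(1 / β) * Real.log (∑ z, Real.exp (-β * r z)))
      = -Real.log (∑ z, Real.exp (-β * r z)) := by field_simp
    have e2 : β * (m - Real.log (Fintype.card ι) / β) = β * m - Real.log (Fintype.card ι) := by
      field_simp
    linarith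
  exact le_of_mul_le_mul_left h3 hβ

lemma softMin_add_const (hβ : 0 < β) (r : ι → ℝ) (c : ℝ) :
    softMin β (fun z => r z + c) = softMin β r + c := by
  have h : ∀ z, Real.exp (-β * (r z + c)) = Real.exp (-β * r z) * Real.exp (-β * c) := fun z => by
    rw [← Real.exp_add]; ring_nf
  simp_rw [softMin, h]
  rw [← Finset.sum_mul, Real.log_mul (sum_exp_pos _).ne' (Real.exp_pos _).ne', Real.log_exp]
  field_simp
  ring

lemma softMin_mono (hβ : 0 < β) {r s : ι → ℝ} (h : ∀ z, r z ≤ s z) :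
    softMin β r ≤ softMin β s := by
  have h1 : ∑ z, Real.exp (-β * s z) ≤ ∑ z, Real.exp (-β * r z) :=
    Finset.sum_le_sum fun z _ => Real.exp_le_exp.2 (by nlinarith [h z])
  have h2 := Real.log_le_log (sum_exp_pos _) h1
  rw [softMin, softMin]
  have : 0 < 1 / β := by positivity
  nlinarith

/-- A monotone map that commutes with adding constants is nonexpansive for the sup norm. -/
lemma abs_softMin_sub_le (hβ : 0 < β) {r s : ι → ℝ} {c : ℝ} (h : ∀ z, |r z - s z| ≤ c) :
    |softMin β r - softMin β s| ≤ c := by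
  have h1 : softMin β r ≤ softMin β s + c := by
    rw [← softMin_add_const hβ]
    exact softMin_mono hβ fun z => by linarith [(abs_le.1 (h z)).2]
  have h2 : softMin β s ≤ softMin β r + c := by
    rw [← softMin_add_const hβ]
    exact softMin_mono hβ fun z => by linarith [(abs_le.1 (h z)).1]
  exact abs_le.2 ⟨by linarith, by linarith⟩

end SoftMin

section SmoothMinNorm

variable {ι H : Type*} [Fintype ι] [Nonempty ι] [NormedAddCommGroup H] [InnerProductSpace ℝ H]

/-- The terms `‖a_z‖ + c_z`, smoothed. -/
noncomputable def shiftedNorm (ε : ℝ) (x : ι → H × ℝ) (z : ι) : ℝ :=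
  smoothNorm ε (x z).1 + (x z).2

/-- The first derivative of a shifted norm in the direction `u`. -/
noncomputable def shiftedNormD (ε : ℝ) (x u : ι → H × ℝ) (z : ι) : ℝ :=
  ⟪(x z).1, (u z).1⟫ / smoothNorm ε (x z).1 + (u z).2

/-- The second derivative of a shifted norm in the direction `u`. -/
noncomputable def shiftedNormDD (ε : ℝ) (x u : ι → H × ℝ) (z : ι) : ℝ :=
  (‖(u z).1‖ ^ 2 * smoothNorm ε (x z).1 - ⟪(x z).1, (u z).1⟫ *
    (⟪(x z).1, (u z).1⟫ / smoothNorm ε (x z).1)) / smoothNorm ε (x z).1 ^ 2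

/-- The smoothed minimum of `‖a_z‖ + c_z`. -/
noncomputable def smoothMin (ε β : ℝ) (x : ι → H × ℝ) : ℝ :=
  softMin β (shiftedNorm ε x)

/-- The softmin average of `f`. -/
noncomputable def softAvg (ε β : ℝ) (x : ι → H × ℝ) (f : ι → ℝ) : ℝ :=
  (∑ z, Real.exp (-β * shiftedNorm ε x z) * f z) / ∑ z, Real.exp (-β * shiftedNorm ε x z)

/-- The second derivative of `smoothMin` in the direction `u`. -/
noncomputable def smoothMinDD (ε β : ℝ) (x u : ι → H × ℝ) : ℝ :=
  softAvg ε β x (fun z => shiftedNormDD ε x u z - β * shiftedNormD ε x u z ^ 2)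
    + β * softAvg ε β x (shiftedNormD ε x u) ^ 2

variable {ε β : ℝ}

omit [Fintype ι] [Nonempty ι] in
lemma hasDerivAt_shiftedNorm (hε : 0 < ε) (x u : ι → H × ℝ) (z : ι) (s : ℝ) :
    HasDerivAt (fun s : ℝ => shiftedNorm ε (x + s • u) z) (shiftedNormD ε (x + s • u) u z) s := by
  have h1 := hasDerivAt_smoothNorm_line hε (x z).1 (u z).1 s
  have h2 := ((hasDerivAt_id s).mul_const (u z).2).const_add (x z).2
  rw [one_mul] at h2
  exact h1.add h2

omit [Fintype ι] [Nonempty ι] in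
lemma hasDerivAt_shiftedNormD (hε : 0 < ε) (x u : ι → H × ℝ) (z : ι) (s : ℝ) :
    HasDerivAt (fun s : ℝ => shiftedNormD ε (x + s • u) u z)
      (shiftedNormDD ε (x + s • u) u z) s := by
  have h1 := hasDerivAt_smoothNorm_line hε (x z).1 (u z).1 s
  have h2 : HasDerivAt (fun s : ℝ => ⟪(x z).1 + s • (u z).1, (u z).1⟫) (‖(u z).1‖ ^ 2) s := by
    have := ((hasDerivAt_id s).mul_const (⟪(u z).1, (u z).1⟫)).const_add ⟪(x z).1, (u z).1⟫
    simp_rw [inner_add_left, real_inner_smul_left]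
    exact this.congr_deriv (by rw [one_mul, real_inner_self_eq_norm_sq])
  exact (h2.div h1 (smoothNorm_pos hε _).ne').add_const (u z).2

omit [Nonempty ι] in
lemma hasDerivAt_exp_shiftedNorm (hε : 0 < ε) (x u : ι → H × ℝ) (z : ι) (s : ℝ) :
    HasDerivAt (fun s : ℝ => Real.exp (-β * shiftedNorm ε (x + s • u) z))
      (Real.exp (-β * shiftedNorm ε (x + s • u) z) * (-β * shiftedNormD ε (x + s • u) u z)) s :=
  ((hasDerivAt_shiftedNorm hε x u z s).const_mul (-β)).exp

lemma hasDerivAt_smoothMin (hε : 0 < ε) (hβ : 0 < β) (x u : ι → H × ℝ) (s : ℝ) :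
    HasDerivAt (fun s : ℝ => smoothMin ε β (x + s • u))
      (softAvg ε β (x + s • u) (shiftedNormD ε (x + s • u) u)) s := by
  have h1 := HasDerivAt.fun_sum (u := Finset.univ)
    fun z _ => hasDerivAt_exp_shiftedNorm (β := β) hε x u z s
  have h2 := (h1.log (sum_exp_pos _).ne').const_mul (-(1 / β))
  refine h2.congr_deriv ?_
  rw [softAvg, ← mul_div_assoc, Finset.mul_sum]
  congr 1
  refine Finset.sum_congr rfl fun z _ => ?_
  field_simp

/-- Differentiating a Gibbs average gives the average of the derivatives minus β times a variance.
The squared mean thus enters with a plus sign, which fixes the direction of Gordon's inequality. -/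
lemma hasDerivAt_softAvg_shiftedNormD (hε : 0 < ε) (x u : ι → H × ℝ) (s : ℝ) :
    HasDerivAt (fun s : ℝ => softAvg ε β (x + s • u) (shiftedNormD ε (x + s • u) u))
      (smoothMinDD ε β (x + s • u) u) s := by
  have h1 := HasDerivAt.fun_sum (u := Finset.univ)
    fun z _ => hasDerivAt_exp_shiftedNorm (β := β) hε x u z s
  have h2 := HasDerivAt.fun_sum (u := Finset.univ)
    fun z _ => (hasDerivAt_exp_shiftedNorm (β := β) hε x u z s).mul
      (hasDerivAt_shiftedNormD hε x u z s)
  have hQ := sum_exp_pos fun z => -β * shiftedNorm ε (x + s • u) z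
  have h3 := h2.div h1 hQ.ne'
  refine h3.congr_deriv ?_
  rw [smoothMinDD, softAvg, softAvg]
  have e1 : ∑ z, Real.exp (-β * shiftedNorm ε (x + s • u) z) *
      (-β * shiftedNormD ε (x + s • u) u z) = -β * ∑ z,
        Real.exp (-β * shiftedNorm ε (x + s • u) z) * shiftedNormD ε (x + s • u) u z := by
    rw [Finset.mul_sum]; exact Finset.sum_congr rfl fun z _ => by ring
  have e2 : ∑ z, (Real.exp (-β * shiftedNorm ε (x + s • u) z) *
      (-β * shiftedNormD ε (x + s • u) u z) * shiftedNormD ε (x + s • u) u z +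
      Real.exp (-β * shiftedNorm ε (x + s • u) z) * shiftedNormDD ε (x + s • u) u z)
      = ∑ z, Real.exp (-β * shiftedNorm ε (x + s • u) z) *
        (shiftedNormDD ε (x + s • u) u z - β * shiftedNormD ε (x + s • u) u z ^ 2) :=
    Finset.sum_congr rfl fun z _ => by ring
  simp only [Pi.mul_apply]
  rw [e1, e2]
  field_simp
  ring

lemma contDiff_smoothMin (hε : 0 < ε) {m : WithTop ℕ∞} :
    ContDiff ℝ m (smoothMin ε β : (ι → H × ℝ) → ℝ) := by
  have h1 : ∀ z : ι, ContDiff ℝ m fun x : ι → H × ℝ => shiftedNorm ε x z := fun z => by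
    have h2 : ContDiff ℝ m fun x : ι → H × ℝ => x z := contDiff_apply ℝ (H × ℝ) z
    exact ((contDiff_smoothNorm hε).comp (contDiff_fst.comp h2)).add (contDiff_snd.comp h2)
  refine contDiff_const.mul (ContDiff.log (ContDiff.sum fun z _ => ?_) fun x =>
    (sum_exp_pos _).ne')
  exact (contDiff_const.mul (h1 z)).exp

lemma continuous_shiftedNorm (hε : 0 < ε) (z : ι) :
    Continuous fun x : ι → H × ℝ => shiftedNorm ε x z := by
  have h0 : Continuous (smoothNorm ε : H → ℝ) := (contDiff_smoothNorm (m := 0) hε).continuous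
  unfold shiftedNorm
  fun_prop

lemma continuous_softAvg (hε : 0 < ε) {f : (ι → H × ℝ) → ι → ℝ}
    (hf : ∀ z, Continuous fun x => f x z) :
    Continuous fun x : ι → H × ℝ => softAvg ε β x (f x) := by
  have h1 := continuous_shiftedNorm (ι := ι) (H := H) hε
  unfold softAvg
  exact Continuous.div (by fun_prop) (by fun_prop) fun x => (sum_exp_pos _).ne'

lemma abs_softAvg_le {x : ι → H × ℝ} {f : ι → ℝ} {C : ℝ} (hf : ∀ z, |f z| ≤ C) :
    |softAvg ε β x f| ≤ C := by
  have hQ := sum_exp_pos fun z => -β * shiftedNorm ε x z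
  rw [softAvg, abs_div, abs_of_pos hQ, div_le_iff₀ hQ, Finset.mul_sum]
  refine (Finset.abs_sum_le_sum_abs _ _).trans (Finset.sum_le_sum fun z _ => ?_)
  rw [abs_mul, abs_of_pos (Real.exp_pos _), mul_comm]
  exact mul_le_mul_of_nonneg_right (hf z) (Real.exp_pos _).le

omit [Nonempty ι] in
lemma continuous_shiftedNormD (hε : 0 < ε) (u : ι → H × ℝ) (z : ι) :
    Continuous fun x : ι → H × ℝ => shiftedNormD ε x u z := by
  have h0 : Continuous (smoothNorm ε : H → ℝ) := (contDiff_smoothNorm (m := 0) hε).continuous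
  unfold shiftedNormD
  exact (Continuous.div (by fun_prop) (by fun_prop) fun x => (smoothNorm_pos hε _).ne').add
    (by fun_prop)

omit [Nonempty ι] in
lemma continuous_shiftedNormDD (hε : 0 < ε) (u : ι → H × ℝ) (z : ι) :
    Continuous fun x : ι → H × ℝ => shiftedNormDD ε x u z := by
  have h0 : Continuous (smoothNorm ε : H → ℝ) := (contDiff_smoothNorm (m := 0) hε).continuous
  unfold shiftedNormDD
  have h1 : Continuous fun x : ι → H × ℝ => ⟪(x z).1, (u z).1⟫ / smoothNorm ε (x z).1 :=
    Continuous.div (by fun_prop) (by fun_prop) fun x => (smoothNorm_pos hε _).ne'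
  exact Continuous.div (by fun_prop) (by fun_prop) fun x =>
    pow_ne_zero _ (smoothNorm_pos hε _).ne'

omit [Fintype ι] [Nonempty ι] in
lemma abs_inner_div_smoothNorm_le (hε : 0 < ε) (a u : H) :
    |⟪a, u⟫ / smoothNorm ε a| ≤ ‖u‖ := by
  have hN := smoothNorm_pos hε a
  rw [abs_div, abs_of_pos hN, div_le_iff₀ hN]
  refine (abs_real_inner_le_norm _ _).trans ?_
  rw [mul_comm]
  exact mul_le_mul_of_nonneg_left (norm_le_smoothNorm a) (norm_nonneg u)

omit [Nonempty ι] in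
lemma abs_shiftedNormD_le (hε : 0 < ε) (x u : ι → H × ℝ) (z : ι) :
    |shiftedNormD ε x u z| ≤ 2 * ‖u‖ := by
  have h1 := abs_inner_div_smoothNorm_le hε (x z).1 (u z).1
  have h2 := norm_le_pi_norm u z
  have h3 := norm_fst_le (u z)
  have h4 := norm_snd_le (u z)
  rw [Real.norm_eq_abs] at h4
  exact (abs_add_le _ _).trans (by linarith)

-- The bound blows up as ε → 0, which is harmless: the comparison theorem needs boundedness only for
-- each fixed ε.
omit [Nonempty ι] in
lemma abs_shiftedNormDD_le (hε : 0 < ε) (x u : ι → H × ℝ) (z : ι) :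
    |shiftedNormDD ε x u z| ≤ 2 * ‖u‖ ^ 2 / ε := by
  have hN := smoothNorm_pos hε (x z).1
  have h1 := abs_inner_div_smoothNorm_le hε (x z).1 (u z).1
  have h2 : ‖(u z).1‖ ≤ ‖u‖ := (norm_fst_le (u z)).trans (norm_le_pi_norm u z)
  have e : shiftedNormDD ε x u z = (‖(u z).1‖ ^ 2 - (⟪(x z).1, (u z).1⟫ / smoothNorm ε (x z).1) ^ 2)
      / smoothNorm ε (x z).1 := by
    rw [shiftedNormDD]; field_simp
  rw [e, abs_div, abs_of_pos hN]
  have h3 : |‖(u z).1‖ ^ 2 - (⟪(x z).1, (u z).1⟫ / smoothNorm ε (x z).1) ^ 2| ≤ 2 * ‖u‖ ^ 2 := by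
    have h4 : (⟪(x z).1, (u z).1⟫ / smoothNorm ε (x z).1) ^ 2 ≤ ‖(u z).1‖ ^ 2 :=
      sq_le_sq' (abs_le.1 h1).1 (abs_le.1 h1).2
    have h5 : ‖(u z).1‖ ^ 2 ≤ ‖u‖ ^ 2 := by gcongr
    rw [abs_le]
    constructor <;> nlinarith [sq_nonneg (⟪(x z).1, (u z).1⟫ / smoothNorm ε (x z).1)]
  exact div_le_div₀ (by positivity) h3 hε (le_smoothNorm _)

lemma abs_smoothMinDD_le (hε : 0 < ε) (hβ : 0 < β) (x u : ι → H × ℝ) :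
    |smoothMinDD ε β x u| ≤ 2 * ‖u‖ ^ 2 / ε + 8 * β * ‖u‖ ^ 2 := by
  have h1 : |softAvg ε β x (fun z => shiftedNormDD ε x u z - β * shiftedNormD ε x u z ^ 2)|
      ≤ 2 * ‖u‖ ^ 2 / ε + β * (2 * ‖u‖) ^ 2 := by
    refine abs_softAvg_le fun z => (abs_sub _ _).trans ?_
    rw [abs_mul, abs_of_pos hβ, abs_of_nonneg (sq_nonneg (shiftedNormD ε x u z)),
      ← sq_abs (shiftedNormD ε x u z)]
    have := abs_shiftedNormDD_le hε x u z
    have h2 := abs_shiftedNormD_le hε x u z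
    gcongr
  have h2 : |softAvg ε β x (shiftedNormD ε x u)| ≤ 2 * ‖u‖ :=
    abs_softAvg_le (abs_shiftedNormD_le hε x u)
  refine (abs_add_le _ _).trans ?_
  rw [abs_mul, abs_of_pos hβ, abs_of_nonneg (sq_nonneg (softAvg _ _ _ _)),
      ← sq_abs (softAvg _ _ _ _)]
  have : β * |softAvg ε β x (shiftedNormD ε x u)| ^ 2 ≤ β * (2 * ‖u‖) ^ 2 := by gcongr
  nlinarith

lemma lipschitzWith_smoothMin (hε : 0 < ε) (hβ : 0 < β) :
    LipschitzWith 2 (smoothMin ε β : (ι → H × ℝ) → ℝ) := by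
  refine LipschitzWith.of_dist_le_mul fun x y => ?_
  rw [Real.dist_eq, dist_eq_norm]
  refine abs_softMin_sub_le hβ fun z => ?_
  have h1 := abs_smoothNorm_sub_le hε (x z).1 (y z).1
  have h2 := norm_le_pi_norm (x - y) z
  have h3 := norm_fst_le ((x - y) z)
  have h4 := norm_snd_le ((x - y) z)
  rw [Real.norm_eq_abs] at h4
  have h5 : shiftedNorm ε x z - shiftedNorm ε y z = (smoothNorm ε (x z).1 - smoothNorm ε (y z).1)
      + ((x - y) z).2 := by
    simp only [shiftedNorm, Pi.sub_apply, Prod.snd_sub]; ring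
  rw [h5]
  refine (abs_add_le _ _).trans ?_
  have h6 : ((x - y) z).1 = (x z).1 - (y z).1 := rfl
  rw [h6] at h3
  simp only [NNReal.coe_ofNat]
  linarith

/-- The trace of the second derivatives along a family of directions. -/
lemma sum_smoothMinDD {K : Type*} [Fintype K] (x : ι → H × ℝ) (s : K → ι → H × ℝ) :
    ∑ k, smoothMinDD ε β x (s k)
      = softAvg ε β x (fun z => ∑ k, shiftedNormDD ε x (s k) z
          - β * ∑ k, shiftedNormD ε x (s k) z ^ 2)
        + β * ((∑ z, ∑ z', Real.exp (-β * shiftedNorm ε x z) * Real.exp (-β * shiftedNorm ε x z')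
          * ∑ k, shiftedNormD ε x (s k) z * shiftedNormD ε x (s k) z') /
          (∑ z, Real.exp (-β * shiftedNorm ε x z)) ^ 2) := by
  simp_rw [smoothMinDD]
  rw [Finset.sum_add_distrib, ← Finset.mul_sum]
  congr 1
  · simp_rw [softAvg]
    rw [← Finset.sum_div, Finset.sum_comm]
    congr 1
    refine Finset.sum_congr rfl fun z _ => ?_
    rw [← Finset.mul_sum, Finset.sum_sub_distrib, Finset.mul_sum]
  · congr 1
    simp_rw [softAvg, div_pow]
    rw [← Finset.sum_div]
    congr 1
    simp_rw [sq, Finset.sum_mul_sum, Finset.mul_sum]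
    rw [Finset.sum_comm]
    refine Finset.sum_congr rfl fun z _ => ?_
    rw [Finset.sum_comm]
    exact Finset.sum_congr rfl fun z' _ => Finset.sum_congr rfl fun k _ => by ring

/-- Comparison of the traces of the second derivatives along two families of directions. -/
lemma sum_smoothMinDD_le {I J : Type*} [Fintype I] [Fintype J] (hβ : 0 < β) (x : ι → H × ℝ)
    (u : I → ι → H × ℝ) (v : J → ι → H × ℝ)
    (h2 : ∀ z, ∑ j, shiftedNormDD ε x (v j) z = ∑ i, shiftedNormDD ε x (u i) z)
    (h1 : ∀ z, ∑ j, shiftedNormD ε x (v j) z ^ 2 = ∑ i, shiftedNormD ε x (u i) z ^ 2)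
    (h0 : ∀ z z', ∑ j, shiftedNormD ε x (v j) z * shiftedNormD ε x (v j) z'
      ≤ ∑ i, shiftedNormD ε x (u i) z * shiftedNormD ε x (u i) z') :
    ∑ j, smoothMinDD ε β x (v j) ≤ ∑ i, smoothMinDD ε β x (u i) := by
  rw [sum_smoothMinDD x u, sum_smoothMinDD x v]
  -- The Gibbs averages now agree on both sides. What remains is a sum of the covariances in `h0`
  -- with positive weights.
  simp_rw [h1, h2]
  gcongr with z _ z' _
  exact h0 z z'

end SmoothMinNorm

end SmoothMin

/-! ### Gordon's inequality for finitely many unit vectors. -/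

section Gordon

section SumProjections

variable {I J : Type*} [Fintype I] [Fintype J]

/-- Restriction of a vector to the left summand of the index type. -/
noncomputable def sumFst : EuclideanSpace ℝ (I ⊕ J) →L[ℝ] EuclideanSpace ℝ I :=
  LinearMap.toContinuousLinearMap
    { toFun := fun x => WithLp.toLp 2 fun i => x (Sum.inl i)
      map_add' := fun _ _ => rfl
      map_smul' := fun _ _ => rfl }

/-- Restriction of a vector to the right summand of the index type. -/
noncomputable def sumSnd : EuclideanSpace ℝ (I ⊕ J) →L[ℝ] EuclideanSpace ℝ J :=
  LinearMap.toContinuousLinearMap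
    { toFun := fun x => WithLp.toLp 2 fun j => x (Sum.inr j)
      map_add' := fun _ _ => rfl
      map_smul' := fun _ _ => rfl }

@[simp] lemma sumFst_apply (x : EuclideanSpace ℝ (I ⊕ J)) (i : I) :
    sumFst x i = x (Sum.inl i) := rfl

@[simp] lemma sumSnd_apply (x : EuclideanSpace ℝ (I ⊕ J)) (j : J) :
    sumSnd x j = x (Sum.inr j) := rfl

lemma map_sumFst_stdGaussian :
    (stdGaussian (EuclideanSpace ℝ (I ⊕ J))).map sumFst = stdGaussian (EuclideanSpace ℝ I) := by
  refine map_stdGaussian_of_norm_adjoint sumFst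
    (fun t => (WithLp.toLp 2 (Sum.elim t.ofLp 0) : EuclideanSpace ℝ (I ⊕ J)))
    (fun x t => ?_) fun t => ?_
  · simp [PiLp.inner_apply]
  · rw [← sq_eq_sq₀ (norm_nonneg _) (norm_nonneg _), EuclideanSpace.real_norm_sq_eq,
      EuclideanSpace.real_norm_sq_eq]
    simp

lemma map_sumSnd_stdGaussian :
    (stdGaussian (EuclideanSpace ℝ (I ⊕ J))).map sumSnd = stdGaussian (EuclideanSpace ℝ J) := by
  refine map_stdGaussian_of_norm_adjoint sumSnd
    (fun t => (WithLp.toLp 2 (Sum.elim 0 t.ofLp) : EuclideanSpace ℝ (I ⊕ J)))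
    (fun x t => ?_) fun t => ?_
  · simp [PiLp.inner_apply]
  · rw [← sq_eq_sq₀ (norm_nonneg _) (norm_nonneg _), EuclideanSpace.real_norm_sq_eq,
      EuclideanSpace.real_norm_sq_eq]
    simp

end SumProjections

/-- The linear map `x ↦ ∑ x_i u_i`. -/
noncomputable def combination {I V : Type*} [Fintype I] [NormedAddCommGroup V] [NormedSpace ℝ V]
    (u : I → V) : EuclideanSpace ℝ I →L[ℝ] V :=
  ∑ i, (EuclideanSpace.proj i : EuclideanSpace ℝ I →L[ℝ] ℝ).smulRight (u i)

lemma combination_apply {I V : Type*} [Fintype I] [NormedAddCommGroup V] [NormedSpace ℝ V]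
    (u : I → V) (x : EuclideanSpace ℝ I) : combination u x = ∑ i, x i • u i := by
  simp [combination]

variable {n p : ℕ}

/-- The product of a matrix, viewed as a vector of entries, with the vector `ζ`. -/
noncomputable def matVec (ζ : Vec p) : EuclideanSpace ℝ (Fin n × Fin p) →L[ℝ] Vec n :=
  LinearMap.toContinuousLinearMap
    { toFun := fun x => WithLp.toLp 2 fun i => ∑ j, x (i, j) * ζ j
      map_add' := fun x y => by ext i; simp [add_mul, Finset.sum_add_distrib]
      map_smul' := fun c x => by ext i; simp [Finset.mul_sum, mul_assoc] }

@[simp] lemma matVec_apply (ζ : Vec p) (x : EuclideanSpace ℝ (Fin n × Fin p)) (i : Fin n) :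
    matVec ζ x i = ∑ j, x (i, j) * ζ j := rfl

lemma norm_matVec_le (ζ : Vec p) (x : EuclideanSpace ℝ (Fin n × Fin p)) :
    ‖matVec ζ x‖ ≤ ‖x‖ * ‖ζ‖ := by
  refine (sq_le_sq₀ (norm_nonneg _) (by positivity)).1 ?_
  rw [mul_pow, EuclideanSpace.real_norm_sq_eq, EuclideanSpace.real_norm_sq_eq,
    EuclideanSpace.real_norm_sq_eq, Fintype.sum_prod_type, Finset.sum_mul]
  exact Finset.sum_le_sum fun i _ => by
    rw [matVec_apply]; exact Finset.sum_mul_sq_le_sq_mul_sq _ _ _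

variable {ι : Type*} [Fintype ι] [Nonempty ι]

/-- The directions of the process `z ↦ (X z, γ)`. -/
noncomputable def matrixDirections (ζ : ι → Vec p) :
    (Fin n × Fin p) ⊕ Unit → ι → Vec n × ℝ :=
  Sum.elim (fun ij z => (EuclideanSpace.single ij.1 (ζ z ij.2), 0)) fun _ _ => (0, 1)

/-- The directions of the process `z ↦ (h, -⟨g, z⟩)`. -/
noncomputable def decoupledDirections (ζ : ι → Vec p) : Fin n ⊕ Fin p → ι → Vec n × ℝ :=
  Sum.elim (fun i _ => (EuclideanSpace.single i 1, 0)) fun j z => (0, -ζ z j)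

-- The summand 1 comes from the scalar Gaussian γ. It is there so that, for unit vectors `ζ z`, the
-- diagonal z = z' agrees with that of the decoupled process.
omit [Fintype ι] [Nonempty ι] in
lemma sum_mul_matrixDirections {ε : ℝ} (ζ : ι → Vec p) (x : ι → Vec n × ℝ) (z z' : ι) :
    ∑ k, shiftedNormD ε x (matrixDirections ζ k) z * shiftedNormD ε x (matrixDirections ζ k) z'
      = ⟪(x z).1, (x z').1⟫ / (smoothNorm ε (x z).1 * smoothNorm ε (x z').1) * ⟪ζ z, ζ z'⟫ + 1 := by
  simp only [shiftedNormD, matrixDirections, Fintype.sum_sum_type, Sum.elim_inl, Sum.elim_inr,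
    EuclideanSpace.inner_single_right, inner_zero_right, Fintype.sum_prod_type,
    Finset.univ_unique, Finset.sum_singleton]
  simp only [conj_trivial, add_zero, zero_div, zero_add, mul_one, PiLp.inner_apply,
    RCLike.inner_apply]
  congr 1
  rw [Finset.sum_div, Finset.sum_mul_sum]
  exact Finset.sum_congr rfl fun i _ => Finset.sum_congr rfl fun j _ => by
    rw [div_mul_div_comm]; ring

omit [Fintype ι] [Nonempty ι] in
lemma sum_mul_decoupledDirections {ε : ℝ} (ζ : ι → Vec p) (x : ι → Vec n × ℝ) (z z' : ι) :
    ∑ k, shiftedNormD ε x (decoupledDirections ζ k) z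
        * shiftedNormD ε x (decoupledDirections ζ k) z'
      = ⟪(x z).1, (x z').1⟫ / (smoothNorm ε (x z).1 * smoothNorm ε (x z').1) + ⟪ζ z, ζ z'⟫ := by
  simp only [shiftedNormD, decoupledDirections, Fintype.sum_sum_type, Sum.elim_inl, Sum.elim_inr,
    EuclideanSpace.inner_single_right, inner_zero_right]
  simp only [conj_trivial, add_zero, zero_div, zero_add, one_mul, PiLp.inner_apply,
    RCLike.inner_apply]
  congr 1
  · rw [Finset.sum_div]
    exact Finset.sum_congr rfl fun i _ => by rw [div_mul_div_comm]; ring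
  · exact Finset.sum_congr rfl fun i _ => by ring

-- Second derivatives are quadratic in the direction, so the directions `ζ z j` times a basis vector
-- add up to that basis vector's contribution, because the squares of the `ζ z j` sum to 1.
omit [Fintype ι] [Nonempty ι] in
lemma sum_shiftedNormDD_directions {ε : ℝ} {ζ : ι → Vec p} (hζ : ∀ z, ‖ζ z‖ = 1)
    (x : ι → Vec n × ℝ) (z : ι) :
    ∑ k, shiftedNormDD ε x (decoupledDirections ζ k) z
      = ∑ k, shiftedNormDD ε x (matrixDirections ζ k) z := by
  have h1 : ∑ j, ζ z j ^ 2 = 1 := by rw [← EuclideanSpace.real_norm_sq_eq, hζ, one_pow]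
  simp only [shiftedNormDD, decoupledDirections, matrixDirections, Fintype.sum_sum_type,
    Sum.elim_inl, Sum.elim_inr, EuclideanSpace.inner_single_right, inner_zero_right,
    Fintype.sum_prod_type, norm_zero, PiLp.norm_single]
  simp only [conj_trivial, one_mul, norm_one, one_pow, Real.norm_eq_abs, sq_abs]
  simp only [ne_eq, OfNat.ofNat_ne_zero, not_false_eq_true, zero_pow, zero_mul, sub_self,
    zero_div, Finset.sum_const_zero, add_zero]
  refine Finset.sum_congr rfl fun i _ => ?_
  rw [← one_mul (((smoothNorm ε (x z).1 - _) : ℝ) / _), ← h1, Finset.sum_mul]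
  exact Finset.sum_congr rfl fun j _ => by ring

omit [Fintype ι] [Nonempty ι] in
lemma combination_matrixDirections (ζ : ι → Vec p)
    (x : EuclideanSpace ℝ ((Fin n × Fin p) ⊕ Unit)) (z : ι) [Fintype ι] :
    combination (matrixDirections ζ) x z = (matVec (ζ z) (sumFst x), x (Sum.inr ())) := by
  classical
  rw [combination_apply]
  simp only [Finset.sum_apply, Fintype.sum_sum_type, matrixDirections, Sum.elim_inl, Sum.elim_inr,
    Pi.smul_apply, Fintype.sum_prod_type]
  refine Prod.ext ?_ ?_
  · ext i
    simp [Prod.fst_sum, Pi.single_apply, Finset.sum_comm (s := Finset.univ (α := Fin n)),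
      WithLp.ofLp_sum]
  · simp [Prod.snd_sum]

omit [Fintype ι] [Nonempty ι] in
lemma combination_decoupledDirections (ζ : ι → Vec p)
    (y : EuclideanSpace ℝ (Fin n ⊕ Fin p)) (z : ι) [Fintype ι] :
    combination (decoupledDirections ζ) y z = (sumFst y, -⟪ζ z, sumSnd y⟫) := by
  classical
  rw [combination_apply]
  simp only [Finset.sum_apply, Fintype.sum_sum_type, decoupledDirections, Sum.elim_inl,
    Sum.elim_inr, Pi.smul_apply]
  refine Prod.ext ?_ ?_
  · ext i
    simp [Prod.fst_sum, Pi.single_apply, WithLp.ofLp_sum]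
  · simp [Prod.snd_sum, PiLp.inner_apply]

/-- **Gordon's inequality** for the smoothed minimum. -/
theorem integral_smoothMin_directions_le {ε β : ℝ} (hε : 0 < ε) (hβ : 0 < β) {ζ : ι → Vec p}
    (hζ : ∀ z, ‖ζ z‖ = 1) :
    ∫ y, smoothMin ε β (combination (decoupledDirections (n := n) ζ) y)
        ∂(stdGaussian (EuclideanSpace ℝ (Fin n ⊕ Fin p)))
      ≤ ∫ x, smoothMin ε β (combination (matrixDirections (n := n) ζ) x)
        ∂(stdGaussian (EuclideanSpace ℝ ((Fin n × Fin p) ⊕ Unit))) := by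
  have hsm := contDiff_smoothMin (ι := ι) (H := Vec n) (β := β) hε (m := 1)
  have hD : ∀ x, HasFDerivAt (smoothMin ε β : (ι → Vec n × ℝ) → ℝ) (fderiv ℝ (smoothMin ε β) x) x :=
    fun x => (hsm.differentiable one_ne_zero).differentiableAt.hasFDerivAt
  have hDu : ∀ x u, fderiv ℝ (smoothMin ε β : (ι → Vec n × ℝ) → ℝ) x u
      = softAvg ε β x (shiftedNormD ε x u) := by
    intro x u
    have h1 := hasDerivAt_smoothMin hε hβ x u 0
    have h2 : HasDerivAt (fun s : ℝ => x + s • u) u 0 := by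
      simpa using ((hasDerivAt_id (0 : ℝ)).smul_const u).const_add x
    have h3 := HasFDerivAt.comp_hasDerivAt (0 : ℝ) (f := fun s : ℝ => x + s • u)
      (by simpa using hD x) h2
    simpa using h3.unique h1
  refine integral_stdGaussian_comparison hD (hsm.continuous_fderiv one_ne_zero)
    (D2 := smoothMinDD ε β) (fun x u => ?_) (fun u => ?_) (M := 2) (fun x => ?_) (fun u =>
      ⟨_, fun x => abs_smoothMinDD_le hε hβ x u⟩) _ _ (matrixDirections ζ)
    (combination_apply _) (decoupledDirections ζ) (combination_apply _) (fun x => ?_)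
  · simp_rw [hDu]
    simpa using hasDerivAt_softAvg_shiftedNormD (β := β) hε x u 0
  · have h1 := continuous_shiftedNormD (ι := ι) (H := Vec n) hε u
    have h2 := continuous_shiftedNormDD (ι := ι) (H := Vec n) hε u
    refine (continuous_softAvg hε fun z => ?_).add
      (continuous_const.mul ((continuous_softAvg hε h1).pow 2))
    have := h1 z
    have := h2 z
    fun_prop
  · simpa using norm_fderiv_le_of_lipschitz ℝ (lipschitzWith_smoothMin hε hβ) (x₀ := x)
  · refine sum_smoothMinDD_le hβ x _ _ (sum_shiftedNormDD_directions hζ x) (fun z => ?_)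
      fun z z' => ?_
    · simp_rw [sq]
      rw [sum_mul_matrixDirections, sum_mul_decoupledDirections, real_inner_self_eq_norm_sq (ζ z),
        hζ]
      ring
    · rw [sum_mul_matrixDirections, sum_mul_decoupledDirections]
      have hc : ⟪ζ z, ζ z'⟫ ≤ 1 := by
        have := real_inner_le_norm (ζ z) (ζ z')
        rwa [hζ, hζ, one_mul] at this
      have hN := mul_pos (smoothNorm_pos hε (x z).1) (smoothNorm_pos hε (x z').1)
      have ha : ⟪(x z).1, (x z').1⟫ / (smoothNorm ε (x z).1 * smoothNorm ε (x z').1) ≤ 1 := by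
        rw [div_le_one hN]
        exact (real_inner_le_norm _ _).trans (mul_le_mul (norm_le_smoothNorm _)
          (norm_le_smoothNorm _) (norm_nonneg _) (smoothNorm_pos hε _).le)
      -- Gordon's sign condition: ac + 1 - (a + c) = (1 - a)(1 - c) ≥ 0, where a is the ratio in
      -- `ha` and c the inner product in `hc`.
      nlinarith [mul_nonneg (sub_nonneg.2 ha) (sub_nonneg.2 hc)]

/-- The smoothed minimum of `‖X z‖` over finitely many `z`. -/
noncomputable def matSoftMin (ε β : ℝ) (ζ : ι → Vec p) (x : EuclideanSpace ℝ (Fin n × Fin p)) : ℝ :=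
  softMin β fun z => smoothNorm ε (matVec (ζ z) x)

lemma lipschitzWith_matSoftMin {ε β : ℝ} (hε : 0 < ε) (hβ : 0 < β) {ζ : ι → Vec p}
    (hζ : ∀ z, ‖ζ z‖ = 1) : LipschitzWith 1 (matSoftMin (n := n) ε β ζ) := by
  refine LipschitzWith.of_dist_le_mul fun x y => ?_
  rw [Real.dist_eq, dist_eq_norm]
  refine abs_softMin_sub_le hβ fun z => (abs_smoothNorm_sub_le hε _ _).trans ?_
  rw [← map_sub]
  simpa [hζ] using norm_matVec_le (ζ z) (x - y)

lemma contDiff_matSoftMin {ε β : ℝ} (hε : 0 < ε) (ζ : ι → Vec p) {m : WithTop ℕ∞} :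
    ContDiff ℝ m (matSoftMin (n := n) ε β ζ) := by
  refine contDiff_const.mul (ContDiff.log (ContDiff.sum fun z _ => ?_) fun x =>
    (sum_exp_pos _).ne')
  exact (contDiff_const.mul ((contDiff_smoothNorm hε).comp (matVec (ζ z)).contDiff)).exp

lemma integrable_iSup_inner_stdGaussian (ζ : ι → Vec p) :
    Integrable (fun g => ⨆ z, ⟪ζ z, g⟫) (stdGaussian (Vec p)) := by
  have h1 : ∀ g : Vec p, ∀ z, |⟪ζ z, g⟫| ≤ (∑ z, ‖ζ z‖) * ‖g‖ := fun g z =>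
    (abs_real_inner_le_norm _ _).trans (by
      gcongr
      exact Finset.single_le_sum (f := fun z => ‖ζ z‖) (fun _ _ => norm_nonneg _)
        (Finset.mem_univ z))
  refine (integrable_norm_stdGaussian.const_mul (∑ z, ‖ζ z‖)).mono'
    (Measurable.iSup fun z => by fun_prop).aestronglyMeasurable (ae_of_all _ fun g => ?_)
  rw [Real.norm_eq_abs, abs_le]
  obtain ⟨z0⟩ := ‹Nonempty ι›
  exact ⟨(abs_le.1 (h1 g z0)).1.trans (le_ciSup (f := fun z => ⟪ζ z, g⟫)
    (Set.finite_range _).bddAbove z0),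
    ciSup_le fun z => (abs_le.1 (h1 g z)).2⟩

/-- On the matrix side γ is a common shift of all terms, so it leaves the soft minimum and has mean
zero. On the decoupled side every term is at least ‖h‖ - sup ⟨ζ z, g⟩, so only the softening loss
remains. -/
lemma le_integral_matSoftMin {ε β : ℝ} (hε : 0 < ε) (hβ : 0 < β) {ζ : ι → Vec p}
    (hζ : ∀ z, ‖ζ z‖ = 1) :
    meanNorm n - ∫ g, ⨆ z, ⟪ζ z, g⟫ ∂(stdGaussian (Vec p)) - Real.log (Fintype.card ι) / β
      ≤ ∫ x, matSoftMin ε β ζ x ∂(stdGaussian (EuclideanSpace ℝ (Fin n × Fin p))) := by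
  have h := integral_smoothMin_directions_le (n := n) hε hβ hζ
  have e1 : ∀ x : EuclideanSpace ℝ ((Fin n × Fin p) ⊕ Unit),
      smoothMin ε β (combination (matrixDirections (n := n) ζ) x)
        = matSoftMin ε β ζ (sumFst x) + ⟪EuclideanSpace.single (Sum.inr ()) 1, x⟫ := by
    intro x
    rw [EuclideanSpace.inner_single_left, map_one, one_mul, matSoftMin, ← softMin_add_const hβ]
    simp only [smoothMin]
    congr 1
    ext z
    rw [shiftedNorm, combination_matrixDirections]
  have hF := lipschitzWith_matSoftMin (n := n) hε hβ hζ
  have hFi := integrable_stdGaussian_of_lipschitz hF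
  have e2 : ∫ x, smoothMin ε β (combination (matrixDirections (n := n) ζ) x)
        ∂(stdGaussian (EuclideanSpace ℝ ((Fin n × Fin p) ⊕ Unit)))
      = ∫ x, matSoftMin ε β ζ x ∂(stdGaussian (EuclideanSpace ℝ (Fin n × Fin p))) := by
    simp_rw [e1]
    rw [integral_add]
    · rw [← map_sumFst_stdGaussian (I := Fin n × Fin p) (J := Unit), integral_map (by fun_prop)
        hF.continuous.aestronglyMeasurable]
      have := integral_strongDual_stdGaussian (innerSL ℝ
        (EuclideanSpace.single (Sum.inr ()) 1 : EuclideanSpace ℝ ((Fin n × Fin p) ⊕ Unit)))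
      simp only [innerSL_apply_apply] at this
      rw [this, add_zero]
    · rw [← map_sumFst_stdGaussian (I := Fin n × Fin p) (J := Unit)] at hFi
      exact hFi.comp_measurable sumFst.continuous.measurable
    · exact ((innerSL ℝ (EuclideanSpace.single (Sum.inr ()) 1 :
        EuclideanSpace ℝ ((Fin n × Fin p) ⊕ Unit))).integrable_comp
          (IsGaussian.integrable_id (μ := stdGaussian _)) :)
  have h3 : meanNorm n - ∫ g, ⨆ z, ⟪ζ z, g⟫ ∂(stdGaussian (Vec p))
        - Real.log (Fintype.card ι) / β
      ≤ ∫ y, smoothMin ε β (combination (decoupledDirections (n := n) ζ) y)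
        ∂(stdGaussian (EuclideanSpace ℝ (Fin n ⊕ Fin p))) := by
    have hi1 : Integrable (fun y : EuclideanSpace ℝ (Fin n ⊕ Fin p) => ‖sumFst y‖)
        (stdGaussian (EuclideanSpace ℝ (Fin n ⊕ Fin p))) := by
      have := integrable_norm_stdGaussian (E := Vec n)
      rw [← map_sumFst_stdGaussian (J := Fin p)] at this
      exact this.comp_measurable sumFst.continuous.measurable
    have hi2 : Integrable (fun y : EuclideanSpace ℝ (Fin n ⊕ Fin p) => ⨆ z, ⟪ζ z, sumSnd y⟫)
        (stdGaussian (EuclideanSpace ℝ (Fin n ⊕ Fin p))) := by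
      have := integrable_iSup_inner_stdGaussian ζ
      rw [← map_sumSnd_stdGaussian (I := Fin n)] at this
      exact this.comp_measurable sumSnd.continuous.measurable
    have e3 : meanNorm n = ∫ y : EuclideanSpace ℝ (Fin n ⊕ Fin p), ‖sumFst y‖
        ∂(stdGaussian (EuclideanSpace ℝ (Fin n ⊕ Fin p))) := by
      rw [meanNorm, ← map_sumFst_stdGaussian (J := Fin p),
        integral_map (by fun_prop) (by fun_prop)]
    have e4 : ∫ g, ⨆ z, ⟪ζ z, g⟫ ∂(stdGaussian (Vec p))
        = ∫ y : EuclideanSpace ℝ (Fin n ⊕ Fin p), ⨆ z, ⟪ζ z, sumSnd y⟫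
        ∂(stdGaussian (EuclideanSpace ℝ (Fin n ⊕ Fin p))) := by
      rw [← map_sumSnd_stdGaussian (I := Fin n), integral_map (by fun_prop)
        (Measurable.iSup fun z => by fun_prop).aestronglyMeasurable]
    have e5 : Real.log (Fintype.card ι) / β
        = ∫ y : EuclideanSpace ℝ (Fin n ⊕ Fin p), Real.log (Fintype.card ι) / β
        ∂(stdGaussian (EuclideanSpace ℝ (Fin n ⊕ Fin p))) := by simp
    have hi3 : Integrable (fun y : EuclideanSpace ℝ (Fin n ⊕ Fin p) =>
        ‖sumFst y‖ - ⨆ z, ⟪ζ z, sumSnd y⟫)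
        (stdGaussian (EuclideanSpace ℝ (Fin n ⊕ Fin p))) := hi1.sub hi2
    rw [e3, e4, e5, ← integral_sub hi1 hi2, ← integral_sub hi3 (integrable_const _)]
    refine integral_mono (hi3.sub (integrable_const _))
      (integrable_stdGaussian_of_lipschitz
        ((lipschitzWith_smoothMin hε hβ).comp
          (combination (decoupledDirections (n := n) ζ)).lipschitz)) fun y => ?_
    refine le_softMin hβ fun z => ?_
    rw [shiftedNorm, combination_decoupledDirections]
    have h5 := norm_le_smoothNorm (ε := ε) (sumFst y : Vec n)
    have h6 := le_ciSup (f := fun z => ⟪ζ z, sumSnd y⟫) (Set.finite_range _).bddAbove z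
    simp only at h6 ⊢
    linarith
  rw [← e2]
  exact h3.trans h

/-- Lower tail of `min ‖X z‖` over finitely many unit vectors `z`. -/
theorem stdGaussian_real_exists_norm_matVec_le {ζ : ι → Vec p} (hζ : ∀ z, ‖ζ z‖ = 1) {t δ : ℝ}
    (ht : 0 ≤ t) (hδ : 0 < δ) :
    (stdGaussian (EuclideanSpace ℝ (Fin n × Fin p))).real
      {x | ∃ z, ‖matVec (ζ z) x‖
        ≤ meanNorm n - ∫ g, ⨆ z, ⟪ζ z, g⟫ ∂(stdGaussian (Vec p)) - t - δ}
      ≤ Real.exp (-t ^ 2 / 2) := by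
  have hcard : 0 ≤ Real.log (Fintype.card ι) :=
    Real.log_natCast_nonneg _
  -- Half of δ pays for the softening loss `log (card ι) / β`, the other half for ε = δ/2 in the
  -- smoothed norm. The `+ 1` keeps β positive when there is only one vector.
  set β := 2 * (Real.log (Fintype.card ι) + 1) / δ with hβd
  have hβ : 0 < β := by positivity
  have hb : Real.log (Fintype.card ι) / β ≤ δ / 2 := by
    rw [div_le_iff₀ hβ, hβd]
    have : δ / 2 * (2 * (Real.log (Fintype.card ι) + 1) / δ)
      = Real.log (Fintype.card ι) + 1 := by field_simp
    linarith
  have hε : 0 < δ / 2 := by positivity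
  refine le_trans ?_ (stdGaussian_real_le_le_of_lipschitz
    (lipschitzWith_matSoftMin (n := n) hε hβ hζ) (contDiff_matSoftMin hε ζ) ht)
  refine measureReal_mono fun x hx => ?_
  obtain ⟨z, hz⟩ := hx
  have h1 := le_integral_matSoftMin (n := n) hε hβ hζ
  have h2 := softMin_le hβ (fun z => smoothNorm (δ / 2) (matVec (ζ z) x)) z
  have h3 := smoothNorm_le hε (matVec (ζ z) x)
  change matSoftMin (δ / 2) β ζ x ≤ _
  change matSoftMin (δ / 2) β ζ x ≤ _ at h2
  linarith

end Gordon

/-! ### Gordon's escape theorem for arbitrary subsets of the unit ball. -/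

section GordonSets

variable {n p : ℕ}

lemma bddAbove_inner_image {S : Set (Vec p)} (hS : S ⊆ Metric.closedBall 0 1) (g : Vec p) :
    BddAbove ((fun z => ⟪g, z⟫) '' S) := by
  refine ⟨‖g‖, ?_⟩
  rintro _ ⟨z, hz, rfl⟩
  have h1 : ‖z‖ ≤ 1 := by simpa using hS hz
  exact (real_inner_le_norm g z).trans (mul_le_of_le_one_right (norm_nonneg g) h1)

lemma lipschitzWith_sSup_inner_image {S : Set (Vec p)} (hS : S ⊆ Metric.closedBall 0 1)
    (hne : S.Nonempty) : LipschitzWith 1 fun g : Vec p => sSup ((fun z => ⟪g, z⟫) '' S) := by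
  refine LipschitzWith.of_le_add fun g g' => csSup_le (hne.image _) ?_
  rintro _ ⟨z, hz, rfl⟩
  have h1 : ‖z‖ ≤ 1 := by simpa using hS hz
  have h2 := le_csSup (bddAbove_inner_image hS g') ⟨z, hz, rfl⟩
  have h3 : ⟪g, z⟫ = ⟪g', z⟫ + ⟪g - g', z⟫ := by rw [inner_sub_left]; ring
  have h4 := (real_inner_le_norm (g - g') z).trans (mul_le_of_le_one_right (norm_nonneg _) h1)
  simp only at h2 ⊢
  rw [dist_eq_norm]
  linarith

lemma integral_iSup_inner_le_gaussianWidth {S : Set (Vec p)} (hS : S ⊆ Metric.closedBall 0 1)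
    {ι : Type*} [Fintype ι] [Nonempty ι] {ζ : ι → Vec p} (hζ : ∀ z, ζ z ∈ S) :
    ∫ g, ⨆ z, ⟪ζ z, g⟫ ∂(stdGaussian (Vec p)) ≤ gaussianWidth S := by
  obtain ⟨z0⟩ := ‹Nonempty ι›
  refine integral_mono (integrable_iSup_inner_stdGaussian ζ) (integrable_stdGaussian_of_lipschitz
    (lipschitzWith_sSup_inner_image hS ⟨_, hζ z0⟩)) fun g => ciSup_le fun z => ?_
  rw [real_inner_comm]
  exact le_csSup (bddAbove_inner_image hS g) ⟨ζ z, hζ z, rfl⟩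

lemma gaussianWidth_nonneg {S : Set (Vec p)} (hS : S ⊆ Metric.closedBall 0 1) (h0 : 0 ∈ S) :
    0 ≤ gaussianWidth S :=
  integral_nonneg fun g => le_csSup (bddAbove_inner_image hS g) ⟨0, h0, inner_zero_right g⟩

/-- A linear form has mean zero. This lets the escape theorem also treat the fixed direction of the
initial error. -/
lemma gaussianWidth_singleton (u : Vec p) : gaussianWidth {u} = 0 := by
  have := integral_strongDual_stdGaussian (innerSL ℝ u)
  simp only [gaussianWidth, Set.image_singleton, csSup_singleton]
  simp_rw [real_inner_comm u]
  simpa using this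

lemma continuous_matVec_left (x : EuclideanSpace ℝ (Fin n × Fin p)) :
    Continuous fun ζ : Vec p => matVec ζ x := by
  refine (PiLp.continuous_toLp 2 _).comp (continuous_pi fun i => ?_)
  fun_prop

/-- **Gordon's escape through the mesh**, with the sharp Gaussian tail. -/
theorem stdGaussian_real_exists_norm_matVec_lt {S : Set (Vec p)}
    (hS : S ⊆ Metric.closedBall 0 1) {t : ℝ} (ht : 0 ≤ t) :
    (stdGaussian (EuclideanSpace ℝ (Fin n × Fin p))).real
      {x | ∃ z ∈ S, ‖z‖ = 1 ∧ ‖matVec z x‖ < meanNorm n - gaussianWidth S - t}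
      ≤ Real.exp (-t ^ 2 / 2) := by
  set G := stdGaussian (EuclideanSpace ℝ (Fin n × Fin p)) with hG
  set T : Set (Vec p) := S ∩ {z | ‖z‖ = 1} with hT
  set s := meanNorm n - gaussianWidth S - t with hs
  rcases T.eq_empty_or_nonempty with hemp | hne
  · have : {x : EuclideanSpace ℝ (Fin n × Fin p) | ∃ z ∈ S, ‖z‖ = 1 ∧ ‖matVec z x‖ < s} = ∅ := by
      refine Set.eq_empty_of_forall_notMem fun x hx => ?_
      obtain ⟨z, hz, hz1, -⟩ := hx
      exact (Set.eq_empty_iff_forall_notMem.1 hemp) z ⟨hz, hz1⟩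
    rw [this, measureReal_empty]
    exact (Real.exp_pos _).le
  have : Nonempty T := hne.to_subtype
  -- Finitely many points of a dense sequence, with slack 1/(k + 1), give events increasing in k
  -- that cover the bad event: the strict inequality is an open condition on z. Continuity from
  -- below then keeps the bound exp(-t²/2), where a union bound would lose it.
  let d : ℕ → T := TopologicalSpace.denseSeq T
  let A : ℕ → Set (EuclideanSpace ℝ (Fin n × Fin p)) := fun k =>
    {x | ∃ z : Fin (k + 1), ‖matVec (d z : Vec p) x‖ ≤ s - 1 / ((k : ℝ) + 1)}
  have hA : ∀ k, G.real (A k) ≤ Real.exp (-t ^ 2 / 2) := by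
    intro k
    have hδ : (0 : ℝ) < 1 / ((k : ℝ) + 1) := by positivity
    refine le_trans (measureReal_mono fun x hx => ?_) (stdGaussian_real_exists_norm_matVec_le
      (n := n) (ζ := fun z : Fin (k + 1) => (d z : Vec p)) (fun z => (d z).2.2) ht hδ)
    obtain ⟨z, hz⟩ := hx
    refine ⟨z, hz.trans ?_⟩
    have := integral_iSup_inner_le_gaussianWidth hS (ζ := fun z : Fin (k + 1) => (d z : Vec p))
      fun z => (d z).2.1
    linarith
  have hmono : Monotone A := by
    intro k l hkl x hx
    obtain ⟨z, hz⟩ := hx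
    refine ⟨⟨z, by omega⟩, hz.trans ?_⟩
    have : 1 / ((l : ℝ) + 1) ≤ 1 / ((k : ℝ) + 1) := by gcongr
    linarith
  have hsub : {x : EuclideanSpace ℝ (Fin n × Fin p) | ∃ z ∈ S, ‖z‖ = 1 ∧ ‖matVec z x‖ < s}
      ⊆ ⋃ k, A k := by
    rintro x ⟨z, hz, hz1, hzs⟩
    have hopen : IsOpen {w : T | ‖matVec (w : Vec p) x‖ < s} :=
      isOpen_lt ((continuous_matVec_left x).comp continuous_subtype_val).norm continuous_const
    obtain ⟨m, hm⟩ := (TopologicalSpace.denseRange_denseSeq T).exists_mem_open hopen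
      ⟨⟨z, hz, hz1⟩, hzs⟩
    have hm' : ‖matVec (d m : Vec p) x‖ < s := hm
    obtain ⟨k, hk⟩ := exists_nat_one_div_lt (sub_pos.2 hm')
    refine Set.mem_iUnion.2 ⟨max m k, ⟨m, by omega⟩, ?_⟩
    have h1 : 1 / (((max m k : ℕ) : ℝ) + 1) ≤ 1 / ((k : ℝ) + 1) := by
      gcongr; exact le_max_right _ _
    simp only
    linarith
  refine (measureReal_mono hsub).trans ?_
  rw [measureReal_def, hmono.measure_iUnion]
  refine ENNReal.toReal_le_of_le_ofReal (Real.exp_pos _).le (iSup_le fun k => ?_)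
  rw [← ENNReal.ofReal_toReal (measure_ne_top G (A k))]
  exact ENNReal.ofReal_le_ofReal (hA k)

end GordonSets

/-! ### Upper tail of the norm of a Gaussian vector. -/

section NormTail

variable {I : Type*} [Fintype I]

lemma integral_norm_sq_stdGaussian :
    ∫ x, ‖x‖ ^ 2 ∂(stdGaussian (EuclideanSpace ℝ I)) = Fintype.card I := by
  classical
  have h : ∀ x : EuclideanSpace ℝ I, ‖x‖ ^ 2 = ∑ i, ⟪EuclideanSpace.single i 1, x⟫ ^ 2 := by
    intro x
    rw [EuclideanSpace.real_norm_sq_eq]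
    simp [EuclideanSpace.inner_single_left]
  simp_rw [h]
  rw [integral_finsetSum _ fun i _ => integrable_inner_sq_stdGaussian _]
  simp [integral_inner_sq_stdGaussian]

lemma integrable_norm_sq_stdGaussian :
    Integrable (fun x => ‖x‖ ^ 2) (stdGaussian (EuclideanSpace ℝ I)) :=
  (IsGaussian.memLp_two_id (μ := stdGaussian (EuclideanSpace ℝ I))).integrable_norm_pow two_ne_zero

/-- A standard Gaussian vector in dimension `N` has norm at most `1.125 √N` with high
probability. -/
lemma stdGaussian_real_le_norm_le :
    (stdGaussian (EuclideanSpace ℝ I)).real {x | 1.125 * √(Fintype.card I) ≤ ‖x‖}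
      ≤ Real.exp (-0.007 * Fintype.card I) := by
  rcases isEmpty_or_nonempty I with hI | hI
  · simp
  set N : ℝ := (Fintype.card I : ℝ) with hN
  have hNpos : 0 < N := by rw [hN]; exact_mod_cast Fintype.card_pos
  have hr : 0 < √N := Real.sqrt_pos.2 hNpos
  have hr2 : √N ^ 2 = N := Real.sq_sqrt hNpos.le
  -- The concentration bound asks for a C¹ function, so the norm is smoothed at scale 0.1√N.
  have hε : 0 < 0.1 * √N := by positivity
  set f : EuclideanSpace ℝ I → ℝ := smoothNorm (0.1 * √N) with hf
  have hlip : LipschitzWith 1 f := LipschitzWith.of_dist_le_mul fun x y => by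
    rw [Real.dist_eq, dist_eq_norm, NNReal.coe_one, one_mul]; exact abs_smoothNorm_sub_le hε x y
  have hmean : ∫ x, f x ∂(stdGaussian (EuclideanSpace ℝ I)) ≤ 1.005 * √N := by
    -- A tangent line bounds f by f² = ‖x‖² + 0.01N, in place of Jensen's inequality. The constant
    -- fits since 1.005² + 0.01 ≤ 1.02005 and 1 + 1.02005 = 2 · 1.005².
    have h1 : ∀ x, f x ≤ (2 * (1.005 * √N))⁻¹ * (‖x‖ ^ 2 + 1.02005 * N) := by
      intro x
      have h2 := smoothNorm_sq (ε := 0.1 * √N) x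
      rw [inv_mul_eq_div, le_div_iff₀ (by positivity)]
      have h3 : f x ^ 2 = ‖x‖ ^ 2 + 0.01 * N := by rw [hf, h2, mul_pow, hr2]; norm_num
      nlinarith [sq_nonneg (f x - 1.005 * √N)]
    refine (integral_mono (integrable_stdGaussian_of_lipschitz hlip)
      ((integrable_norm_sq_stdGaussian.add (integrable_const (1.02005 * N))).const_mul _) h1).trans
      ?_
    rw [integral_const_mul, integral_add' integrable_norm_sq_stdGaussian (integrable_const _),
      integral_norm_sq_stdGaussian, integral_const, probReal_univ, one_smul, ← hN,
      inv_mul_le_iff₀ (by positivity)]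
    nlinarith
  -- Here 1.005 + 0.1199 < 1.125, and 0.1199²/2 > 0.007 gives the exponent.
  have h := stdGaussian_real_ge_le_of_lipschitz hlip (contDiff_smoothNorm hε)
    (t := 0.1199 * √N) (by positivity)
  refine (measureReal_mono fun x hx => ?_).trans (h.trans (Real.exp_le_exp.2 ?_))
  · have h1 : ‖x‖ ≤ f x := norm_le_smoothNorm x
    have h2 : 1.125 * √N ≤ ‖x‖ := hx
    change _ ≤ f x
    linarith
  · rw [mul_pow, hr2]; linarith

end NormTail

/-! ### The mean norm b_n in terms of Gamma functions. -/

section MeanNorm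

/-- The density of the standard Gaussian measure. -/
lemma stdGaussian_eq_withDensity (n : ℕ) :
    stdGaussian (Vec n) = (volume : Measure (Vec n)).withDensity fun x =>
      ENNReal.ofReal (((2 * Real.pi) ^ (n / 2 : ℝ))⁻¹ * Real.exp (-(1 / 2) * ‖x‖ ^ 2)) := by
  set Z : ℝ := (2 * Real.pi) ^ (n / 2 : ℝ) with hZ
  have hZpos : 0 < Z := by positivity
  have hmeas : Measurable fun x : Vec n => ENNReal.ofReal (Z⁻¹ * Real.exp (-(1 / 2) * ‖x‖ ^ 2)) :=
      by
    fun_prop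
  have hint : ∫ x : Vec n, Real.exp (-(1 / 2) * ‖x‖ ^ 2) = Z := by
    have := GaussianFourier.integral_rexp_neg_mul_sq_norm (V := Vec n) (b := 1 / 2) (by norm_num)
    rw [this, hZ, finrank_euclideanSpace_fin]
    congr 1
    ring
  have hi : Integrable fun x : Vec n => Real.exp (-(1 / 2) * ‖x‖ ^ 2) :=
    not_imp_comm.1 integral_undef (by rw [hint]; exact hZpos.ne')
  have hprob : IsProbabilityMeasure ((volume : Measure (Vec n)).withDensity fun x =>
      ENNReal.ofReal (Z⁻¹ * Real.exp (-(1 / 2) * ‖x‖ ^ 2))) := by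
    refine ⟨?_⟩
    rw [withDensity_apply _ MeasurableSet.univ, Measure.restrict_univ,
      ← ofReal_integral_eq_lintegral_ofReal (hi.const_mul _)
        (ae_of_all _ fun x => by positivity), integral_const_mul, hint,
      inv_mul_cancel₀ hZpos.ne', ENNReal.ofReal_one]
  refine Measure.ext_of_charFun (funext fun t => ?_)
  rw [charFun_stdGaussian, charFun_apply, integral_withDensity_eq_integral_toReal_smul hmeas
    (ae_of_all _ fun _ => ENNReal.ofReal_lt_top)]
  have h1 := GaussianFourier.integral_cexp_neg_mul_sq_norm_add (V := Vec n) (b := 1 / 2)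
    (by norm_num) Complex.I t
  have h2 : ∀ x : Vec n, (ENNReal.ofReal (Z⁻¹ * Real.exp (-(1 / 2) * ‖x‖ ^ 2))).toReal •
      Complex.exp (⟪x, t⟫ * Complex.I)
      = (Z : ℂ)⁻¹ * Complex.exp (-(1 / 2 : ℂ) * ‖x‖ ^ 2 + Complex.I * ⟪t, x⟫) := by
    intro x
    rw [ENNReal.toReal_ofReal (by positivity), Complex.real_smul, Complex.exp_add,
      real_inner_comm t x]
    push_cast
    rw [mul_comm Complex.I, mul_assoc]
  simp_rw [h2]
  rw [integral_const_mul, h1, finrank_euclideanSpace_fin]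
  have h3 : ((Real.pi : ℂ) / (1 / 2)) ^ ((n : ℂ) / 2) = (Z : ℂ) := by
    rw [hZ, Complex.ofReal_cpow (by positivity)]
    push_cast
    congr 1
    ring
  rw [h3, ← mul_assoc, inv_mul_cancel₀ (by exact_mod_cast hZpos.ne'), one_mul]
  congr 1
  rw [Complex.I_sq]
  ring

/-- Polar coordinates are applied both to the Gaussian weight and to ‖x‖ times it. In the quotient
the volume of the unit ball cancels, leaving a ratio of two one-dimensional Gamma integrals. -/
lemma meanNorm_eq_phi {n : ℕ} (hn : 0 < n) : meanNorm n = phi n := by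
  set Z : ℝ := (2 * Real.pi) ^ (n / 2 : ℝ) with hZ
  have hZpos : 0 < Z := by positivity
  have hmeas : Measurable fun x : Vec n => ENNReal.ofReal (Z⁻¹ * Real.exp (-(1 / 2) * ‖x‖ ^ 2)) :=
      by
    fun_prop
  have hint : ∫ x : Vec n, Real.exp (-(1 / 2) * ‖x‖ ^ 2) = Z := by
    have := GaussianFourier.integral_rexp_neg_mul_sq_norm (V := Vec n) (b := 1 / 2) (by norm_num)
    rw [this, hZ, finrank_euclideanSpace_fin]
    congr 1
    ring
  have : Nonempty (Fin n) := ⟨⟨0, hn⟩⟩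
  have hpolar0 := integral_fun_norm_addHaar (volume : Measure (Vec n))
    (fun r => Real.exp (-(1 / 2) * r ^ 2))
  have hpolar1 := integral_fun_norm_addHaar (volume : Measure (Vec n))
    (fun r => r * Real.exp (-(1 / 2) * r ^ 2))
  rw [finrank_euclideanSpace_fin] at hpolar0 hpolar1
  have hI : ∀ k : ℕ, ∫ y in Set.Ioi (0 : ℝ), y ^ k * Real.exp (-(1 / 2) * y ^ 2)
      = (1 / 2 : ℝ) ^ (-((k : ℝ) + 1) / 2) * (1 / 2) * Real.Gamma (((k : ℝ) + 1) / 2) := by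
    intro k
    rw [← integral_rpow_mul_exp_neg_mul_rpow (p := 2) (q := k) (b := 1 / 2) two_pos
      (by have : (0 : ℝ) ≤ k := k.cast_nonneg
          linarith) (by norm_num)]
    simp
  have e0 : ∫ y in Set.Ioi (0 : ℝ), y ^ (n - 1) • Real.exp (-(1 / 2) * y ^ 2)
      = (1 / 2 : ℝ) ^ (-(n : ℝ) / 2) * (1 / 2) * Real.Gamma ((n : ℝ) / 2) := by
    simp only [smul_eq_mul]
    rw [hI, Nat.cast_sub hn, Nat.cast_one, sub_add_cancel]
  have e1 : ∫ y in Set.Ioi (0 : ℝ), y ^ (n - 1) • (y * Real.exp (-(1 / 2) * y ^ 2))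
      = (1 / 2 : ℝ) ^ (-((n : ℝ) + 1) / 2) * (1 / 2) * Real.Gamma (((n : ℝ) + 1) / 2) := by
    rw [← hI]
    congr 1
    ext y
    rw [smul_eq_mul, ← mul_assoc, ← pow_succ, Nat.sub_add_cancel hn]
  rw [e0, hint] at hpolar0
  rw [e1] at hpolar1
  have hm : meanNorm n = Z⁻¹ * ∫ x : Vec n, ‖x‖ * Real.exp (-(1 / 2) * ‖x‖ ^ 2) := by
    rw [meanNorm, stdGaussian_eq_withDensity, integral_withDensity_eq_integral_toReal_smul hmeas
      (ae_of_all _ fun _ => ENNReal.ofReal_lt_top), ← integral_const_mul]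
    congr 1
    ext x
    rw [ENNReal.toReal_ofReal (by positivity), smul_eq_mul]
    ring
  rw [hm, hpolar1, hpolar0, phi]
  have hball : 0 < (volume : Measure (Vec n)).real (Metric.ball 0 1) :=
    ENNReal.toReal_pos (Metric.measure_ball_pos _ _ one_pos).ne' measure_ball_lt_top.ne
  have hG : 0 < Real.Gamma ((n : ℝ) / 2) := Real.Gamma_pos_of_pos (by positivity)
  have hn' : (0 : ℝ) < n := by exact_mod_cast hn
  have hp : (1 / 2 : ℝ) ^ (-((n : ℝ) + 1) / 2) = (1 / 2 : ℝ) ^ (-(n : ℝ) / 2) * √2 := by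
    rw [show -((n : ℝ) + 1) / 2 = -(n : ℝ) / 2 + -(1 / 2) by ring,
      Real.rpow_add (by norm_num), Real.sqrt_eq_rpow, one_div, Real.inv_rpow (by norm_num) (-_),
      Real.rpow_neg (by norm_num), inv_inv]
  have hp0 : 0 < (1 / 2 : ℝ) ^ (-(n : ℝ) / 2) := by positivity
  rw [hp]
  simp only [nsmul_eq_mul, smul_eq_mul]
  field_simp

end MeanNorm

/-! ### Monotonicity of φ(s)²/s, continuity of φ and its range. -/

section Phi

/-- The logarithm of `φ(2x)² / (2x)`. -/
noncomputable def logGammaGap (x : ℝ) : ℝ :=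
  2 * Real.log (Real.Gamma (x + 1 / 2)) - Real.log (Real.Gamma x) - Real.log (Real.Gamma (x + 1))

lemma logGammaGap_add_one {x : ℝ} (hx : 0 < x) :
    logGammaGap (x + 1) - logGammaGap x = Real.log (1 + 1 / (4 * (x * (x + 1)))) := by
  have h1 : Real.log (Real.Gamma (x + 1)) = Real.log x + Real.log (Real.Gamma x) := by
    rw [Real.Gamma_add_one hx.ne', Real.log_mul hx.ne' (Real.Gamma_pos_of_pos hx).ne']
  have h2 : Real.log (Real.Gamma (x + 1 + 1))
      = Real.log (x + 1) + Real.log (Real.Gamma (x + 1)) := by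
    rw [Real.Gamma_add_one (by positivity), Real.log_mul (by positivity)
      (Real.Gamma_pos_of_pos (by positivity)).ne']
  have h3 : Real.log (Real.Gamma (x + 1 + 1 / 2))
      = Real.log (x + 1 / 2) + Real.log (Real.Gamma (x + 1 / 2)) := by
    rw [show x + 1 + 1 / 2 = (x + 1 / 2) + 1 by ring, Real.Gamma_add_one (by positivity),
      Real.log_mul (by positivity) (Real.Gamma_pos_of_pos (by positivity)).ne']
  have h4 : Real.log (1 + 1 / (4 * (x * (x + 1))))
      = 2 * Real.log (x + 1 / 2) - Real.log x - Real.log (x + 1) := by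
    have : 1 + 1 / (4 * (x * (x + 1))) = (x + 1 / 2) ^ 2 / (x * (x + 1)) := by
      field_simp; ring
    rw [this, Real.log_div (by positivity) (by positivity), Real.log_pow,
      Real.log_mul (by positivity) (by positivity)]
    push_cast; ring
  rw [h4, logGammaGap, logGammaGap, h1, h2, h3]
  rw [h1]
  ring

lemma logGammaGap_nonpos {x : ℝ} (hx : 0 < x) : logGammaGap x ≤ 0 := by
  have h := Real.convexOn_log_Gamma.2 (Set.mem_Ioi.2 hx) (Set.mem_Ioi.2 (by linarith : 0 < x + 1))
    (by norm_num : (0 : ℝ) ≤ 1 / 2) (by norm_num : (0 : ℝ) ≤ 1 / 2) (by norm_num)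
  simp only [smul_eq_mul, Function.comp_apply] at h
  rw [show 1 / 2 * x + 1 / 2 * (x + 1) = x + 1 / 2 by ring] at h
  rw [logGammaGap]
  linarith

/-- Midpoint log-convexity of Γ between x + 1/2 and x + 3/2. With the upper bound from the pair x, x
+ 1, it squeezes the gap to 0 at infinity. -/
lemma neg_log_le_logGammaGap {x : ℝ} (hx : 0 < x) :
    -Real.log (1 + 1 / (2 * x)) ≤ logGammaGap x := by
  have h := Real.convexOn_log_Gamma.2 (Set.mem_Ioi.2 (by linarith : 0 < x + 1 / 2))
    (Set.mem_Ioi.2 (by linarith : 0 < x + 1 / 2 + 1))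
    (by norm_num : (0 : ℝ) ≤ 1 / 2) (by norm_num : (0 : ℝ) ≤ 1 / 2) (by norm_num)
  simp only [smul_eq_mul, Function.comp_apply] at h
  rw [show 1 / 2 * (x + 1 / 2) + 1 / 2 * (x + 1 / 2 + 1) = x + 1 by ring] at h
  have h1 : Real.log (Real.Gamma (x + 1)) = Real.log x + Real.log (Real.Gamma x) := by
    rw [Real.Gamma_add_one hx.ne', Real.log_mul hx.ne' (Real.Gamma_pos_of_pos hx).ne']
  have h2 : Real.log (Real.Gamma (x + 1 / 2 + 1))
      = Real.log (x + 1 / 2) + Real.log (Real.Gamma (x + 1 / 2)) := by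
    rw [Real.Gamma_add_one (by positivity), Real.log_mul (by positivity)
      (Real.Gamma_pos_of_pos (by positivity)).ne']
  have h3 : Real.log (1 + 1 / (2 * x)) = Real.log (x + 1 / 2) - Real.log x := by
    rw [← Real.log_div (by positivity) hx.ne']
    congr 1
    field_simp
  rw [h3, logGammaGap]
  rw [h2] at h
  linarith

lemma tendsto_logGammaGap_add_natCast {x : ℝ} (hx : 0 < x) :
    Filter.Tendsto (fun N : ℕ => logGammaGap (x + N)) Filter.atTop (nhds 0) := by
  have h1 : Filter.Tendsto (fun N : ℕ => -Real.log (1 + 1 / (2 * (x + N)))) Filter.atTop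
      (nhds (-Real.log (1 + 0))) := by
    refine ((Filter.Tendsto.const_add 1 ?_).log (by norm_num)).neg
    refine Filter.Tendsto.div_atTop tendsto_const_nhds ?_
    exact (Filter.tendsto_atTop_add_const_left _ x tendsto_natCast_atTop_atTop).const_mul_atTop
      two_pos
  rw [add_zero, Real.log_one, neg_zero] at h1
  have hpos : ∀ N : ℕ, 0 < x + N := fun N => by positivity
  exact tendsto_of_tendsto_of_tendsto_of_le_of_le h1 tendsto_const_nhds
    (fun N => neg_log_le_logGammaGap (hpos N)) fun N => logGammaGap_nonpos (hpos N)

/-- The unit increment log(1 + 1/(4x(x + 1))) decreases in x, so the difference of the gaps at y + N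
and x + N is nonincreasing in N. Its limit is 0, so it is nonnegative at N = 0. -/
lemma logGammaGap_mono {x y : ℝ} (hx : 0 < x) (hxy : x ≤ y) : logGammaGap x ≤ logGammaGap y := by
  have hanti : Antitone fun N : ℕ => logGammaGap (y + N) - logGammaGap (x + N) := by
    refine antitone_nat_of_succ_le fun N => ?_
    have hxN : 0 < x + N := by positivity
    have hyN : 0 < y + N := by linarith
    have h1 := logGammaGap_add_one hxN
    have h2 := logGammaGap_add_one hyN
    have h3 : Real.log (1 + 1 / (4 * ((y + N) * (y + N + 1))))
        ≤ Real.log (1 + 1 / (4 * ((x + N) * (x + N + 1)))) := by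
      refine Real.log_le_log (by positivity) ?_
      gcongr
    push_cast
    rw [← add_assoc, ← add_assoc]
    linarith
  have hlim := (tendsto_logGammaGap_add_natCast (hx.trans_le hxy)).sub
    (tendsto_logGammaGap_add_natCast hx)
  rw [sub_zero] at hlim
  have := hanti.le_of_tendsto hlim 0
  simp only [Nat.cast_zero, add_zero] at this
  linarith

lemma phi_sq_div {s : ℝ} (hs : 0 < s) : phi s ^ 2 / s = Real.exp (logGammaGap (s / 2)) := by
  have h0 : 0 < s / 2 := by positivity
  have h1 := Real.Gamma_pos_of_pos h0
  have h2 := Real.Gamma_pos_of_pos (by positivity : 0 < s / 2 + 1 / 2)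
  have h3 := Real.Gamma_pos_of_pos (by positivity : 0 < s / 2 + 1)
  have e : Real.exp (logGammaGap (s / 2)) = Real.Gamma (s / 2 + 1 / 2) ^ 2 /
      Real.Gamma (s / 2) / Real.Gamma (s / 2 + 1) := by
    rw [logGammaGap, Real.exp_sub, Real.exp_sub, Real.exp_log h1, Real.exp_log h3,
      two_mul, Real.exp_add, Real.exp_log h2, sq]
  rw [e, Real.Gamma_add_one h0.ne', phi, add_div, div_pow, mul_pow, Real.sq_sqrt zero_le_two]
  field_simp

lemma phi_zero : phi 0 = 0 := by simp [phi]

lemma phi_nonneg {s : ℝ} (hs : 0 ≤ s) : 0 ≤ phi s := by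
  rw [phi]
  have := Real.Gamma_pos_of_pos (by positivity : 0 < (s + 1) / 2)
  have := Real.Gamma_nonneg_of_nonneg (by positivity : 0 ≤ s / 2)
  positivity

lemma phi_pos {s : ℝ} (hs : 0 < s) : 0 < phi s := by
  rw [phi]
  have := Real.Gamma_pos_of_pos (by positivity : 0 < (s + 1) / 2)
  have := Real.Gamma_pos_of_pos (by positivity : 0 < s / 2)
  positivity

/-- With s = n₀ and r = n this bounds ω + t by √(n₀/n) b_n, the source of the factor 1 - √(n₀/n). -/
lemma phi_le_sqrt_mul_phi {s r : ℝ} (hs : 0 ≤ s) (hr : 0 < r) (hsr : s ≤ r) :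
    phi s ≤ √(s / r) * phi r := by
  rcases hs.eq_or_lt with rfl | hs'
  · simp [phi_zero]
  refine (sq_le_sq₀ (phi_nonneg hs) (mul_nonneg (Real.sqrt_nonneg _) (phi_nonneg hr.le))).1 ?_
  have h : phi s ^ 2 / s ≤ phi r ^ 2 / r := by
    rw [phi_sq_div hs', phi_sq_div hr]
    exact Real.exp_le_exp.2 (logGammaGap_mono (by positivity) (by linarith))
  rw [mul_pow, Real.sq_sqrt (by positivity)]
  rw [div_le_iff₀ hs'] at h
  exact h.trans (le_of_eq (by ring))

/-- The ratio φ(s)²/s is nondecreasing and equals 2/π at s = 1. -/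
lemma two_div_pi_mul_le_phi_sq {s : ℝ} (hs : 1 ≤ s) : 2 / Real.pi * s ≤ phi s ^ 2 := by
  have h1 : phi 1 ^ 2 / 1 = 2 / Real.pi := by
    rw [phi, show ((1 : ℝ) + 1) / 2 = 1 by norm_num, Real.Gamma_one, Real.Gamma_one_half_eq,
      mul_one, div_one, div_pow, Real.sq_sqrt zero_le_two, Real.sq_sqrt Real.pi_pos.le]
  have hs0 : 0 < s := by linarith
  have h2 : phi 1 ^ 2 / 1 ≤ phi s ^ 2 / s := by
    rw [phi_sq_div one_pos, phi_sq_div hs0]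
    exact Real.exp_le_exp.2 (logGammaGap_mono (by norm_num) (by linarith))
  rw [h1, le_div_iff₀ hs0] at h2
  exact h2

lemma continuousOn_phi : ContinuousOn phi (Set.Ici 0) := by
  have hΓ : ∀ s : ℝ, 0 < s → ContinuousAt Real.Gamma s := fun s hs =>
    (Real.differentiableAt_Gamma fun m => by
      have : (0 : ℝ) ≤ m := m.cast_nonneg
      linarith).continuousAt
  -- The pole of Γ(s/2) at 0 is removed by writing 1/Γ(s/2) = (s/2)/Γ(s/2 + 1).
  have h : ∀ s ∈ Set.Ici (0 : ℝ), phi s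
      = √2 * Real.Gamma ((s + 1) / 2) * (s / 2) / Real.Gamma (s / 2 + 1) := by
    intro s hs
    rcases (Set.mem_Ici.1 hs).eq_or_lt with rfl | hs'
    · simp [phi]
    · have h0 : 0 < s / 2 := by positivity
      have := Real.Gamma_pos_of_pos h0
      rw [phi, Real.Gamma_add_one h0.ne']
      field_simp
  refine ContinuousOn.congr (fun s hs => ContinuousAt.continuousWithinAt ?_) h
  have hs0 : 0 ≤ s := hs
  have h1 : ContinuousAt (fun s : ℝ => Real.Gamma ((s + 1) / 2)) s :=
    ContinuousAt.comp (f := fun s : ℝ => (s + 1) / 2) (hΓ _ (by positivity)) (by fun_prop)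
  have h2 : ContinuousAt (fun s : ℝ => Real.Gamma (s / 2 + 1)) s :=
    ContinuousAt.comp (f := fun s : ℝ => s / 2 + 1) (hΓ _ (by positivity)) (by fun_prop)
  exact ((continuousAt_const.mul h1).mul (by fun_prop)).div h2
    (Real.Gamma_pos_of_pos (by positivity)).ne'

lemma exists_phi_eq {a : ℝ} (ha : 0 ≤ a) : ∃ s ∈ Set.Ici (0 : ℝ), phi s = a := by
  obtain ⟨r, hr1, hra⟩ : ∃ r : ℝ, 1 ≤ r ∧ a ≤ phi r := by
    -- As π ≤ 4, φ(s)² ≥ s/2 for s ≥ 1, which exceeds a² at this point.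
    refine ⟨1 + 2 * a ^ 2, by nlinarith [sq_nonneg a], ?_⟩
    have h1 : 1 ≤ 1 + 2 * a ^ 2 := by nlinarith [sq_nonneg a]
    have h2 := two_div_pi_mul_le_phi_sq h1
    have h3 : (1 : ℝ) / 2 ≤ 2 / Real.pi := by
      rw [div_le_div_iff₀ two_pos Real.pi_pos]; linarith [Real.pi_le_four]
    have h4 := phi_nonneg (by linarith : 0 ≤ 1 + 2 * a ^ 2)
    refine abs_le_of_sq_le_sq' ?_ h4 |>.2
    nlinarith
  have h := intermediate_value_Icc (by linarith : (0 : ℝ) ≤ r)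
    (continuousOn_phi.mono Set.Icc_subset_Ici_self)
  obtain ⟨s, hs, e⟩ := h ⟨by rw [phi_zero]; exact ha, hra⟩
  exact ⟨s, hs.1, e⟩

end Phi

/-! ### Euclidean projection onto a closed convex set. -/

section Projection

variable {p : ℕ} {K : Set (Vec p)}

lemma projOnto_spec (hne : K.Nonempty) (hcl : IsClosed K) (hcv : Convex ℝ K) (z : Vec p) :
    projOnto K z ∈ K ∧ ∀ w ∈ K, ‖z - projOnto K z‖ ≤ ‖z - w‖ := by
  obtain ⟨u, hu, huz⟩ := exists_norm_eq_iInf_of_complete_convex hne hcl.isComplete hcv z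
  refine Classical.epsilon_spec (p := fun v => v ∈ K ∧ ∀ w ∈ K, ‖z - v‖ ≤ ‖z - w‖)
    ⟨u, hu, fun w hw => ?_⟩
  rw [huz]
  exact ciInf_le (f := fun w : K => ‖z - w‖) ⟨0, by rintro _ ⟨w, rfl⟩; exact norm_nonneg _⟩ ⟨w, hw⟩

/-- At the projection, the directions to z and to any point of K form an angle of at least π/2, so
expanding ‖z - v‖² leaves only nonnegative extra terms. -/
lemma norm_projOnto_sub_le (hcl : IsClosed K) (hcv : Convex ℝ K) {v : Vec p} (hv : v ∈ K)
    (z : Vec p) : ‖projOnto K z - v‖ ≤ ‖z - v‖ := by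
  obtain ⟨hP, hmin⟩ := projOnto_spec ⟨v, hv⟩ hcl hcv z
  have hne : Nonempty K := ⟨⟨v, hv⟩⟩
  have h1 : ‖z - projOnto K z‖ = ⨅ w : K, ‖z - w‖ :=
    le_antisymm (le_ciInf fun w => hmin w w.2)
      (ciInf_le (f := fun w : K => ‖z - w‖) ⟨0, by rintro _ ⟨w, rfl⟩; exact norm_nonneg _⟩ ⟨_, hP⟩)
  have h2 := (norm_eq_iInf_iff_real_inner_le_zero hcv hP).1 h1 v hv
  have h3 : ‖z - v‖ ^ 2 = ‖z - projOnto K z‖ ^ 2 - 2 * ⟪z - projOnto K z, v - projOnto K z⟫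
      + ‖projOnto K z - v‖ ^ 2 := by
    rw [show z - v = (z - projOnto K z) - (v - projOnto K z) by abel, norm_sub_sq_real,
      norm_sub_rev v]
  refine (sq_le_sq₀ (norm_nonneg _) (norm_nonneg _)).1 ?_
  nlinarith [sq_nonneg ‖z - projOnto K z‖]

end Projection

/-! ### Contraction of the iteration for a fixed matrix. -/

section Descent

variable {n p : ℕ} {K : Set (Vec p)}

/-- With a = ⟨x, θ - v⟩ and w = y - ⟨x, v⟩, the residual is w - a, and 2(w - a)a + (w - a)² = w² -
a² has no cross term. Multiplying through by ‖x‖² also covers zero rows. -/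
lemma sq_mul_norm_psgdStep_sub_le (hcl : IsClosed K) (hcv : Convex ℝ K) {v : Vec p} (hv : v ∈ K)
    (X : Matrix (Fin n) (Fin p) ℝ) (y : Fin n → ℝ) (i : Fin n) (θ : Vec p) :
    ‖rowVec X i‖ ^ 2 * ‖psgdStep K X y i θ - v‖ ^ 2
      ≤ ‖rowVec X i‖ ^ 2 * ‖θ - v‖ ^ 2 - ⟪rowVec X i, θ - v⟫ ^ 2 + (y i - ⟪rowVec X i, v⟫) ^ 2 := by
  set x := rowVec X i with hx
  rcases eq_or_ne x 0 with h0 | h0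
  · rw [h0]; simp; positivity
  have hxn : 0 < ‖x‖ := norm_pos_iff.2 h0
  have h1 : ‖psgdStep K X y i θ - v‖ ^ 2
      ≤ ‖(θ - v) + ((y i - ⟪x, θ⟫) / ‖x‖ ^ 2) • x‖ ^ 2 := by
    refine pow_le_pow_left₀ (norm_nonneg _) ?_ 2
    refine (norm_projOnto_sub_le hcl hcv hv _).trans (le_of_eq ?_)
    congr 1
    rw [← hx]; abel
  have h2 : ⟪x, θ - v⟫ = ⟪x, θ⟫ - ⟪x, v⟫ := inner_sub_right _ _ _
  have h3 : ‖(θ - v) + ((y i - ⟪x, θ⟫) / ‖x‖ ^ 2) • x‖ ^ 2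
      = ‖θ - v‖ ^ 2 + 2 * ((y i - ⟪x, θ⟫) / ‖x‖ ^ 2 * ⟪x, θ - v⟫)
        + (y i - ⟪x, θ⟫) ^ 2 / ‖x‖ ^ 2 := by
    rw [norm_add_sq_real, inner_smul_right, real_inner_comm x, norm_smul, mul_pow,
      Real.norm_eq_abs, sq_abs]
    field_simp
  refine (mul_le_mul_of_nonneg_left h1 (by positivity)).trans (le_of_eq ?_)
  rw [h3, h2]
  field_simp
  ring

/-- The squared Frobenius norm. -/
noncomputable def frobSq (X : Matrix (Fin n) (Fin p) ℝ) : ℝ := ∑ k, ‖rowVec X k‖ ^ 2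

lemma integral_rowLaw (X : Matrix (Fin n) (Fin p) ℝ) (f : Fin n → ℝ) :
    ∫ i, f i ∂(rowLaw X) = ∑ i, ‖rowVec X i‖ ^ 2 / frobSq X * f i := by
  rw [rowLaw, integral_finsetSum_measure fun i _ =>
    ((integrable_dirac (by simp)).smul_measure ENNReal.ofReal_ne_top)]
  refine Finset.sum_congr rfl fun i _ => ?_
  rw [integral_smul_measure, integral_dirac, ENNReal.toReal_ofReal, smul_eq_mul, frobSq]
  exact div_nonneg (sq_nonneg _) (Finset.sum_nonneg fun _ _ => sq_nonneg _)

instance isFiniteMeasure_rowLaw (X : Matrix (Fin n) (Fin p) ℝ) : IsFiniteMeasure (rowLaw X) := by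
  refine ⟨?_⟩
  simp only [rowLaw, Measure.finsetSum_apply, Measure.smul_apply, smul_eq_mul]
  exact ENNReal.sum_lt_top.2 fun i _ => by simp

lemma isProbabilityMeasure_rowLaw {X : Matrix (Fin n) (Fin p) ℝ} (hX : 0 < frobSq X) :
    IsProbabilityMeasure (rowLaw X) := by
  have h := integral_rowLaw X fun _ => 1
  simp only [mul_one] at h
  rw [← Finset.sum_div, integral_const, smul_eq_mul, mul_one] at h
  rw [← frobSq, div_self hX.ne'] at h
  refine ⟨?_⟩
  rwa [measureReal_def, ENNReal.toReal_eq_one_iff] at h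

/-- This is conditioning on the earlier indices: the last one is independent of them and is
integrated first. -/
lemma integral_psgd_succ (X : Matrix (Fin n) (Fin p) ℝ) (τ : ℕ)
    (F : (Fin τ → Fin n) → Fin n → ℝ) :
    ∫ ψ, F (Fin.init ψ) (ψ (Fin.last τ)) ∂(Measure.pi fun _ : Fin (τ + 1) => rowLaw X)
      = ∫ ψ, ∑ i, ‖rowVec X i‖ ^ 2 / frobSq X * F ψ i ∂(Measure.pi fun _ : Fin τ => rowLaw X) := by
  have h := measurePreserving_piFinSuccAbove (fun _ : Fin (τ + 1) => rowLaw X) (Fin.last τ)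
  have h1 := h.integral_comp' (fun z => F z.2 z.1)
  have h2 : ∀ ψ : Fin (τ + 1) → Fin n,
      F (MeasurableEquiv.piFinSuccAbove (fun _ => Fin n) (Fin.last τ) ψ).2
        (MeasurableEquiv.piFinSuccAbove (fun _ => Fin n) (Fin.last τ) ψ).1
      = F (Fin.init ψ) (ψ (Fin.last τ)) := by
    intro ψ
    simp [MeasurableEquiv.piFinSuccAbove, Fin.insertNthEquiv, Fin.removeNth_last]
  simp_rw [h2] at h1
  rw [h1, integral_prod_symm _ (Integrable.of_finite)]
  simp_rw [integral_rowLaw]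

/-- The contraction of the expected squared error over the iterations. -/
theorem expectedSqError_le (hcl : IsClosed K) (hcv : Convex ℝ K) {v : Vec p} (hv : v ∈ K)
    (X : Matrix (Fin n) (Fin p) ℝ) (y : Fin n → ℝ) (θ₀ : Vec p) {m δ : ℝ} (hm : 0 < m)
    (hδ1 : δ ≤ 1) (hδ : δ * frobSq X ≤ m ^ 2)
    (hK : ∀ θ ∈ K, m ^ 2 * ‖θ - v‖ ^ 2 ≤ ∑ i, ⟪rowVec X i, θ - v⟫ ^ 2)
    (h0 : m ^ 2 * ‖θ₀ - v‖ ^ 2 ≤ ∑ i, ⟪rowVec X i, θ₀ - v⟫ ^ 2) (τ : ℕ) :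
    expectedSqError K X y θ₀ v τ ≤ (1 - δ) ^ τ * ‖θ₀ - v‖ ^ 2
      + (∑ i, (y i - ⟪rowVec X i, v⟫) ^ 2) / m ^ 2 := by
  set W := ∑ i, (y i - ⟪rowVec X i, v⟫) ^ 2 with hW
  have hW0 : 0 ≤ W := Finset.sum_nonneg fun _ _ => sq_nonneg _
  -- Every later iterate is a projection, hence in K; only `θ₀` may lie outside, which is what `h0`
  -- is for.
  have hinv : ∀ τ (ψ : Fin τ → Fin n), m ^ 2 * ‖psgdIter K X y θ₀ τ ψ - v‖ ^ 2
      ≤ ∑ i, ⟪rowVec X i, psgdIter K X y θ₀ τ ψ - v⟫ ^ 2 := by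
    intro τ ψ
    cases τ with
    | zero => exact h0
    | succ τ => exact hK _ (projOnto_spec ⟨v, hv⟩ hcl hcv _).1
  -- If ‖X‖_F < m, then m²‖e‖² ≤ ‖Xe‖² ≤ ‖X‖_F²‖e‖² forces e = 0. This also disposes of X = 0, where
  -- `rowLaw X` is not a probability measure.
  rcases lt_or_ge (frobSq X) (m ^ 2) with hS | hS
  · have hz : ∀ τ (ψ : Fin τ → Fin n), ‖psgdIter K X y θ₀ τ ψ - v‖ ^ 2 = 0 := by
      intro τ ψ
      have h1 := hinv τ ψ
      have h2 : ∑ i, ⟪rowVec X i, psgdIter K X y θ₀ τ ψ - v⟫ ^ 2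
          ≤ frobSq X * ‖psgdIter K X y θ₀ τ ψ - v‖ ^ 2 := by
        rw [frobSq, Finset.sum_mul]
        refine Finset.sum_le_sum fun i _ => ?_
        rw [← mul_pow, ← sq_abs]
        exact pow_le_pow_left₀ (abs_nonneg _) (abs_real_inner_le_norm _ _) 2
      have h3 := sq_nonneg ‖psgdIter K X y θ₀ τ ψ - v‖
      nlinarith
    rw [expectedSqError]
    simp_rw [hz]
    rw [integral_zero]
    have : 0 ≤ (1 - δ) ^ τ := pow_nonneg (by linarith) _
    positivity
  have hS0 : 0 < frobSq X := lt_of_lt_of_le (by positivity) hS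
  have := isProbabilityMeasure_rowLaw hS0
  have hα1 : m ^ 2 / frobSq X ≤ 1 := (div_le_one hS0).2 hS
  have hrec : ∀ τ, expectedSqError K X y θ₀ v (τ + 1)
      ≤ (1 - m ^ 2 / frobSq X) * expectedSqError K X y θ₀ v τ + W / frobSq X := by
    intro τ
    have e : expectedSqError K X y θ₀ v (τ + 1) = ∫ ψ, ∑ i, ‖rowVec X i‖ ^ 2 / frobSq X *
        ‖psgdStep K X y i (psgdIter K X y θ₀ τ ψ) - v‖ ^ 2
          ∂(Measure.pi fun _ : Fin τ => rowLaw X) :=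
      integral_psgd_succ X τ fun ψ i => ‖psgdStep K X y i (psgdIter K X y θ₀ τ ψ) - v‖ ^ 2
    have e2 : (1 - m ^ 2 / frobSq X) * expectedSqError K X y θ₀ v τ + W / frobSq X
        = ∫ ψ, ((1 - m ^ 2 / frobSq X) * ‖psgdIter K X y θ₀ τ ψ - v‖ ^ 2 + W / frobSq X)
          ∂(Measure.pi fun _ : Fin τ => rowLaw X) := by
      rw [integral_add Integrable.of_finite Integrable.of_finite, integral_const_mul,
        integral_const, probReal_univ, one_smul, expectedSqError]
    rw [e, e2]
    refine integral_mono Integrable.of_finite Integrable.of_finite fun ψ => ?_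
    set θ := psgdIter K X y θ₀ τ ψ with hθ
    have h1 : ∀ i, ‖rowVec X i‖ ^ 2 / frobSq X * ‖psgdStep K X y i θ - v‖ ^ 2
        ≤ (‖rowVec X i‖ ^ 2 * ‖θ - v‖ ^ 2 - ⟪rowVec X i, θ - v⟫ ^ 2
          + (y i - ⟪rowVec X i, v⟫) ^ 2) / frobSq X := by
      intro i
      rw [div_mul_eq_mul_div]
      exact div_le_div_of_nonneg_right (sq_mul_norm_psgdStep_sub_le hcl hcv hv X y i θ) hS0.le
    refine (Finset.sum_le_sum fun i _ => h1 i).trans ?_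
    rw [← Finset.sum_div, Finset.sum_add_distrib, Finset.sum_sub_distrib, ← Finset.sum_mul,
      ← frobSq, ← hW, div_le_iff₀ hS0]
    have h2 := hinv τ ψ
    rw [← hθ] at h2
    have h3 : ((1 - m ^ 2 / frobSq X) * ‖θ - v‖ ^ 2 + W / frobSq X) * frobSq X
        = frobSq X * ‖θ - v‖ ^ 2 - m ^ 2 * ‖θ - v‖ ^ 2 + W := by field_simp
    rw [h3]
    linarith
  have hbound : ∀ τ, expectedSqError K X y θ₀ v τ
      ≤ (1 - m ^ 2 / frobSq X) ^ τ * ‖θ₀ - v‖ ^ 2 + W / m ^ 2 := by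
    intro τ
    induction τ with
    | zero =>
      have : expectedSqError K X y θ₀ v 0 = ‖θ₀ - v‖ ^ 2 := by
        simp [expectedSqError, psgdIter]
      rw [this, pow_zero, one_mul]
      have : 0 ≤ W / m ^ 2 := by positivity
      linarith
    | succ τ ih =>
      refine (hrec τ).trans ?_
      have h1 := mul_le_mul_of_nonneg_left ih (sub_nonneg.2 hα1)
      -- The noise floor W/m² is the fixed point of the affine recursion `hrec`.
      have h2 : (1 - m ^ 2 / frobSq X) * (W / m ^ 2) + W / frobSq X = W / m ^ 2 := by
        field_simp; ring
      rw [mul_add] at h1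
      rw [pow_succ' (1 - m ^ 2 / frobSq X), mul_assoc]
      linarith
  refine (hbound τ).trans ?_
  gcongr
  · rwa [le_div_iff₀ hS0]

end Descent

/-! ### The Gaussian matrix as a Gaussian vector of its entries. -/

section GaussianMatrix

variable {n p : ℕ}

/-- The entries of a matrix as a Euclidean vector. -/
noncomputable def entriesVec (X : Matrix (Fin n) (Fin p) ℝ) : EuclideanSpace ℝ (Fin n × Fin p) :=
  WithLp.toLp 2 fun ij => X ij.1 ij.2

lemma matVec_entriesVec (X : Matrix (Fin n) (Fin p) ℝ) (e : Vec p) (i : Fin n) :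
    matVec e (entriesVec X) i = ⟪rowVec X i, e⟫ := by
  simp [entriesVec, rowVec, PiLp.inner_apply, mul_comm]

lemma norm_matVec_entriesVec_sq (X : Matrix (Fin n) (Fin p) ℝ) (e : Vec p) :
    ‖matVec e (entriesVec X)‖ ^ 2 = ∑ i, ⟪rowVec X i, e⟫ ^ 2 := by
  rw [EuclideanSpace.real_norm_sq_eq]
  simp_rw [matVec_entriesVec]

lemma norm_entriesVec_sq (X : Matrix (Fin n) (Fin p) ℝ) : ‖entriesVec X‖ ^ 2 = frobSq X := by
  rw [EuclideanSpace.real_norm_sq_eq, frobSq, Fintype.sum_prod_type]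
  simp_rw [EuclideanSpace.real_norm_sq_eq]
  rfl

lemma map_matVec_stdGaussian {θ : Vec p} (hθ : ‖θ‖ = 1) :
    (stdGaussian (EuclideanSpace ℝ (Fin n × Fin p))).map (matVec θ) = stdGaussian (Vec n) := by
  refine map_stdGaussian_of_norm_adjoint (matVec θ)
    (fun t => (WithLp.toLp 2 fun ij => t ij.1 * θ ij.2 : EuclideanSpace ℝ (Fin n × Fin p)))
    (fun x t => ?_) fun t => ?_
  · simp only [PiLp.inner_apply, matVec_apply, RCLike.inner_apply, conj_trivial,
      Fintype.sum_prod_type, Finset.mul_sum]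
    exact Finset.sum_congr rfl fun i _ => Finset.sum_congr rfl fun j _ => by ring
  · rw [← sq_eq_sq₀ (norm_nonneg _) (norm_nonneg _), EuclideanSpace.real_norm_sq_eq,
      EuclideanSpace.real_norm_sq_eq, Fintype.sum_prod_type]
    simp_rw [mul_pow, ← Finset.mul_sum, ← EuclideanSpace.real_norm_sq_eq θ, hθ]
    simp

lemma hasLaw_entriesVec {Ω : Type*} [MeasurableSpace Ω] {P : Measure Ω} [IsProbabilityMeasure P]
    {X : Ω → Matrix (Fin n) (Fin p) ℝ}
    (hX : ∀ i j, HasLaw (fun ω => X ω i j) (gaussianReal 0 1) P)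
    (hind : iIndepFun (fun (ij : Fin n × Fin p) (ω : Ω) => X ω ij.1 ij.2) P) :
    HasLaw (fun ω => entriesVec (X ω)) (stdGaussian (EuclideanSpace ℝ (Fin n × Fin p))) P := by
  have hm : ∀ ij : Fin n × Fin p, AEMeasurable (fun ω => X ω ij.1 ij.2) P := fun ij =>
    (hX ij.1 ij.2).aemeasurable
  have hm2 : AEMeasurable (fun ω => fun ij : Fin n × Fin p => X ω ij.1 ij.2) P :=
    aemeasurable_pi_lambda _ hm
  have h := (iIndepFun_iff_map_fun_eq_pi_map hm).1 hind
  simp_rw [(hX _ _).map_eq] at h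
  have hT : Measurable (WithLp.toLp 2 : (Fin n × Fin p → ℝ) → EuclideanSpace ℝ (Fin n × Fin p)) :=
    by fun_prop
  refine ⟨hT.comp_aemeasurable hm2, ?_⟩
  rw [← map_pi_eq_stdGaussian, ← h, AEMeasurable.map_map_of_aemeasurable hT.aemeasurable hm2]
  rfl

/-- A lower bound on unit vectors of a cone extends to the whole cone. -/
lemma sq_mul_norm_sq_le_of_forall_unit {C : Set (Vec p)}
    (hC : ∀ z ∈ C, ∀ a : ℝ, 0 ≤ a → a • z ∈ C) {m : ℝ} (hm : 0 ≤ m)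
    {X : Matrix (Fin n) (Fin p) ℝ}
    (h : ∀ z ∈ C, ‖z‖ = 1 → m ≤ ‖matVec z (entriesVec X)‖) {e : Vec p} (he : e ∈ C) :
    m ^ 2 * ‖e‖ ^ 2 ≤ ∑ i, ⟪rowVec X i, e⟫ ^ 2 := by
  rcases eq_or_ne e 0 with rfl | h0
  · simp
  have hn : 0 < ‖e‖ := norm_pos_iff.2 h0
  have h1 := h (‖e‖⁻¹ • e) (hC e he _ (by positivity)) (by
    rw [norm_smul, norm_inv, norm_norm, inv_mul_cancel₀ hn.ne'])
  have h2 := pow_le_pow_left₀ hm h1 2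
  rw [norm_matVec_entriesVec_sq] at h2
  simp_rw [inner_smul_right, mul_pow] at h2
  rw [← Finset.mul_sum, inv_pow, inv_mul_eq_div, le_div_iff₀ (by positivity)] at h2
  exact h2

/-- The residual of y at μθ is f(g) - μg with g = Xθ. For unit θ this g is standard Gaussian, which
links the residual to p(η). -/
lemma norm_effectiveNoise_sq (f : ℝ → ℝ) (X : Matrix (Fin n) (Fin p) ℝ) (θ : Vec p) :
    ‖effectiveNoise f (matVec θ (entriesVec X))‖ ^ 2
      = ∑ i, (observations f X θ i - ⟪rowVec X i, meanTerm f • θ⟫) ^ 2 := by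
  rw [EuclideanSpace.real_norm_sq_eq]
  refine Finset.sum_congr rfl fun i _ => ?_
  rw [observations, inner_smul_right, ← matVec_entriesVec]
  rfl

end GaussianMatrix

/-! ### The defining equation of n₀. -/

section MinimalSamples

variable {p : ℕ} {C : Set (Vec p)} {t : ℝ}

lemma minimalSamples_spec (h0 : 0 ∈ C) (ht : 0 ≤ t) :
    0 ≤ minimalSamples C t ∧
      phi (minimalSamples C t) = gaussianWidth (C ∩ Metric.closedBall 0 1) + t := by
  have h := exists_phi_eq (add_nonneg (gaussianWidth_nonneg
    (S := C ∩ Metric.closedBall 0 1) Set.inter_subset_right ⟨h0, by simp⟩) ht)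
  exact ⟨Function.invFunOn_mem h, Function.invFunOn_eq h⟩

end MinimalSamples

/-! ### Assembly of the deterministic bound and the probabilistic estimates. -/

/-- The error bound on the event where the restricted smallest singular value, the Frobenius
norm and the noise are controlled. -/
lemma expectedSqError_le_of_good {n p : ℕ} {f : ℝ → ℝ} {R : Vec p → ℝ} {θstar θ₀ : Vec p}
    {C : Set (Vec p)} {t η : ℝ} (hR : ConvexOn ℝ Set.univ R)
    (hC : IsDescentCone R (meanTerm f • θstar) C) (ht : 0 ≤ t) (hp : 0 < p)
    (hn : minimalSamples C t < n) (X : Matrix (Fin n) (Fin p) ℝ)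
    (hcone : ∀ z ∈ C, ‖z‖ = 1 → meanNorm n - gaussianWidth (C ∩ Metric.closedBall 0 1) - t
      ≤ ‖matVec z (entriesVec X)‖)
    (hinit : R (meanTerm f • θstar) < R θ₀ → (meanNorm n - t) ^ 2 * ‖θ₀ - meanTerm f • θstar‖ ^ 2
      ≤ ∑ i, ⟪rowVec X i, θ₀ - meanTerm f • θstar⟫ ^ 2)
    (hfrob : ‖entriesVec X‖ ≤ 1.125 * √(n * p))
    (hnoise : ‖effectiveNoise f (matVec θstar (entriesVec X))‖ ≤ η * meanNorm n * sigmaTerm f)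
    (τ : ℕ) :
    expectedSqError {θ | R θ ≤ R (meanTerm f • θstar)} X (observations f X θstar) θ₀
        (meanTerm f • θstar) τ ≤
      (1 - (1 - √(minimalSamples C t / n)) ^ 2 / (2 * p)) ^ τ * ‖θ₀ - meanTerm f • θstar‖ ^ 2
        + 1.01 / (1 - √(minimalSamples C t / n)) ^ 2 * η ^ 2 * sigmaTerm f ^ 2 := by
  set v := meanTerm f • θstar with hv
  have hC0 : (0 : Vec p) ∈ C := hC.descentSet_subset (by simp [descentSet])
  obtain ⟨hn0, hphi⟩ := minimalSamples_spec hC0 ht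
  have hnpos : (0 : ℝ) < n := hn0.trans_lt hn
  have hn1 : 0 < n := by exact_mod_cast hnpos
  have hp1 : (1 : ℝ) ≤ p := by exact_mod_cast hp
  set r := √(minimalSamples C t / n) with hr
  have hr0 : 0 ≤ r := Real.sqrt_nonneg _
  have hr1 : r < 1 := by
    rw [hr, Real.sqrt_lt' one_pos, one_pow, div_lt_one hnpos]; exact hn
  set b := meanNorm n with hb
  have hbphi : b = phi n := meanNorm_eq_phi hn1
  have hb0 : 0 < b := hbphi ▸ phi_pos hnpos
  have hb2 : 2 / Real.pi * n ≤ b ^ 2 := by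
    rw [hbphi]; exact two_div_pi_mul_le_phi_sq (by exact_mod_cast hn1)
  set m := b - gaussianWidth (C ∩ Metric.closedBall 0 1) - t with hm
  have hmb : b * (1 - r) ≤ m := by
    have := phi_le_sqrt_mul_phi hn0 hnpos hn.le
    rw [hphi, ← hbphi] at this
    rw [hm]
    linarith
  have hbr : 0 < b * (1 - r) := mul_pos hb0 (by linarith)
  have hm0 : 0 < m := hbr.trans_le hmb
  have hw0 : 0 ≤ gaussianWidth (C ∩ Metric.closedBall 0 1) :=
    gaussianWidth_nonneg Set.inter_subset_right ⟨hC0, by simp⟩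
  have hm2 : b ^ 2 * (1 - r) ^ 2 ≤ m ^ 2 := by
    rw [← mul_pow]; exact pow_le_pow_left₀ hbr.le hmb 2
  -- The number is 1.125²/2: with ‖X‖_F² ≤ 1.125² np and b_n² ≥ (2/π)n, it gives (1 - r)²/(2p) ·
  -- ‖X‖_F² ≤ m².
  have hpi : 0.6328125 ≤ 2 / Real.pi := by
    rw [le_div_iff₀ Real.pi_pos]; linarith [Real.pi_lt_d2]
  -- A finite convex function on a finite-dimensional space is continuous.
  have hcl : IsClosed {θ | R θ ≤ R v} :=
    isClosed_le hR.locallyLipschitz.continuous continuous_const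
  have hcv : Convex ℝ {θ | R θ ≤ R v} := by simpa using hR.convex_le (R v)
  have hK : ∀ θ, R θ ≤ R v → m ^ 2 * ‖θ - v‖ ^ 2 ≤ ∑ i, ⟪rowVec X i, θ - v⟫ ^ 2 := by
    intro θ hθ
    refine sq_mul_norm_sq_le_of_forall_unit hC.smul_mem hm0.le hcone (hC.descentSet_subset ?_)
    simpa [descentSet] using hθ
  have hfro : frobSq X ≤ 1.265625 * (n * p) := by
    rw [← norm_entriesVec_sq]
    refine (pow_le_pow_left₀ (norm_nonneg _) hfrob 2).trans ?_
    rw [mul_pow, Real.sq_sqrt (by positivity)]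
    norm_num
  have hδ1 : (1 - r) ^ 2 / (2 * p) ≤ 1 := by
    rw [div_le_one (by positivity)]
    nlinarith
  refine (expectedSqError_le hcl hcv (show v ∈ {θ | R θ ≤ R v} from le_refl (R v)) X
    (observations f X θstar) θ₀ hm0 hδ1 ?_ hK ?_ τ).trans (add_le_add le_rfl ?_)
  · have h1 : (1 - r) ^ 2 / (2 * p) * frobSq X ≤ (1 - r) ^ 2 / (2 * p) * (1.265625 * (n * p)) := by
      gcongr
    refine h1.trans (le_trans ?_ hm2)
    have h2 : (1 - r) ^ 2 / (2 * p) * (1.265625 * (n * p)) = (0.6328125 * n) * (1 - r) ^ 2 := by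
      field_simp
      norm_num
      ring
    rw [h2]
    gcongr
    exact le_trans (by gcongr) hb2
  · rcases le_or_gt (R θ₀) (R v) with h | h
    · exact hK θ₀ h
    · refine le_trans ?_ (hinit h)
      gcongr
      linarith
  · rw [← norm_effectiveNoise_sq]
    have h1 := pow_le_pow_left₀ (norm_nonneg _) hnoise 2
    have hr2 : 0 < (1 - r) ^ 2 := pow_pos (by linarith) 2
    calc _ ≤ (η * b * sigmaTerm f) ^ 2 / (b ^ 2 * (1 - r) ^ 2) := by gcongr
      _ = 1 / (1 - r) ^ 2 * (η ^ 2 * sigmaTerm f ^ 2) := by field_simp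
      _ ≤ 1.01 / (1 - r) ^ 2 * (η ^ 2 * sigmaTerm f ^ 2) := by gcongr; norm_num
      _ = _ := by ring

/-- If every outcome outside of `A` lies in one of three sets, then `A` is likely. -/
lemma one_sub_le_measureReal_of_univ_subset {Ω : Type*} [MeasurableSpace Ω] (P : Measure Ω)
    [IsProbabilityMeasure P] {A B₁ B₂ B₃ : Set Ω} {b₁ b₂ b₃ : ℝ}
    (h : ∀ ω, ω ∉ B₁ → ω ∉ B₂ → ω ∉ B₃ → ω ∈ A) (h₁ : P.real B₁ ≤ b₁) (h₂ : P.real B₂ ≤ b₂)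
    (h₃ : P.real B₃ ≤ b₃) : 1 - b₁ - b₂ - b₃ ≤ P.real A := by
  have hsub : (Set.univ : Set Ω) ⊆ A ∪ (B₁ ∪ (B₂ ∪ B₃)) := by
    intro ω _
    by_contra hω
    simp only [Set.mem_union, not_or] at hω
    exact hω.1 (h ω hω.2.1 hω.2.2.1 hω.2.2.2)
  have h1 := measureReal_mono (μ := P) hsub
  rw [probReal_univ] at h1
  have h2 := measureReal_union_le (μ := P) A (B₁ ∪ (B₂ ∪ B₃))
  have h3 := measureReal_union_le (μ := P) B₁ (B₂ ∪ B₃)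
  have h4 := measureReal_union_le (μ := P) B₂ B₃
  linarith

/-- Only an inequality is claimed, so `s` need not be measurable. Upper bounds on bad events require
no more. -/
lemma ProbabilityTheory.HasLaw.measureReal_preimage_le {Ω 𝓧 : Type*} [MeasurableSpace Ω]
    [MeasurableSpace 𝓧]
    {P : Measure Ω} {μ : Measure 𝓧} [IsFiniteMeasure μ] {Y : Ω → 𝓧} (hY : HasLaw Y μ P)
    (s : Set 𝓧) : P.real (Y ⁻¹' s) ≤ μ.real s := by
  rw [measureReal_def, measureReal_def]
  refine ENNReal.toReal_mono (measure_ne_top _ _) ?_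
  rw [← hY.map_eq]
  exact Measure.le_map_apply hY.aemeasurable s

theorem theorem2 :
    ∃ c : ℝ, 0 < c ∧
      ∀ (n p : ℕ) (f : ℝ → ℝ) (R : Vec p → ℝ) (θstar θ₀ : Vec p) (C : Set (Vec p)) (t η : ℝ)
        (Ω : Type*) (_ : MeasurableSpace Ω) (P : Measure Ω) (_ : IsProbabilityMeasure P)
        (X : Ω → Matrix (Fin n) (Fin p) ℝ),
        -- the nonlinearity, with finite nonlinearity parameters
        Measurable f →
        MemLp f 2 (gaussianReal 0 1) →
        MemLp (fun x => x * f x) 2 (gaussianReal 0 1) →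
        -- the unknown parameter and the regularizer
        ‖θstar‖ = 1 →
        ConvexOn ℝ Set.univ R →
        IsDescentCone R (meanTerm f • θstar) C →
        0 ≤ t →
        -- i.i.d. standard normal entries
        (∀ i j, HasLaw (fun ω => X ω i j) (gaussianReal 0 1) P) →
        iIndepFun (fun (ij : Fin n × Fin p) (ω : Ω) => X ω ij.1 ij.2) P →
        -- the number of samples
        minimalSamples C t < n →
        1 - (n + 1) * Real.exp (-c * p) - concProb f n η
            - (if R θ₀ ≤ R (meanTerm f • θstar) then 1 else 2) * Real.exp (-t ^ 2 / 2) ≤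
          P.real {ω | ∀ τ : ℕ,
            expectedSqError {θ | R θ ≤ R (meanTerm f • θstar)} (X ω)
                (observations f (X ω) θstar) θ₀ (meanTerm f • θstar) τ ≤
              (1 - (1 - √(minimalSamples C t / n)) ^ 2 / (2 * p)) ^ τ
                  * ‖θ₀ - meanTerm f • θstar‖ ^ 2
                + 1.01 / (1 - √(minimalSamples C t / n)) ^ 2 * η ^ 2 * sigmaTerm f ^ 2} := by
  -- The exponent of `stdGaussian_real_le_norm_le`, used in dimension np ≥ p.
  refine ⟨0.007, by norm_num, ?_⟩
  intro n p f R θstar θ₀ C t η Ω _ P _ X hf hf2 hxf hθ hR hC ht hX hind hn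
  have hp : 0 < p := by
    rcases Nat.eq_zero_or_pos p with rfl | hp
    · rw [Subsingleton.elim θstar 0, norm_zero] at hθ
      exact absurd hθ zero_ne_one
    · exact hp
  have hC0 : (0 : Vec p) ∈ C := hC.descentSet_subset (by simp [descentSet])
  have hnpos : (0 : ℝ) < n := (minimalSamples_spec hC0 ht).1.trans_lt hn
  have hn1 : (1 : ℝ) ≤ n := by exact_mod_cast (by exact_mod_cast hnpos : 0 < n)
  have hlaw := hasLaw_entriesVec hX hind
  set v := meanTerm f • θstar with hv
  set S : Set (Vec p) := C ∩ Metric.closedBall 0 1 with hS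
  let B₁ : Set (EuclideanSpace ℝ (Fin n × Fin p)) :=
    {x | 1.125 * √(Fintype.card (Fin n × Fin p)) ≤ ‖x‖}
  let B₂ : Set (EuclideanSpace ℝ (Fin n × Fin p)) :=
    matVec θstar ⁻¹' {g | η * meanNorm n * sigmaTerm f < ‖effectiveNoise f g‖}
  let D : Set (EuclideanSpace ℝ (Fin n × Fin p)) :=
    {x | ∃ z ∈ S, ‖z‖ = 1 ∧ ‖matVec z x‖ < meanNorm n - gaussianWidth S - t}
  have hB₁ : P.real ((fun ω => entriesVec (X ω)) ⁻¹' B₁) ≤ (n + 1) * Real.exp (-0.007 * p) := by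
    refine (hlaw.measureReal_preimage_le B₁).trans (stdGaussian_real_le_norm_le.trans ?_)
    have h1 : Real.exp (-0.007 * Fintype.card (Fin n × Fin p)) ≤ Real.exp (-0.007 * p) := by
      refine Real.exp_le_exp.2 ?_
      have : (p : ℝ) ≤ Fintype.card (Fin n × Fin p) := by
        simp only [Fintype.card_prod, Fintype.card_fin, Nat.cast_mul]
        exact le_mul_of_one_le_left p.cast_nonneg hn1
      linarith
    nlinarith [Real.exp_pos (-0.007 * (p : ℝ))]
  have hB₂ : P.real ((fun ω => entriesVec (X ω)) ⁻¹' B₂) ≤ concProb f n η := by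
    refine (hlaw.measureReal_preimage_le B₂).trans ?_
    refine le_trans ?_ (le_add_of_nonneg_right measureReal_nonneg)
    exact HasLaw.measureReal_preimage_le (Y := matVec θstar)
      ⟨(matVec θstar).continuous.aemeasurable, map_matVec_stdGaussian hθ⟩ _
  have hD : (stdGaussian (EuclideanSpace ℝ (Fin n × Fin p))).real D ≤ Real.exp (-t ^ 2 / 2) :=
    stdGaussian_real_exists_norm_matVec_lt Set.inter_subset_right ht
  have hfrobOf : ∀ x, x ∉ B₁ → ‖x‖ ≤ 1.125 * √(n * p) := by
    intro x hx
    have h1 : ‖x‖ ≤ 1.125 * √(Fintype.card (Fin n × Fin p)) := le_of_not_ge hx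
    rwa [Fintype.card_prod, Fintype.card_fin, Fintype.card_fin, Nat.cast_mul] at h1
  have hconeOf : ∀ x, x ∉ D → ∀ z ∈ C, ‖z‖ = 1 → meanNorm n - gaussianWidth S - t
      ≤ ‖matVec z x‖ := by
    intro x hx z hz hz1
    by_contra hlt
    exact hx ⟨z, ⟨hz, by simp [hz1]⟩, hz1, not_le.1 hlt⟩
  split_ifs with hθ₀
  · rw [one_mul]
    refine one_sub_le_measureReal_of_univ_subset P (fun ω h₁ h₂ h₃ τ => ?_) hB₁ hB₂
      ((hlaw.measureReal_preimage_le D).trans hD)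
    refine expectedSqError_le_of_good hR hC ht hp hn (X ω) (hconeOf _ h₃)
      (fun h => absurd hθ₀ (not_le.2 h)) (hfrobOf _ h₁) (not_lt.1 h₂) τ
  -- The initial error may lie outside C. Its normalisation `u` is a fixed direction, so the escape
  -- theorem for the singleton `{u}`, of width zero, gives ‖Xu‖ ≥ b_n - t at the cost of a second
  -- exp(-t²/2).
  · set e := θ₀ - v with he
    have he0 : 0 < ‖e‖ := by
      refine norm_pos_iff.2 fun h => hθ₀ ?_
      rw [sub_eq_zero.1 h]
    set u := ‖e‖⁻¹ • e with hu
    have hu1 : ‖u‖ = 1 := by rw [hu, norm_smul, norm_inv, norm_norm, inv_mul_cancel₀ he0.ne']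
    let D' : Set (EuclideanSpace ℝ (Fin n × Fin p)) :=
      {x | ∃ z ∈ ({u} : Set (Vec p)), ‖z‖ = 1 ∧ ‖matVec z x‖ < meanNorm n - gaussianWidth {u} - t}
    have hD' : (stdGaussian (EuclideanSpace ℝ (Fin n × Fin p))).real D' ≤ Real.exp (-t ^ 2 / 2) :=
      stdGaussian_real_exists_norm_matVec_lt (by simp [hu1]) ht
    refine one_sub_le_measureReal_of_univ_subset P (fun ω h₁ h₂ h₃ τ => ?_) hB₁ hB₂
      ((hlaw.measureReal_preimage_le (D ∪ D')).trans ((measureReal_union_le _ _).trans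
        (by linarith)))
    have h₄ : entriesVec (X ω) ∉ D := fun h => h₃ (Or.inl h)
    have h₅ : entriesVec (X ω) ∉ D' := fun h => h₃ (Or.inr h)
    refine expectedSqError_le_of_good hR hC ht hp hn (X ω) (hconeOf _ h₄) (fun _ => ?_)
      (hfrobOf _ h₁) (not_lt.1 h₂) τ
    have h6 : meanNorm n - t ≤ ‖matVec u (entriesVec (X ω))‖ := by
      by_contra hlt
      refine h₅ ⟨u, rfl, hu1, ?_⟩
      rw [gaussianWidth_singleton, sub_zero]
      exact not_le.1 hlt
    -- Needed for squaring `h6`: t ≤ ω + t = φ(n₀) ≤ φ(n) = b_n.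
    have h7 : 0 ≤ meanNorm n - t := by
      obtain ⟨hn0, hphi⟩ := minimalSamples_spec hC0 ht
      have hw : 0 ≤ gaussianWidth (C ∩ Metric.closedBall 0 1) :=
        gaussianWidth_nonneg Set.inter_subset_right ⟨hC0, by simp⟩
      have hle := phi_le_sqrt_mul_phi hn0 hnpos hn.le
      have hr : √(minimalSamples C t / n) ≤ 1 :=
        Real.sqrt_le_one.2 ((div_le_one hnpos).2 hn.le)
      have := mul_le_of_le_one_left (phi_nonneg hnpos.le) hr
      rw [meanNorm_eq_phi (Nat.cast_pos.1 hnpos)]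
      linarith
    have h8 := pow_le_pow_left₀ h7 h6 2
    rw [norm_matVec_entriesVec_sq] at h8
    simp_rw [hu, inner_smul_right, mul_pow] at h8
    rwa [← Finset.mul_sum, inv_pow, inv_mul_eq_div, le_div_iff₀ (by positivity)] at h8
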